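/- **Theorem 3 (efficiency of the DRL value estimator).** Consider a two-player zero-sum Markov game with finite state space $\mathcal S$, finite action spaces $\mathcal A_1,\mathcal A_2$, horizon $T$, initial distribution $P_I$, transition probabilities $P_T$, reward distributions $P_R$ with mean $R$ (transitions and rewards may depend on the step $t$; the time-homogeneous game is a special case) and discount factor $\gamma\in[0,1]$. Let $\pi=(\pi_1,\pi_2)$ be a target profile and $\pi^b=(\pi^b_1,\pi^b_2)$ a behavior profile of Markov policies, $v_1=v_1(\pi_1,\pi_2)=\mathbb E_\pi[\sum_{t=1}^T\gamma^{t-1}r_t]$ and $v_2=-v_1$. Let $V_{1,T+1}=0$, $Q_{1,t}(s,a^1,a^2)=R(s,a^1,a^2)+\gamma\,\mathbb E[V_{1,t+1}(s_{t+1})\mid s_t=s,a_t^1=a^1,a_t^2=a^2]$ and $V_{1,t}(s)=\mathbb E_\pi[Q_{1,t}(s,a^1,a^2)\mid s]$. Let $p_t^{\pi}$ be the marginal distribution of $(s_t,a_t^1,a_t^2)$ under $\pi$ and $\mu_t=p_t^{\pi}/p_t^{\pi^b}$. Let $n$ i.i.d. trajectories $(s_{i,1},a^1_{i,1},a^2_{i,1},r_{i,1},\dots,s_{i,T},a^1_{i,T},a^2_{i,T},r_{i,T},s_{i,T+1})$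 be generated under $\pi^b$. Split them, independently of the data, into $K\ge1$ folds of even size ($\lfloor n/K\rfloor$ or $\lceil n/K\rceil$). For each fold $k$ let $\hat Q^{-k}_{1,t}$ and $\hat\mu^{-k}_t$ be estimators of $Q_{1,t}$ and $\mu_t$ computed from the data outside of fold $k$. Put $\hat\mu_0^{-k}=1$, $\hat V^{-k}_{1,t}(s)=\mathbb E_\pi[\hat Q^{-k}_{1,t}(s,a^1,a^2)\mid s]$ and, with $k(i)$ the fold of $i$, $$\hat v^{\mathrm{DRL}}_1=\frac1n\sum_{i=1}^n\sum_{t=1}^T\gamma^{t-1}\Big(\hat\mu_t^{-k(i)}\big(r_{i,t}-\hat Q_{1,t}^{-k(i)}\big)+\hat\mu_{t-1}^{-k(i)}\hat V_{1,t}^{-k(i)}\Big),\qquad \hat v^{\mathrm{DRL}}_2=-\hat v^{\mathrm{DRL}}_1,$$ where the estimated functions are evaluated along the $i$-th trajectory. Assume that for all $1\le t\le T$: $\pi_{1,t}\pi_{2,t}\le C\,\pi^b_{1,t}\pi^b_{2,t}$ at all states that are visited at step $t$ with positive probability under $\pi^b$; $|r_t|\le R_{\max}$ almost surely under $\pi^b$;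 $0\le\hat\mu^{-k}_t\le C^t$ and $|\hat Q^{-k}_{1,t}|\le(T+1-t)R_{\max}$. Assume further that for all $1\le t\le T$ and $1\le k\le K$ $$\|\hat Q^{-k}_{1,t}-Q_{1,t}\|_2=o_p(n^{-\alpha_1}),\qquad \|\hat\mu^{-k}_t-\mu_t\|_2=o_p(n^{-\alpha_2}),$$ where $\alpha_1>0$, $\alpha_2>0$, $\alpha_1+\alpha_2\ge1/2$ and $\|\cdot\|_2$ is the $L^2$ norm with respect to $p_t^{\pi^b}$. Then $$\sqrt n\,(\hat v^{\mathrm{DRL}}_1-v_1)\xrightarrow{d}\mathcal N(0,\Upsilon_{\mathrm{EB}}),\qquad \sqrt n\,(\hat v^{\mathrm{DRL}}_2-v_2)\xrightarrow{d}\mathcal N(0,\Upsilon_{\mathrm{EB}}),$$ where, with expectations and variances under $\pi^b$, $$\Upsilon_{\mathrm{EB}}=\mathbb V[V_{1,1}(s_1)]+\sum_{t=1}^T\mathbb E\big[\gamma^{2(t-1)}\mu_t^2\,\mathbb V[r_t+\gamma V_{1,t+1}(s_{t+1})\mid s_t,a_t^1,a_t^2]\big].$$ Moreover, $\Upsilon_{\mathrm{EB}}$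 is the semiparametric efficiency bound for $v_1$: the supremum of the Cramér–Rao bounds $(\partial_\theta v_1)^2/I$ at the truth over all one-dimensional regular parametric submodels (dominated by the true law of a trajectory and differentiable in quadratic mean, with differentiable $v_1$ and Fisher information $I$; $0/0=0$) of the nonparametric model in which the initial distribution, the transition probabilities and reward distributions of each step, and the behavior profile are unknown. -/

import Mathlib

open MeasureTheory ProbabilityTheory Filter Topology

/-- A two-player zero-sum Markov game with finite state space `S`, finite action spaces `A₁`, `A₂`
and horizon `T`. The time index `t : Fin T` is `0`-based. Transition probabilities and reward
distributions may depend on the step; a time-homogeneous game is one where they do not. -/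
structure MarkovGame (S A₁ A₂ : Type*) [Fintype S] (T : ℕ) where
  /-- initial state distribution -/
  init : S → ℝ
  init_nonneg : ∀ s, 0 ≤ init s
  init_sum : ∑ s, init s = 1
  /-- `trans t s a b s'` is the probability of moving from `s` to `s'` under the actions `a, b` -/
  trans : Fin T → S → A₁ → A₂ → S → ℝ
  trans_nonneg : ∀ t s a b s', 0 ≤ trans t s a b s'
  trans_sum : ∀ t s a b, ∑ s', trans t s a b s' = 1
  /-- distribution of the reward of player 1 (player 2 receives the opposite reward) -/
  reward : Fin T → S → A₁ → A₂ → Measure ℝ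
  reward_prob : ∀ t s a b, IsProbabilityMeasure (reward t s a b)

/-- A Markov policy: for each step and state a probability vector on the actions. -/
structure MarkovPolicy (S A : Type*) [Fintype A] (T : ℕ) where
  prob : Fin T → S → A → ℝ
  prob_nonneg : ∀ t s a, 0 ≤ prob t s a
  prob_sum : ∀ t s, ∑ a, prob t s a = 1

/-- A policy profile: a Markov policy for each player. -/
structure PolicyProfile (S A₁ A₂ : Type*) [Fintype A₁] [Fintype A₂] (T : ℕ) where
  fst : MarkovPolicy S A₁ T
  snd : MarkovPolicy S A₂ T

/-- Trajectories `(s_1, …, s_{T+1}), (a_1^1, …, a_T^1), (a_1^2, …, a_T^2), (r_1, …, r_T)`. -/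
abbrev Trajectory (S A₁ A₂ : Type*) (T : ℕ) : Type _ :=
  (Fin (T + 1) → S) × (Fin T → A₁) × (Fin T → A₂) × (Fin T → ℝ)

namespace Trajectory

variable {S A₁ A₂ : Type*} {T : ℕ}

/-- The state at which the actions of step `t` are taken. -/
def state (τ : Trajectory S A₁ A₂ T) (t : Fin T) : S := τ.1 t.castSucc

/-- The state reached after step `t`. -/
def nextState (τ : Trajectory S A₁ A₂ T) (t : Fin T) : S := τ.1 t.succ

/-- The action of player 1 at step `t`. -/
def act₁ (τ : Trajectory S A₁ A₂ T) (t : Fin T) : A₁ := τ.2.1 t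

/-- The action of player 2 at step `t`. -/
def act₂ (τ : Trajectory S A₁ A₂ T) (t : Fin T) : A₂ := τ.2.2.1 t

/-- The reward of player 1 at step `t`. -/
def rew (τ : Trajectory S A₁ A₂ T) (t : Fin T) : ℝ := τ.2.2.2 t

/-- The first state. -/
def initState (τ : Trajectory S A₁ A₂ T) : S := τ.1 0

end Trajectory

/-- The probability with which a profile plays the pair of actions `(a, b)` at step `t` in `s`. -/
def PolicyProfile.prob {S A₁ A₂ : Type*} [Fintype A₁] [Fintype A₂] {T : ℕ}
    (π : PolicyProfile S A₁ A₂ T) (t : Fin T) (s : S) (a : A₁) (b : A₂) : ℝ :=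
  π.fst.prob t s a * π.snd.prob t s b

namespace MarkovGame

variable {S A₁ A₂ : Type*} [Fintype S] [Fintype A₁] [Fintype A₂] {T : ℕ}

/-- The law of a trajectory when the profile `π` is played:
`P_I(s_1) ∏_t π_{1,t}(a_t^1 | s_t) π_{2,t}(a_t^2 | s_t) P_R(r_t | s_t, a_t) P_T(s_{t+1} | s_t, a_t)`.
-/
noncomputable def trajLaw [MeasurableSpace S] [MeasurableSpace A₁] [MeasurableSpace A₂]
    (G : MarkovGame S A₁ A₂ T) (π : PolicyProfile S A₁ A₂ T) :
    Measure (Trajectory S A₁ A₂ T) := by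
  classical
  exact ∑ s : Fin (T + 1) → S, ∑ a : Fin T → A₁, ∑ b : Fin T → A₂,
    ENNReal.ofReal (G.init (s 0) * ∏ t : Fin T, (π.prob t (s t.castSucc) (a t) (b t) *
      G.trans t (s t.castSucc) (a t) (b t) (s t.succ))) •
    (Measure.pi fun t : Fin T => G.reward t (s t.castSucc) (a t) (b t)).map
      (fun r => (s, a, b, r))

/-- The discounted value of the profile `π` for player 1 (that for player 2 is its opposite). -/
noncomputable def value [MeasurableSpace S] [MeasurableSpace A₁] [MeasurableSpace A₂]
    (G : MarkovGame S A₁ A₂ T) (γ : ℝ) (π : PolicyProfile S A₁ A₂ T) : ℝ :=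
  ∫ τ, ∑ t : Fin T, γ ^ (t : ℕ) * τ.rew t ∂(G.trajLaw π)

/-- The mean reward. -/
noncomputable def meanReward (G : MarkovGame S A₁ A₂ T) (t : Fin T) (s : S) (a : A₁) (b : A₂) : ℝ :=
  ∫ r, r ∂(G.reward t s a b)

/-- The state value function of player 1, by backward recursion from the value `0` after the last
step. -/
noncomputable def stateValue (G : MarkovGame S A₁ A₂ T) (γ : ℝ) (π : PolicyProfile S A₁ A₂ T)
    (t : Fin (T + 1)) : S → ℝ :=
  Fin.reverseInduction (motive := fun _ => S → ℝ) (fun _ => 0)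
    (fun t V s => ∑ a, ∑ b, π.prob t s a b *
      (G.meanReward t s a b + γ * ∑ s', G.trans t s a b s' * V s')) t

/-- The state-action value function of player 1. -/
noncomputable def qValue (G : MarkovGame S A₁ A₂ T) (γ : ℝ) (π : PolicyProfile S A₁ A₂ T)
    (t : Fin T) (s : S) (a : A₁) (b : A₂) : ℝ :=
  G.meanReward t s a b + γ * ∑ s', G.trans t s a b s' * G.stateValue γ π t.succ s'

/-- The marginal distribution of the state under the profile `π`. -/
noncomputable def stateMarginal (G : MarkovGame S A₁ A₂ T) (π : PolicyProfile S A₁ A₂ T)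
    (t : Fin (T + 1)) : S → ℝ :=
  Fin.induction (motive := fun _ => S → ℝ) G.init
    (fun t p s' => ∑ s, ∑ a, ∑ b, G.trans t s a b s' * (π.prob t s a b * p s)) t

/-- The marginal state-action distribution `p_t^π`. -/
noncomputable def marginal (G : MarkovGame S A₁ A₂ T) (π : PolicyProfile S A₁ A₂ T)
    (t : Fin T) (s : S) (a : A₁) (b : A₂) : ℝ :=
  π.prob t s a b * G.stateMarginal π t.castSucc s

/-- The marginal density ratio `μ_t = p_t^π / p_t^{πb}`. -/
noncomputable def marginalRatio (G : MarkovGame S A₁ A₂ T) (πb π : PolicyProfile S A₁ A₂ T)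
    (t : Fin T) (s : S) (a : A₁) (b : A₂) : ℝ :=
  G.marginal π t s a b / G.marginal πb t s a b

/-- The `L²` norm of a function of `(s_t, a_t^1, a_t^2)` under the behavior profile `πb`. -/
noncomputable def l2Norm (G : MarkovGame S A₁ A₂ T) (πb : PolicyProfile S A₁ A₂ T)
    (t : Fin T) (f : S → A₁ → A₂ → ℝ) : ℝ :=
  √(∑ s, ∑ a, ∑ b, G.marginal πb t s a b * f s a b ^ 2)

/-- The number
`Υ_EB = Var[V_1(s_1)] + ∑_t E[γ^{2(t-1)} μ_t² Var[r_t + γ V_{t+1}(s_{t+1}) | s_t, a_t^1, a_t^2]]`,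
for trajectories generated by the behavior profile `πb`. -/
noncomputable def upsilonEB [MeasurableSpace S] [MeasurableSpace A₁] [MeasurableSpace A₂]
    (G : MarkovGame S A₁ A₂ T) (γ : ℝ) (πb π : PolicyProfile S A₁ A₂ T) : ℝ :=
  Var[fun τ => G.stateValue γ π 0 τ.initState; G.trajLaw πb] +
    ∑ t : Fin T, ∫ τ, γ ^ (2 * (t : ℕ)) *
      G.marginalRatio πb π t (τ.state t) (τ.act₁ t) (τ.act₂ t) ^ 2 *
      (Var[fun τ' => τ'.rew t + γ * G.stateValue γ π t.succ (τ'.nextState t); G.trajLaw πb |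
        MeasurableSpace.comap
          (fun τ' : Trajectory S A₁ A₂ T => (τ'.state t, τ'.act₁ t, τ'.act₂ t)) inferInstance]) τ
      ∂(G.trajLaw πb)

/-- A regular one-dimensional parametric submodel of the nonparametric model of all Markov games and
behavior profiles, through the true game `G` and the true behavior profile `πb`. The laws of the
data in it are dominated by the true law and differentiable in quadratic mean at the truth with
score `score`, and the value of the target profile `π` is differentiable at the truth. -/
structure RegularSubmodel [MeasurableSpace S] [MeasurableSpace A₁] [MeasurableSpace A₂]
    (G : MarkovGame S A₁ A₂ T) (γ : ℝ) (πb π : PolicyProfile S A₁ A₂ T) where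
  game : ℝ → MarkovGame S A₁ A₂ T
  behavior : ℝ → PolicyProfile S A₁ A₂ T
  game_zero : game 0 = G
  behavior_zero : behavior 0 = πb
  density : ℝ → Trajectory S A₁ A₂ T → ℝ
  density_nonneg : ∀ θ τ, 0 ≤ density θ τ
  density_measurable : ∀ θ, Measurable (density θ)
  law_eq : ∀ᶠ θ in 𝓝 0, (game θ).trajLaw (behavior θ) =
    (G.trajLaw πb).withDensity fun τ => ENNReal.ofReal (density θ τ)
  score : Trajectory S A₁ A₂ T → ℝ
  score_memLp : MemLp score 2 (G.trajLaw πb)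
  quadratic_mean : Tendsto (fun θ : ℝ =>
    (∫ τ, (√(density θ τ) - 1 - θ / 2 * score τ) ^ 2 ∂(G.trajLaw πb)) / θ ^ 2) (𝓝[≠] 0) (𝓝 0)
  valueDeriv : ℝ
  hasDerivAt_value : HasDerivAt (fun θ => (game θ).value γ π) valueDeriv 0

/-- The Cramér–Rao bound `(dv/dθ)² / I` of a submodel, with values in `[0, ∞]`
(`0 / 0 = 0`, and `c / 0 = ∞` for `c > 0`). -/
noncomputable def RegularSubmodel.cramerRao
    [MeasurableSpace S] [MeasurableSpace A₁] [MeasurableSpace A₂]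
    {G : MarkovGame S A₁ A₂ T} {γ : ℝ} {πb π : PolicyProfile S A₁ A₂ T}
    (M : RegularSubmodel G γ πb π) : ENNReal :=
  ENNReal.ofReal (M.valueDeriv ^ 2) / ENNReal.ofReal (∫ τ, M.score τ ^ 2 ∂(G.trajLaw πb))

/-- The semiparametric efficiency bound for the value of the target profile `π`: the supremum of the
Cramér–Rao bounds over the regular parametric submodels. -/
noncomputable def efficiencyBound [MeasurableSpace S] [MeasurableSpace A₁] [MeasurableSpace A₂]
    (G : MarkovGame S A₁ A₂ T) (γ : ℝ) (πb π : PolicyProfile S A₁ A₂ T) : ENNReal :=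
  ⨆ M : RegularSubmodel G γ πb π, M.cramerRao

end MarkovGame

/-- For each sample size `n`, partition `p` of the sample into `K` folds and fold `k`, an estimator
of a function of `(t, s_t, a_t^1, a_t^2)`, computed from the data outside of fold `k`. -/
abbrev CrossFitEstimator (S A₁ A₂ : Type*) (T K : ℕ) : Type _ :=
  (n : ℕ) → (p : Fin n → Fin K) → (k : Fin K) →
    ({j : Fin n // p j ≠ k} → Trajectory S A₁ A₂ T) → Fin T → S → A₁ → A₂ → ℝ

section Estimator

variable {S A₁ A₂ : Type*} [Fintype A₁] [Fintype A₂] {T : ℕ}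

/-- The ratio of the previous step along a trajectory, `μ_{t-1}(s_{t-1}, a_{t-1})`, with `μ_0 = 1`.
-/
noncomputable def prevRatio (μ : Fin T → S → A₁ → A₂ → ℝ) (τ : Trajectory S A₁ A₂ T)
    (t : Fin T) : ℝ :=
  if (t : ℕ) = 0 then 1
  else
    let u : Fin T := ⟨(t : ℕ) - 1, lt_of_le_of_lt (Nat.sub_le _ _) t.isLt⟩
    μ u (τ.state u) (τ.act₁ u) (τ.act₂ u)

/-- `∑_t γ^{t-1} (μ_t (r_t - Q_t) + μ_{t-1} V_t)` along a trajectory, where `V_t` is the mean of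
`Q_t(s_t, ·)` under the target profile `π`. -/
noncomputable def drlSummand (γ : ℝ) (π : PolicyProfile S A₁ A₂ T)
    (Q μ : Fin T → S → A₁ → A₂ → ℝ) (τ : Trajectory S A₁ A₂ T) : ℝ :=
  ∑ t : Fin T, γ ^ (t : ℕ) *
    (μ t (τ.state t) (τ.act₁ t) (τ.act₂ t) *
        (τ.rew t - Q t (τ.state t) (τ.act₁ t) (τ.act₂ t)) +
      prevRatio μ τ t *
        ∑ a, ∑ b, π.prob t (τ.state t) a b * Q t (τ.state t) a b)

/-- The cross-fitted double reinforcement learning estimator of the value for player 1, from the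
sample `D` partitioned into folds by `p`. -/
noncomputable def drlEstimator {K : ℕ} (γ : ℝ) (π : PolicyProfile S A₁ A₂ T)
    (Qhat μhat : CrossFitEstimator S A₁ A₂ T K) (n : ℕ) (p : Fin n → Fin K)
    (D : Fin n → Trajectory S A₁ A₂ T) : ℝ :=
  (1 / (n : ℝ)) * ∑ i : Fin n,
    drlSummand γ π (Qhat n p (p i) fun j => D j) (μhat n p (p i) fun j => D j) (D i)

end Estimator

/-! Shifting the index of the terms with the previous ratio turns the summand of the estimator into
a start value plus discounted, ratio-weighted temporal differences `r_t + γ V(s_{t+1}) - Q(s_t,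
a_t)` (`drlSummand_eq`). Both halves of the theorem rest on this form. Write ψ for the summand at
the true nuisance functions and v for the value.

Asymptotic normality. The summand is doubly robust: for arbitrary `Q` and `μ` its bias is exactly a
sum of products of an error of `μ` with an error of `Q`
(`RewardBounded.integral_drlSummand_sub_value`). This follows from a telescoping identity for the
marginals of the target profile (`sum_marginal_mul_sub`) and a change of measure. With the assumed
rates, √n times the bias is a product of two `o_p(1)` terms. The rest of the error in a fold is a
sum of terms that, given the data outside of the fold, are independent and centered, so its second
moment divided by n is at most four times the mean squared error of the summand
(`integral_sq_sum_random_fold_le`). As the spaces are finite, the `L²` norm controls the pointwise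
errors on the support (`exists_abs_le_l2Norm`), and the summand is Lipschitz in these errors; hence
that moment tends to zero. So √n times the estimation error equals the normalized sum of ψ - v up to
`o_p(1)` (`tendstoInMeasure_drlEstimator_sub`), and the central limit theorem with Slutsky's lemma
gives the limit. By the Bellman equation the true temporal differences are martingale differences,
hence uncorrelated with each other and with the start value; their second moments add up to
`upsilonEB` (`RewardBounded.variance_drlSummand`).

Efficiency. In a perturbed game the value is a start value plus true temporal differences,
integrated under the perturbed behavior law and weighted by the perturbed ratio
(`value_eq_sum_marginalRatio_mul`). These integrals vanish at the truth, so the ratio needs only to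
be continuous, and the derivative of the value is the inner product of ψ with the score
(`HasScore.hasDerivAt_value`). Scores are centered, so the Cauchy–Schwarz inequality bounds every
Cramér–Rao quotient by the variance of ψ (`RegularSubmodel.cramerRao_le`). Equality holds for a
submodel with score ψ - v. It exists because ψ - v splits into centered bounded functions of the
initial state, of the transitions and of the rewards, along which the game can be tilted linearly
with the behavior kept fixed (`efficientDirection`, `efficiencyBound_eq`). -/

set_option linter.unusedSectionVars false

/-! ### Sums over paths as products of transfer matrices -/

/-- Summing out the first state absorbs the first matrix into the start vector and leaves a path
that is shorter by one; hence the induction over arbitrary start vectors. -/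
theorem sum_paths_eq_sum_zero {S : Type*} [Fintype S] {T : ℕ} (f : S → ℝ) (M : Fin T → S → S → ℝ)
    (β : Fin (T + 1) → S → ℝ) (hβ_last : ∀ s, β (Fin.last T) s = 1)
    (hβ : ∀ (t : Fin T) s, β t.castSucc s = ∑ s', M t s s' * β t.succ s') :
    ∑ s : Fin (T + 1) → S, f (s 0) * ∏ t, M t (s t.castSucc) (s t.succ) = ∑ s, f s * β 0 s := by
  induction T generalizing f with
  | zero =>
    have h0 : ∀ s, β 0 s = 1 := hβ_last
    simp only [Finset.univ_eq_empty, Finset.prod_empty, h0]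
    exact (Equiv.funUnique (Fin 1) S).sum_comp (fun s => f s * 1)
  | succ T ih =>
    have key := ih (fun s' => ∑ s, f s * M 0 s s') (fun t => M t.succ) (fun t => β t.succ)
      (fun s => hβ_last s) (fun t s => by simpa using hβ t.succ s)
    have e : ∑ s : Fin (T + 2) → S, f (s 0) * ∏ t, M t (s t.castSucc) (s t.succ) =
        ∑ s' : Fin (T + 1) → S, ∑ x, f x * (M 0 x (s' 0) *
          ∏ t : Fin T, M t.succ (s' t.castSucc) (s' t.succ)) := by
      rw [← (Fin.consEquiv (fun _ : Fin (T + 2) => S)).sum_comp, Fintype.sum_prod_type_right]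
      refine Finset.sum_congr rfl fun s' _ => Finset.sum_congr rfl fun x _ => ?_
      simp [Fin.consEquiv, Fin.prod_univ_succ]
    rw [e]
    simp only [← mul_assoc, ← Finset.sum_mul]
    rw [key]
    simp only [Finset.sum_mul]
    rw [Finset.sum_comm]
    refine Finset.sum_congr rfl fun s _ => ?_
    have := hβ 0 s
    rw [Fin.castSucc_zero] at this
    rw [this, Finset.mul_sum]
    refine Finset.sum_congr rfl fun s' _ => ?_
    rw [mul_assoc]

/-- A sum over paths of a product of transfer matrices, split at time `t` into a forward vector `α`
and a backward vector `β`. -/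
theorem sum_paths_eq {S : Type*} [Fintype S] {T : ℕ} (M : Fin T → S → S → ℝ)
    (α β : Fin (T + 1) → S → ℝ) (hβ_last : ∀ s, β (Fin.last T) s = 1)
    (hβ : ∀ (t : Fin T) s, β t.castSucc s = ∑ s', M t s s' * β t.succ s')
    (t : Fin (T + 1))
    (hα : ∀ u : Fin T, u.castSucc < t → ∀ s', α u.succ s' = ∑ s, α u.castSucc s * M u s s') :
    ∑ s : Fin (T + 1) → S, α 0 (s 0) * ∏ t, M t (s t.castSucc) (s t.succ) =
      ∑ s, α t s * β t s := by
  rw [sum_paths_eq_sum_zero _ M β hβ_last hβ]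
  -- The pairing of `α u` with `β u` does not depend on `u` up to `t`: the matrix of a step can act
  -- on either vector.
  induction t using Fin.induction with
  | zero => rfl
  | succ u ih =>
    rw [ih fun v hv => hα v (hv.trans u.castSucc_lt_succ)]
    simp only [hβ u, hα u u.castSucc_lt_succ, Finset.mul_sum, Finset.sum_mul]
    rw [Finset.sum_comm]
    simp only [mul_assoc]

/-- States and actions take finitely many values, so only the rewards matter for measurability. -/
theorem Trajectory.measurable_of_measurable_rew {S A₁ A₂ E : Type*} [Fintype S] [Fintype A₁]
    [Fintype A₂] [MeasurableSpace S] [MeasurableSingletonClass S] [MeasurableSpace A₁]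
    [MeasurableSingletonClass A₁] [MeasurableSpace A₂] [MeasurableSingletonClass A₂]
    [MeasurableSpace E] {T : ℕ} {f : Trajectory S A₁ A₂ T → E}
    (hf : ∀ s a b, Measurable fun r => f (s, a, b, r)) : Measurable f := by
  refine measurable_from_prod_countable_right fun s => ?_
  refine measurable_from_prod_countable_right fun a => ?_
  exact measurable_from_prod_countable_right fun b => hf s a b

/-- The value along a trajectory of a function of `(s_t, a_t^1, a_t^2, r_t, s_{t+1})`. -/
def Trajectory.step {S A₁ A₂ : Type*} {T : ℕ} (τ : Trajectory S A₁ A₂ T) (t : Fin T)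
    (F : S → A₁ → A₂ → ℝ → S → ℝ) : ℝ :=
  F (τ.state t) (τ.act₁ t) (τ.act₂ t) (τ.rew t) (τ.nextState t)

/-! ### Integration against the law of a trajectory -/

namespace MarkovGame

variable {S A₁ A₂ : Type*} [Fintype S] [Fintype A₁] [Fintype A₂] {T : ℕ}
    [MeasurableSpace S] [MeasurableSpace A₁] [MeasurableSpace A₂]

instance (G : MarkovGame S A₁ A₂ T) (t : Fin T) (s : S) (a : A₁) (b : A₂) :
    IsProbabilityMeasure (G.reward t s a b) := G.reward_prob t s a b

theorem _root_.PolicyProfile.prob_nonneg (π : PolicyProfile S A₁ A₂ T) (t : Fin T) (s : S) (a : A₁)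
    (b : A₂) : 0 ≤ π.prob t s a b :=
  mul_nonneg (π.fst.prob_nonneg _ _ _) (π.snd.prob_nonneg _ _ _)

theorem _root_.PolicyProfile.prob_sum (π : PolicyProfile S A₁ A₂ T) (t : Fin T) (s : S) :
    ∑ a, ∑ b, π.prob t s a b = 1 := by
  simp only [PolicyProfile.prob, ← Finset.mul_sum, π.snd.prob_sum, mul_one, π.fst.prob_sum]

/-- The probability of the discrete part of a trajectory. -/
noncomputable def pathWeight (G : MarkovGame S A₁ A₂ T) (π : PolicyProfile S A₁ A₂ T)
    (s : Fin (T + 1) → S) (a : Fin T → A₁) (b : Fin T → A₂) : ℝ :=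
  G.init (s 0) * ∏ t : Fin T, (π.prob t (s t.castSucc) (a t) (b t) *
      G.trans t (s t.castSucc) (a t) (b t) (s t.succ))

theorem pathWeight_nonneg (G : MarkovGame S A₁ A₂ T) (π : PolicyProfile S A₁ A₂ T)
    (s : Fin (T + 1) → S) (a : Fin T → A₁) (b : Fin T → A₂) : 0 ≤ G.pathWeight π s a b :=
  mul_nonneg (G.init_nonneg _) <| Finset.prod_nonneg fun _ _ =>
    mul_nonneg (π.prob_nonneg _ _ _ _) (G.trans_nonneg _ _ _ _ _)

/-- The finite sums over sequences involve decidability instances, chosen classically in `trajLaw`;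
here they are arbitrary. -/
theorem trajLaw_eq [DecidableEq (Fin T → A₁)] [DecidableEq (Fin T → A₂)] [DecidableEq (Fin T)]
    (G : MarkovGame S A₁ A₂ T) (π : PolicyProfile S A₁ A₂ T) :
    G.trajLaw π = ∑ s : Fin (T + 1) → S, ∑ a : Fin T → A₁, ∑ b : Fin T → A₂,
      ENNReal.ofReal (G.pathWeight π s a b) •
      (Measure.pi fun t : Fin T => G.reward t (s t.castSucc) (a t) (b t)).map
        (fun r => (s, a, b, r)) := by
  unfold trajLaw pathWeight
  congr!

theorem measurable_mk (s : Fin (T + 1) → S) (a : Fin T → A₁) (b : Fin T → A₂) :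
    Measurable fun r : Fin T → ℝ => ((s, a, b, r) : Trajectory S A₁ A₂ T) := by
  fun_prop

instance (G : MarkovGame S A₁ A₂ T) (π : PolicyProfile S A₁ A₂ T) :
    IsFiniteMeasure (G.trajLaw π) := by
  classical
  rw [trajLaw_eq]
  constructor
  simp only [Measure.coe_finsetSum, Finset.sum_apply, Measure.smul_apply, smul_eq_mul]
  refine ENNReal.sum_lt_top.2 fun s _ => ENNReal.sum_lt_top.2 fun a _ =>
    ENNReal.sum_lt_top.2 fun b _ => ENNReal.mul_lt_top ENNReal.ofReal_lt_top ?_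
  rw [Measure.map_apply (measurable_mk s a b) MeasurableSet.univ]
  exact measure_lt_top _ _

/-- Integration of a bounded measurable function against the law of a trajectory. -/
theorem integral_trajLaw (G : MarkovGame S A₁ A₂ T) (π : PolicyProfile S A₁ A₂ T)
    {f : Trajectory S A₁ A₂ T → ℝ} (hf : Measurable f) {B : ℝ} (hB : ∀ τ, |f τ| ≤ B) :
    ∫ τ, f τ ∂(G.trajLaw π) = ∑ s : Fin (T + 1) → S, ∑ a : Fin T → A₁, ∑ b : Fin T → A₂,
      G.pathWeight π s a b *
        ∫ r, f (s, a, b, r) ∂(Measure.pi fun t : Fin T => G.reward t (s t.castSucc) (a t) (b t)) := by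
  classical
  have hint : ∀ s a b, Integrable f (ENNReal.ofReal (G.pathWeight π s a b) •
      (Measure.pi fun t : Fin T => G.reward t (s t.castSucc) (a t) (b t)).map
        (fun r => ((s, a, b, r) : Trajectory S A₁ A₂ T))) := by
    intro s a b
    refine Integrable.smul_measure ?_ ENNReal.ofReal_ne_top
    have := Measure.isProbabilityMeasure_map
      (μ := Measure.pi fun t : Fin T => G.reward t (s t.castSucc) (a t) (b t))
      (measurable_mk s a b).aemeasurable
    exact Integrable.of_bound hf.aestronglyMeasurable B (ae_of_all _ hB)
  rw [trajLaw_eq, integral_finsetSum_measure fun s _ => integrable_finsetSum_measure.2 fun a _ =>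
    integrable_finsetSum_measure.2 fun b _ => hint s a b]
  refine Finset.sum_congr rfl fun s _ => ?_
  rw [integral_finsetSum_measure fun a _ => integrable_finsetSum_measure.2 fun b _ => hint s a b]
  refine Finset.sum_congr rfl fun a _ => ?_
  rw [integral_finsetSum_measure fun b _ => hint s a b]
  refine Finset.sum_congr rfl fun b _ => ?_
  rw [integral_smul_measure, ENNReal.toReal_ofReal (G.pathWeight_nonneg π s a b), smul_eq_mul,
    integral_map (measurable_mk s a b).aemeasurable hf.aestronglyMeasurable]

/-- The transfer matrix of a step, weighted by a function. -/
noncomputable def stepMatrix (G : MarkovGame S A₁ A₂ T) (π : PolicyProfile S A₁ A₂ T) (t : Fin T)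
    (F : S → A₁ → A₂ → ℝ → S → ℝ) (s s' : S) : ℝ :=
  ∑ a, ∑ b, π.prob t s a b * G.trans t s a b s' * ∫ r, F s a b r s' ∂(G.reward t s a b)

variable [MeasurableSingletonClass S] [MeasurableSingletonClass A₁] [MeasurableSingletonClass A₂]

theorem _root_.Trajectory.measurable_step {F : S → A₁ → A₂ → ℝ → S → ℝ}
    (hF : ∀ s a b s', Measurable fun r => F s a b r s') (t : Fin T) :
    Measurable fun τ : Trajectory S A₁ A₂ T => τ.step t F :=
  Trajectory.measurable_of_measurable_rew fun s a b =>
    (hF (s t.castSucc) (a t) (b t) (s t.succ)).comp (measurable_pi_apply t)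

/-- Given the states and actions the rewards are independent, so the integral of the product
factorizes. Distributivity then moves the sums over action sequences inside the product, and a path
sum over the states alone remains. -/
theorem integral_prod_step (G : MarkovGame S A₁ A₂ T) (π : PolicyProfile S A₁ A₂ T) (f : S → ℝ)
    (F : Fin T → S → A₁ → A₂ → ℝ → S → ℝ)
    (hF : ∀ t s a b s', Measurable fun r => F t s a b r s')
    (B : Fin T → ℝ) (hB : ∀ t s a b r s', |F t s a b r s'| ≤ B t) :
    ∫ τ, f τ.initState * ∏ t, τ.step t (F t) ∂(G.trajLaw π) =
      ∑ s : Fin (T + 1) → S, G.init (s 0) * f (s 0) *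
        ∏ t, G.stepMatrix π t (F t) (s t.castSucc) (s t.succ) := by
  classical
  have hmeas : Measurable fun τ : Trajectory S A₁ A₂ T => f τ.initState * ∏ t, τ.step t (F t) := by
    refine Measurable.mul ?_ ?_
    · exact Trajectory.measurable_of_measurable_rew fun s a b =>
        (measurable_const : Measurable fun _ : Fin T → ℝ => f (s 0))
    · exact Finset.measurable_prod _ fun t _ => Trajectory.measurable_step (hF t) t
  have hbound : ∀ τ : Trajectory S A₁ A₂ T, |f τ.initState * ∏ t, τ.step t (F t)| ≤
      (∑ s, |f s|) * ∏ t, B t := by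
    intro τ
    rw [abs_mul, Finset.abs_prod]
    refine mul_le_mul (Finset.single_le_sum (f := fun s => |f s|) (fun _ _ => abs_nonneg _)
      (Finset.mem_univ τ.initState)) ?_ (Finset.prod_nonneg fun _ _ => abs_nonneg _)
      (Finset.sum_nonneg fun _ _ => abs_nonneg _)
    exact Finset.prod_le_prod (fun _ _ => abs_nonneg _) fun t _ => hB t _ _ _ _ _
  rw [integral_trajLaw G π hmeas hbound]
  refine Finset.sum_congr rfl fun s _ => ?_
  have e : ∀ a b, G.pathWeight π s a b * ∫ r, f (Trajectory.initState ((s, a, b, r) :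
        Trajectory S A₁ A₂ T)) * ∏ t, Trajectory.step ((s, a, b, r) : Trajectory S A₁ A₂ T) t (F t)
        ∂(Measure.pi fun t : Fin T => G.reward t (s t.castSucc) (a t) (b t)) =
      G.init (s 0) * f (s 0) * ∏ t, (π.prob t (s t.castSucc) (a t) (b t) *
        G.trans t (s t.castSucc) (a t) (b t) (s t.succ) *
        ∫ r, F t (s t.castSucc) (a t) (b t) r (s t.succ)
          ∂(G.reward t (s t.castSucc) (a t) (b t))) := by
    intro a b
    have h1 : ∫ r, f (Trajectory.initState ((s, a, b, r) :
        Trajectory S A₁ A₂ T)) * ∏ t, Trajectory.step ((s, a, b, r) : Trajectory S A₁ A₂ T) t (F t)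
        ∂(Measure.pi fun t : Fin T => G.reward t (s t.castSucc) (a t) (b t)) =
        f (s 0) * ∏ t, ∫ r, F t (s t.castSucc) (a t) (b t) r (s t.succ)
          ∂(G.reward t (s t.castSucc) (a t) (b t)) := by
      rw [← integral_fintype_prod_eq_prod
        (fun t r => F t (s t.castSucc) (a t) (b t) r (s t.succ)), ← integral_const_mul]
      rfl
    rw [h1, Finset.prod_mul_distrib, pathWeight]
    ring
  simp only [e, ← Finset.mul_sum]
  congr 1
  simp only [stepMatrix]
  -- Expanding the product of sums over actions recovers the sum over action sequences, one player
  -- at a time.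
  rw [Finset.prod_univ_sum]
  simp only [Fintype.piFinset_univ]
  refine Finset.sum_congr rfl fun a _ => ?_
  rw [Finset.prod_univ_sum]
  simp only [Fintype.piFinset_univ]

end MarkovGame

/-! ### Forward and backward recursions, and expectations of one step -/

/-- The backward recursion from the constant vector `1` along transfer matrices. -/
noncomputable def backwardVector {S : Type*} [Fintype S] {T : ℕ} (M : Fin T → S → S → ℝ)
    (t : Fin (T + 1)) : S → ℝ :=
  Fin.reverseInduction (motive := fun _ => S → ℝ) (fun _ => 1)
    (fun t V s => ∑ s', M t s s' * V s') t

theorem backwardVector_last {S : Type*} [Fintype S] {T : ℕ} (M : Fin T → S → S → ℝ) (s : S) :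
    backwardVector M (Fin.last T) s = 1 := by
  simp [backwardVector]

theorem backwardVector_castSucc {S : Type*} [Fintype S] {T : ℕ} (M : Fin T → S → S → ℝ) (t : Fin T)
    (s : S) : backwardVector M t.castSucc s = ∑ s', M t s s' * backwardVector M t.succ s' := by
  simp only [backwardVector, Fin.reverseInduction_castSucc]

/-- Stochastic matrices fix the constant vector, so steps without a weight have no effect on the
past. -/
theorem backwardVector_eq_one {S : Type*} [Fintype S] {T : ℕ} (M : Fin T → S → S → ℝ)
    (t : Fin (T + 1)) (h : ∀ u : Fin T, t ≤ u.castSucc → ∀ s, ∑ s', M u s s' = 1) (s : S) :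
    backwardVector M t s = 1 := by
  induction t using Fin.reverseInduction generalizing s with
  | last => exact backwardVector_last M s
  | cast u ih =>
    have ih' := ih fun v hv => h v (u.castSucc_lt_succ.le.trans hv)
    simp only [backwardVector_castSucc, ih', mul_one]
    exact h u le_rfl s

namespace MarkovGame

variable {S A₁ A₂ : Type*} [Fintype S] [Fintype A₁] [Fintype A₂] {T : ℕ}
    [MeasurableSpace S] [MeasurableSpace A₁] [MeasurableSpace A₂]

theorem stateMarginal_zero (G : MarkovGame S A₁ A₂ T) (π : PolicyProfile S A₁ A₂ T) :
    G.stateMarginal π 0 = G.init := by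
  simp [stateMarginal]

theorem stateMarginal_succ (G : MarkovGame S A₁ A₂ T) (π : PolicyProfile S A₁ A₂ T) (t : Fin T)
    (s' : S) : G.stateMarginal π t.succ s' =
      ∑ s, ∑ a, ∑ b, G.trans t s a b s' * G.marginal π t s a b := by
  simp only [stateMarginal, Fin.induction_succ, marginal]

theorem stateMarginal_nonneg (G : MarkovGame S A₁ A₂ T) (π : PolicyProfile S A₁ A₂ T)
    (t : Fin (T + 1)) (s : S) : 0 ≤ G.stateMarginal π t s := by
  induction t using Fin.induction generalizing s with
  | zero => rw [stateMarginal_zero]; exact G.init_nonneg s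
  | succ t ih =>
    rw [stateMarginal_succ]
    exact Finset.sum_nonneg fun s _ => Finset.sum_nonneg fun a _ => Finset.sum_nonneg fun b _ =>
      mul_nonneg (G.trans_nonneg _ _ _ _ _) (mul_nonneg (π.prob_nonneg _ _ _ _) (ih s))

theorem marginal_nonneg (G : MarkovGame S A₁ A₂ T) (π : PolicyProfile S A₁ A₂ T)
    (t : Fin T) (s : S) (a : A₁) (b : A₂) : 0 ≤ G.marginal π t s a b :=
  mul_nonneg (π.prob_nonneg _ _ _ _) (G.stateMarginal_nonneg π _ _)

theorem sum_marginal (G : MarkovGame S A₁ A₂ T) (π : PolicyProfile S A₁ A₂ T) (t : Fin T) (s : S) :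
    ∑ a, ∑ b, G.marginal π t s a b = G.stateMarginal π t.castSucc s := by
  simp only [marginal, ← Finset.sum_mul, π.prob_sum, one_mul]

/-- The conditional mean of a function of `(s_t, a_t^1, a_t^2, r_t, s_{t+1})` given
`(s_t, a_t^1, a_t^2)`. -/
noncomputable def stepMean (G : MarkovGame S A₁ A₂ T) (t : Fin T)
    (F : S → A₁ → A₂ → ℝ → S → ℝ) (s : S) (a : A₁) (b : A₂) : ℝ :=
  ∑ s', G.trans t s a b s' * ∫ r, F s a b r s' ∂(G.reward t s a b)

theorem sum_stepMatrix (G : MarkovGame S A₁ A₂ T) (π : PolicyProfile S A₁ A₂ T) (t : Fin T)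
    (F : S → A₁ → A₂ → ℝ → S → ℝ) (s : S) :
    ∑ s', G.stepMatrix π t F s s' = ∑ a, ∑ b, π.prob t s a b * G.stepMean t F s a b := by
  simp only [stepMatrix, stepMean, Finset.mul_sum, ← mul_assoc]
  rw [Finset.sum_comm]
  refine Finset.sum_congr rfl fun a _ => ?_
  rw [Finset.sum_comm]

theorem stepMean_one (G : MarkovGame S A₁ A₂ T) (t : Fin T) (s : S) (a : A₁) (b : A₂) :
    G.stepMean t (fun _ _ _ _ _ => 1) s a b = 1 := by
  simp [stepMean, G.trans_sum]

theorem sum_stepMatrix_one (G : MarkovGame S A₁ A₂ T) (π : PolicyProfile S A₁ A₂ T) (t : Fin T)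
    (s : S) : ∑ s', G.stepMatrix π t (fun _ _ _ _ _ => 1) s s' = 1 := by
  simp only [sum_stepMatrix, stepMean_one, mul_one, π.prob_sum]

variable [MeasurableSingletonClass S] [MeasurableSingletonClass A₁] [MeasurableSingletonClass A₂]

theorem integral_initState (G : MarkovGame S A₁ A₂ T) (π : PolicyProfile S A₁ A₂ T) (f : S → ℝ) :
    ∫ τ, f τ.initState ∂(G.trajLaw π) = ∑ s, G.init s * f s := by
  have h := G.integral_prod_step π f (fun _ _ _ _ _ _ => 1)
    (fun _ _ _ _ _ => measurable_const) (fun _ => 1) (fun _ _ _ _ _ _ => by simp)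
  simp only [Trajectory.step, Finset.prod_const_one, mul_one] at h
  rw [h, sum_paths_eq_sum_zero (fun s => G.init s * f s) _ (fun _ _ => 1) (fun _ => rfl)]
  · simp
  · intro t s
    simp only [mul_one, sum_stepMatrix_one]

instance (G : MarkovGame S A₁ A₂ T) (π : PolicyProfile S A₁ A₂ T) :
    IsProbabilityMeasure (G.trajLaw π) := by
  have h := G.integral_initState π (fun _ => 1)
  simp only [integral_const, smul_eq_mul, mul_one, G.init_sum] at h
  exact ⟨by simpa [Measure.real, ENNReal.toReal_eq_one_iff] using h⟩

/-- Integration of a bounded function of one step. -/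
theorem integral_step_of_bounded (G : MarkovGame S A₁ A₂ T) (π : PolicyProfile S A₁ A₂ T)
    (t : Fin T) (F : S → A₁ → A₂ → ℝ → S → ℝ) (hF : ∀ s a b s', Measurable fun r => F s a b r s')
    {B : ℝ} (hB : ∀ s a b r s', |F s a b r s'| ≤ B) :
    ∫ τ, τ.step t F ∂(G.trajLaw π) = ∑ s, ∑ a, ∑ b, G.marginal π t s a b * G.stepMean t F s a b := by
  -- All other steps get weight 1: before `t` the matrices propagate the state marginals, after `t`
  -- they are stochastic and the backward vector is 1.
  set F' : Fin T → S → A₁ → A₂ → ℝ → S → ℝ := fun u => if u = t then F else fun _ _ _ _ _ => 1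
    with hF'
  have h := G.integral_prod_step π (fun _ => 1) F'
    (fun u s a b s' => by
      by_cases hu : u = t
      · simpa [hF', hu] using hF s a b s'
      · simp [hF', hu])
    (fun u => max B 1) (fun u s a b r s' => by
      by_cases hu : u = t
      · simpa [hF', hu] using Or.inl (hB s a b r s')
      · simp [hF', hu])
  have hprod : ∀ τ : Trajectory S A₁ A₂ T, ∏ u, τ.step u (F' u) = τ.step t F := by
    intro τ
    rw [Finset.prod_eq_single t]
    · simp [hF']
    · intro u _ hu
      simp [hF', hu, Trajectory.step]
    · simp
  simp only [hprod, one_mul, mul_one] at h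
  rw [h]
  have h0 := sum_paths_eq (fun u => G.stepMatrix π u (F' u)) (G.stateMarginal π)
    (backwardVector fun u => G.stepMatrix π u (F' u)) (backwardVector_last _)
    (backwardVector_castSucc _) t.castSucc (fun u hu s' => by
      have hu' : u ≠ t := fun e => by simp [e] at hu
      simp only [hF', hu', if_false, stepMatrix, stateMarginal_succ, marginal, integral_const,
        probReal_univ, one_smul, mul_one, Finset.mul_sum]
      refine Finset.sum_congr rfl fun s _ => Finset.sum_congr rfl fun a _ =>
        Finset.sum_congr rfl fun b _ => by ring)
  rw [stateMarginal_zero] at h0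
  rw [h0]
  refine Finset.sum_congr rfl fun s _ => ?_
  have h1 : ∀ s', backwardVector (fun u => G.stepMatrix π u (F' u)) t.succ s' = 1 := by
    refine backwardVector_eq_one _ _ fun u hu s => ?_
    have hu' : u ≠ t := fun e => by
      rw [e] at hu
      exact absurd hu (not_le.2 t.castSucc_lt_succ)
    simp only [hF', hu', if_false, sum_stepMatrix_one]
  simp only [backwardVector_castSucc, h1, mul_one, sum_stepMatrix]
  simp only [hF', if_true, Finset.mul_sum, marginal]
  refine Finset.sum_congr rfl fun a _ => Finset.sum_congr rfl fun b _ => by ring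

/-- Integration of a bounded product over the steps, if the conditional mean of the last nontrivial
factor vanishes. -/
theorem integral_prod_step_eq_zero (G : MarkovGame S A₁ A₂ T) (π : PolicyProfile S A₁ A₂ T)
    (f : S → ℝ) (F : Fin T → S → A₁ → A₂ → ℝ → S → ℝ)
    (hF : ∀ t s a b s', Measurable fun r => F t s a b r s')
    (B : Fin T → ℝ) (hB : ∀ t s a b r s', |F t s a b r s'| ≤ B t) (t : Fin T)
    (hlast : ∀ u, t < u → F u = fun _ _ _ _ _ => 1) (h0 : ∀ s a b, G.stepMean t (F t) s a b = 0) :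
    ∫ τ, f τ.initState * ∏ t, τ.step t (F t) ∂(G.trajLaw π) = 0 := by
  rw [G.integral_prod_step π f F hF B hB]
  set M := fun u => G.stepMatrix π u (F u) with hM
  -- The forward vector is whatever the recursion produces; its values are irrelevant, because the
  -- row sums of the matrix of step `t` vanish.
  set α : Fin (T + 1) → S → ℝ := fun u => Fin.induction (motive := fun _ => S → ℝ)
    (fun s => G.init s * f s) (fun u p s' => ∑ s, p s * M u s s') u with hα
  have h := sum_paths_eq M α (backwardVector M) (backwardVector_last _)
    (backwardVector_castSucc _) t.castSucc (fun u _ s' => by simp [hα])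
  have hα0 : α 0 = fun s => G.init s * f s := by simp [hα]
  rw [hα0] at h
  rw [h]
  refine Finset.sum_eq_zero fun s _ => ?_
  have h1 : ∀ s', backwardVector M t.succ s' = 1 := by
    refine backwardVector_eq_one _ _ fun u hu s => ?_
    simp only [hM, hlast u (Fin.castSucc_lt_castSucc_iff.1 (t.castSucc_lt_succ.trans_le hu)),
      sum_stepMatrix_one]
  simp only [backwardVector_castSucc, h1, mul_one]
  simp only [hM, sum_stepMatrix, h0, mul_zero, Finset.sum_const_zero]

/-- A property of `(s_t, a_t^1, a_t^2, r_t)` that holds for almost all rewards at the state-action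
pairs of positive probability holds almost surely. -/
theorem ae_of_ae_reward (G : MarkovGame S A₁ A₂ T) (π : PolicyProfile S A₁ A₂ T) (t : Fin T)
    (p : S → A₁ → A₂ → ℝ → Prop)
    (hp : ∀ s a b, G.marginal π t s a b ≠ 0 → ∀ᵐ r ∂(G.reward t s a b), p s a b r) :
    ∀ᵐ τ ∂(G.trajLaw π), G.marginal π t (τ.state t) (τ.act₁ t) (τ.act₂ t) ≠ 0 ∧
      p (τ.state t) (τ.act₁ t) (τ.act₂ t) (τ.rew t) := by
  classical
  -- `p` need not be measurable, so its failure set is enlarged to a measurable one of the same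
  -- measure. Off the support `N` is everything, which makes unvisited pairs part of the null event.
  set N : S → A₁ → A₂ → Set ℝ := fun s a b =>
    if G.marginal π t s a b = 0 then Set.univ else toMeasurable (G.reward t s a b) {r | ¬ p s a b r}
    with hN
  have hNm : ∀ s a b, MeasurableSet (N s a b) := fun s a b => by
    simp only [hN]; split_ifs
    · exact MeasurableSet.univ
    · exact measurableSet_toMeasurable _ _
  set F : S → A₁ → A₂ → ℝ → S → ℝ := fun s a b r _ => (N s a b).indicator (fun _ => 1) r with hF
  have hFm : ∀ s a b s', Measurable fun r => F s a b r s' := fun s a b s' =>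
    measurable_const.indicator (hNm s a b)
  have hFB : ∀ s a b r s', |F s a b r s'| ≤ 1 := fun s a b r s' => by
    simp only [hF, Set.indicator]; split_ifs <;> simp
  have hF0 : ∀ s a b r s', 0 ≤ F s a b r s' := fun s a b r s' => by
    simp only [hF, Set.indicator]; split_ifs <;> simp
  have h := G.integral_step_of_bounded π t F hFm hFB
  have hz : ∑ s, ∑ a, ∑ b, G.marginal π t s a b * G.stepMean t F s a b = 0 := by
    refine Finset.sum_eq_zero fun s _ => Finset.sum_eq_zero fun a _ =>
      Finset.sum_eq_zero fun b _ => ?_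
    by_cases hm : G.marginal π t s a b = 0
    · rw [hm, zero_mul]
    · have : G.stepMean t F s a b = 0 := by
        refine Finset.sum_eq_zero fun s' _ => ?_
        have : (G.reward t s a b).real (N s a b) = 0 := by
          simp only [hN, hm, if_false, Measure.real, measure_toMeasurable]
          have := hp s a b hm
          rw [ae_iff] at this
          rw [this, ENNReal.toReal_zero]
        simp only [hF]
        rw [integral_indicator_const _ (hNm s a b), this, zero_smul, mul_zero]
      rw [this, mul_zero]
  rw [hz] at h
  have hint : Integrable (fun τ : Trajectory S A₁ A₂ T => τ.step t F) (G.trajLaw π) :=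
    Integrable.of_bound (Trajectory.measurable_step hFm t).aestronglyMeasurable 1
      (ae_of_all _ fun τ => hFB _ _ _ _ (τ.nextState t))
  have h := (integral_eq_zero_iff_of_nonneg
    (f := fun τ : Trajectory S A₁ A₂ T => τ.step t F)
    (fun τ => hF0 _ _ _ _ (τ.nextState t)) hint).1 h
  filter_upwards [h] with τ hτ
  have hτ' : τ.rew t ∉ N (τ.state t) (τ.act₁ t) (τ.act₂ t) := by
    intro hmem
    simp [Trajectory.step, hF, Set.indicator, hmem] at hτ
  have hm : G.marginal π t (τ.state t) (τ.act₁ t) (τ.act₂ t) ≠ 0 := by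
    intro hm
    simp [hN, hm] at hτ'
  refine ⟨hm, ?_⟩
  by_contra hcon
  refine hτ' ?_
  simp only [hN, hm, if_false]
  exact subset_toMeasurable _ _ hcon

/-- A measurable property of the reward that holds almost surely holds for almost all rewards at the
state-action pairs of positive probability. -/
theorem ae_reward_of_ae (G : MarkovGame S A₁ A₂ T) (π : PolicyProfile S A₁ A₂ T) (t : Fin T)
    {E : Set ℝ} (hE : MeasurableSet E) (h : ∀ᵐ τ ∂(G.trajLaw π), τ.rew t ∈ E) (s : S) (a : A₁)
    (b : A₂) (hm : G.marginal π t s a b ≠ 0) : ∀ᵐ r ∂(G.reward t s a b), r ∈ E := by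
  set F : S → A₁ → A₂ → ℝ → S → ℝ := fun _ _ _ r _ => Eᶜ.indicator (fun _ => 1) r with hF
  have hFm : ∀ s a b s', Measurable fun r => F s a b r s' := fun s a b s' =>
    measurable_const.indicator hE.compl
  have hFB : ∀ s a b r s', |F s a b r s'| ≤ 1 := fun s a b r s' => by
    simp only [hF, Set.indicator]; split_ifs <;> simp
  have hs := G.integral_step_of_bounded π t F hFm hFB
  have h0 : ∫ τ, τ.step t F ∂(G.trajLaw π) = 0 := by
    rw [integral_eq_zero_of_ae]
    filter_upwards [h] with τ hτ
    simp [Trajectory.step, hF, hτ]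
  have hmean : ∀ s a b, G.stepMean t F s a b = (G.reward t s a b).real Eᶜ := by
    intro s a b
    simp only [stepMean, hF, integral_indicator_const _ hE.compl, ← Finset.sum_mul, G.trans_sum,
      smul_eq_mul, mul_one, one_mul]
  rw [h0] at hs
  simp only [hmean] at hs
  have hnn : ∀ s a b, 0 ≤ G.marginal π t s a b * (G.reward t s a b).real Eᶜ := fun s a b =>
    mul_nonneg (G.marginal_nonneg _ _ _ _ _) measureReal_nonneg
  have e1 := (Finset.sum_eq_zero_iff_of_nonneg fun s _ => Finset.sum_nonneg fun a _ =>
    Finset.sum_nonneg fun b _ => hnn s a b).1 hs.symm s (Finset.mem_univ _)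
  have e2 := (Finset.sum_eq_zero_iff_of_nonneg fun a _ =>
    Finset.sum_nonneg fun b _ => hnn s a b).1 e1 a (Finset.mem_univ _)
  have e3 := (Finset.sum_eq_zero_iff_of_nonneg fun b _ => hnn s a b).1 e2 b (Finset.mem_univ _)
  have e4 := (mul_eq_zero.1 e3).resolve_left hm
  rw [ae_iff]
  exact (measureReal_eq_zero_iff).1 e4

/-! ### Almost surely bounded functions of a step and martingale orthogonality -/

/-- `F` is measurable in the reward, and bounded by `B` almost surely at step `t`. -/
structure StepBounded (G : MarkovGame S A₁ A₂ T) (π : PolicyProfile S A₁ A₂ T) (t : Fin T)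
    (F : S → A₁ → A₂ → ℝ → S → ℝ) (B : ℝ) : Prop where
  measurable : ∀ s a b s', Measurable fun r => F s a b r s'
  bound : ∀ s a b, G.marginal π t s a b ≠ 0 →
    ∀ᵐ r ∂(G.reward t s a b), ∀ s', |F s a b r s'| ≤ B

namespace StepBounded

variable {G : MarkovGame S A₁ A₂ T} {π : PolicyProfile S A₁ A₂ T} {t : Fin T}
  {F : S → A₁ → A₂ → ℝ → S → ℝ} {B : ℝ}

theorem ae_bound (h : G.StepBounded π t F B) : ∀ᵐ τ ∂(G.trajLaw π), |τ.step t F| ≤ B := by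
  filter_upwards [G.ae_of_ae_reward π t (fun s a b r => ∀ s', |F s a b r s'| ≤ B) h.bound] with τ hτ
  exact hτ.2 _

theorem aestronglyMeasurable (h : G.StepBounded π t F B) :
    AEStronglyMeasurable (fun τ : Trajectory S A₁ A₂ T => τ.step t F) (G.trajLaw π) :=
  (Trajectory.measurable_step h.measurable t).aestronglyMeasurable

theorem integrable (h : G.StepBounded π t F B) :
    Integrable (fun τ : Trajectory S A₁ A₂ T => τ.step t F) (G.trajLaw π) :=
  Integrable.of_bound h.aestronglyMeasurable B h.ae_bound

theorem memLp (h : G.StepBounded π t F B) (p : ENNReal) :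
    MemLp (fun τ : Trajectory S A₁ A₂ T => τ.step t F) p (G.trajLaw π) :=
  MemLp.of_bound h.aestronglyMeasurable B h.ae_bound

/-- A version of `F` that is bounded everywhere and vanishes off the support. -/
theorem exists_bounded (h : G.StepBounded π t F B) :
    ∃ F' : S → A₁ → A₂ → ℝ → S → ℝ, (∀ s a b s', Measurable fun r => F' s a b r s') ∧
      (∀ s a b r s', |F' s a b r s'| ≤ |B|) ∧
      (∀ s a b, G.marginal π t s a b = 0 → G.stepMean t F' s a b = 0) ∧
      (∀ s a b, G.marginal π t s a b ≠ 0 → G.stepMean t F' s a b = G.stepMean t F s a b) ∧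
      (∀ᵐ τ ∂(G.trajLaw π), τ.step t F' = τ.step t F) := by
  classical
  -- Clipping changes nothing almost surely on the support. The level is `|B|`, so that no sign
  -- condition on `B` is needed.
  set F' : S → A₁ → A₂ → ℝ → S → ℝ := fun s a b r s' =>
    if G.marginal π t s a b = 0 then 0 else max (-|B|) (min |B| (F s a b r s')) with hF'
  have hclip : ∀ x : ℝ, |x| ≤ B → max (-|B|) (min |B| x) = x := by
    intro x hx
    have := abs_le.1 (hx.trans (le_abs_self B))
    rw [min_eq_right this.2, max_eq_right this.1]
  have hae : ∀ s a b, G.marginal π t s a b ≠ 0 →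
      ∀ᵐ r ∂(G.reward t s a b), ∀ s', F' s a b r s' = F s a b r s' := by
    intro s a b hm
    filter_upwards [h.bound s a b hm] with r hr s'
    simp only [hF', hm, if_false, hclip _ (hr s')]
  refine ⟨F', ?_, ?_, ?_, ?_, ?_⟩
  · intro s a b s'
    by_cases hm : G.marginal π t s a b = 0
    · simp [hF', hm]
    · simp only [hF', hm, if_false]
      exact measurable_const.max (measurable_const.min (h.measurable s a b s'))
  · intro s a b r s'
    by_cases hm : G.marginal π t s a b = 0
    · simp [hF', hm]
    · simp only [hF', hm, if_false, abs_le]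
      exact ⟨le_max_left _ _, max_le (by linarith [abs_nonneg B]) (min_le_left _ _)⟩
  · intro s a b hm
    simp [stepMean, hF', hm]
  · intro s a b hm
    refine Finset.sum_congr rfl fun s' _ => ?_
    rw [integral_congr_ae]
    filter_upwards [hae s a b hm] with r hr using hr s'
  · filter_upwards [G.ae_of_ae_reward π t _ hae] with τ hτ using hτ.2 _

/-- Integration of a function of one step. -/
theorem integral_eq (h : G.StepBounded π t F B) :
    ∫ τ, τ.step t F ∂(G.trajLaw π) =
      ∑ s, ∑ a, ∑ b, G.marginal π t s a b * G.stepMean t F s a b := by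
  obtain ⟨F', hm, hb, -, he, hae⟩ := h.exists_bounded
  rw [← integral_congr_ae hae, G.integral_step_of_bounded π t F' hm hb]
  refine Finset.sum_congr rfl fun s _ => Finset.sum_congr rfl fun a _ =>
    Finset.sum_congr rfl fun b _ => ?_
  by_cases h0 : G.marginal π t s a b = 0
  · simp [h0]
  · rw [he s a b h0]

/-- A step function with conditional mean zero is a martingale difference, hence orthogonal to
functions of the first state. The condition is needed only on the support, as the bounded version
vanishes elsewhere. -/
theorem integral_initState_mul_eq_zero (h : G.StepBounded π t F B) (f : S → ℝ)
    (h0 : ∀ s a b, G.marginal π t s a b ≠ 0 → G.stepMean t F s a b = 0) :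
    ∫ τ, f τ.initState * τ.step t F ∂(G.trajLaw π) = 0 := by
  obtain ⟨F', hm, hb, hz, he, hae⟩ := h.exists_bounded
  set H : Fin T → S → A₁ → A₂ → ℝ → S → ℝ := fun u => if u = t then F' else fun _ _ _ _ _ => 1
    with hH
  have key := G.integral_prod_step_eq_zero π f H
    (fun v s a b s' => by
      by_cases hv : v = t
      · simpa [hH, hv] using hm s a b s'
      · simp [hH, hv])
    (fun v => max |B| 1) (fun v s a b r s' => by
      by_cases hv : v = t
      · simpa [hH, hv] using Or.inl (hb s a b r s')
      · simp [hH, hv])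
    t (fun v hv => by simp [hH, hv.ne']) (fun s a b => by
      simp only [hH, if_true]
      by_cases h1 : G.marginal π t s a b = 0
      · exact hz s a b h1
      · rw [he s a b h1, h0 s a b h1])
  rw [← key]
  refine integral_congr_ae ?_
  filter_upwards [hae] with τ hτ
  rw [Finset.prod_eq_single t]
  · simp [hH, hτ]
  · intro v _ hv
    simp [hH, hv, Trajectory.step]
  · simp

/-- Orthogonality of martingale differences: the earlier factor is determined before the later one
is averaged out. -/
theorem integral_mul_eq_zero (h : G.StepBounded π t F B) {u : Fin T} (hu : u < t)
    {E : S → A₁ → A₂ → ℝ → S → ℝ} {B' : ℝ} (hE : G.StepBounded π u E B')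
    (h0 : ∀ s a b, G.marginal π t s a b ≠ 0 → G.stepMean t F s a b = 0) :
    ∫ τ, τ.step u E * τ.step t F ∂(G.trajLaw π) = 0 := by
  obtain ⟨F', hm, hb, hz, he, hae⟩ := h.exists_bounded
  obtain ⟨E', hm', hb', -, -, hae'⟩ := hE.exists_bounded
  set H : Fin T → S → A₁ → A₂ → ℝ → S → ℝ := fun v =>
    if v = t then F' else if v = u then E' else fun _ _ _ _ _ => 1 with hH
  have key := G.integral_prod_step_eq_zero π (fun _ => 1) H
    (fun v s a b s' => by
      by_cases hv : v = t
      · simpa [hH, hv] using hm s a b s'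
      · by_cases hv' : v = u
        · simpa [hH, hv', hu.ne] using hm' s a b s'
        · simp [hH, hv, hv'])
    (fun v => max |B| (max |B'| 1)) (fun v s a b r s' => by
      by_cases hv : v = t
      · simpa [hH, hv] using Or.inl (hb s a b r s')
      · by_cases hv' : v = u
        · simpa [hH, hv', hu.ne] using Or.inr (Or.inl (hb' s a b r s'))
        · simp [hH, hv, hv'])
    t (fun v hv => by simp [hH, hv.ne', (hu.trans hv).ne']) (fun s a b => by
      simp only [hH, if_true]
      by_cases h1 : G.marginal π t s a b = 0
      · exact hz s a b h1
      · rw [he s a b h1, h0 s a b h1])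
  rw [← key]
  refine integral_congr_ae ?_
  filter_upwards [hae, hae'] with τ hτ hτ'
  rw [one_mul, ← Finset.prod_subset (Finset.subset_univ ({u, t} : Finset (Fin T))),
    Finset.prod_pair hu.ne]
  · simp [hH, hτ, hτ', hu.ne]
  · intro v _ hv
    simp only [Finset.mem_insert, Finset.mem_singleton, not_or] at hv
    simp [hH, hv.1, hv.2, Trajectory.step]

end StepBounded

end MarkovGame

/-! ### The temporal difference form of the summand -/

/-- The state value associated with a state-action value `Q`, which vanishes after the last step. -/
noncomputable def PolicyProfile.averageValue {S A₁ A₂ : Type*} [Fintype A₁] [Fintype A₂] {T : ℕ}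
    (π : PolicyProfile S A₁ A₂ T) (Q : Fin T → S → A₁ → A₂ → ℝ) (t : Fin (T + 1)) : S → ℝ :=
  Fin.lastCases (motive := fun _ => S → ℝ) (fun _ => 0)
    (fun t s => ∑ a, ∑ b, π.prob t s a b * Q t s a b) t

theorem PolicyProfile.averageValue_last {S A₁ A₂ : Type*} [Fintype A₁] [Fintype A₂] {T : ℕ}
    (π : PolicyProfile S A₁ A₂ T) (Q : Fin T → S → A₁ → A₂ → ℝ) (s : S) :
    π.averageValue Q (Fin.last T) s = 0 := by
  simp [averageValue]

theorem PolicyProfile.averageValue_castSucc {S A₁ A₂ : Type*} [Fintype A₁] [Fintype A₂] {T : ℕ}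
    (π : PolicyProfile S A₁ A₂ T) (Q : Fin T → S → A₁ → A₂ → ℝ) (t : Fin T) (s : S) :
    π.averageValue Q t.castSucc s = ∑ a, ∑ b, π.prob t s a b * Q t s a b := by
  simp [averageValue]

/-- The temporal difference `r_t + γ V(s_{t+1}) - q(s_t, a_t)`, weighted by `c(s_t, a_t)`. -/
def tdStep {S A₁ A₂ : Type*} (γ : ℝ) (c q : S → A₁ → A₂ → ℝ) (V : S → ℝ) :
    S → A₁ → A₂ → ℝ → S → ℝ :=
  fun s a b r s' => c s a b * (r + γ * V s' - q s a b)

/-- An index shift: the previous ratio times the value at the current state is the ratio of the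
preceding step times the value at its next state. The first term has ratio 1 and becomes the start
value; the last one vanishes with `W`. -/
theorem sum_prevRatio_mul {S A₁ A₂ : Type*} {T : ℕ} (γ : ℝ) (μ : Fin T → S → A₁ → A₂ → ℝ)
    (W : Fin (T + 1) → S → ℝ) (hW : ∀ s, W (Fin.last T) s = 0) (τ : Trajectory S A₁ A₂ T) :
    ∑ t : Fin T, γ ^ (t : ℕ) * (prevRatio μ τ t * W t.castSucc (τ.state t)) =
      W 0 τ.initState + ∑ t : Fin T, γ ^ (t : ℕ) *
        (μ t (τ.state t) (τ.act₁ t) (τ.act₂ t) * (γ * W t.succ (τ.nextState t))) := by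
  cases T with
  | zero =>
    have : W 0 τ.initState = 0 := hW _
    simp [this]
  | succ T =>
    rw [Fin.sum_univ_succ, Fin.sum_univ_castSucc (n := T)]
    have hlast : W (Fin.last T).succ (τ.nextState (Fin.last T)) = 0 := hW _
    rw [hlast]
    have h0 : prevRatio μ τ 0 = 1 := by simp [prevRatio]
    rw [h0]
    simp only [Fin.val_zero, pow_zero, one_mul, mul_zero, add_zero]
    congr 1
    refine Finset.sum_congr rfl fun i _ => ?_
    have h1 : prevRatio μ τ i.succ = μ i.castSucc (τ.state i.castSucc) (τ.act₁ i.castSucc)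
        (τ.act₂ i.castSucc) := by
      simp only [prevRatio, Fin.val_succ, Nat.succ_ne_zero, if_false]
      rfl
    rw [h1, Fin.val_succ, pow_succ]
    have h2 : W i.succ.castSucc (τ.state i.succ) = W i.castSucc.succ (τ.nextState i.castSucc) := rfl
    rw [h2, Fin.val_castSucc]
    ring

/-- After the shift, each step involves one ratio only, and at the truth the sum consists of a start
value and martingale differences. -/
theorem drlSummand_eq {S A₁ A₂ : Type*} [Fintype A₁] [Fintype A₂] {T : ℕ} (γ : ℝ)
    (π : PolicyProfile S A₁ A₂ T) (Q μ : Fin T → S → A₁ → A₂ → ℝ) (τ : Trajectory S A₁ A₂ T) :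
    drlSummand γ π Q μ τ = π.averageValue Q 0 τ.initState + ∑ t : Fin T, γ ^ (t : ℕ) *
      τ.step t (tdStep γ (μ t) (Q t) (π.averageValue Q t.succ)) := by
  have h := sum_prevRatio_mul γ μ (π.averageValue Q) (π.averageValue_last Q) τ
  simp only [drlSummand, mul_add, Finset.sum_add_distrib]
  simp only [PolicyProfile.averageValue_castSucc] at h
  rw [h, add_left_comm, ← Finset.sum_add_distrib]
  congr 1
  refine Finset.sum_congr rfl fun t _ => ?_
  simp only [Trajectory.step, tdStep]
  ring

/-! ### Values, telescoping and the product form of the bias -/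

namespace MarkovGame

variable {S A₁ A₂ : Type*} [Fintype S] [Fintype A₁] [Fintype A₂] {T : ℕ}
    [MeasurableSpace S] [MeasurableSpace A₁] [MeasurableSpace A₂]

theorem sum_stateMarginal (G : MarkovGame S A₁ A₂ T) (π : PolicyProfile S A₁ A₂ T)
    (t : Fin (T + 1)) : ∑ s, G.stateMarginal π t s = 1 := by
  induction t using Fin.induction with
  | zero => rw [stateMarginal_zero]; exact G.init_sum
  | succ t ih =>
    simp only [stateMarginal_succ]
    rw [Finset.sum_comm, ← ih]
    refine Finset.sum_congr rfl fun s _ => ?_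
    rw [← G.sum_marginal π t s, Finset.sum_comm]
    refine Finset.sum_congr rfl fun a _ => ?_
    rw [Finset.sum_comm]
    simp only [← Finset.sum_mul, G.trans_sum, one_mul]

/-- Puts the true values into the form of the estimated ones, so that identities for an arbitrary
`Q` apply to both. -/
theorem stateValue_eq_averageValue (G : MarkovGame S A₁ A₂ T) (γ : ℝ)
    (π : PolicyProfile S A₁ A₂ T) : G.stateValue γ π = π.averageValue (G.qValue γ π) := by
  funext t s
  cases t using Fin.lastCases with
  | last => simp [stateValue, PolicyProfile.averageValue_last]
  | cast t =>
    rw [PolicyProfile.averageValue_castSucc]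
    conv_lhs => rw [stateValue, Fin.reverseInduction_castSucc]
    rfl

/-- The expected discounted sum of the temporal differences of a state-action value telescopes. -/
theorem sum_marginal_mul_sub (G : MarkovGame S A₁ A₂ T) (γ : ℝ) (π : PolicyProfile S A₁ A₂ T)
    (Q : Fin T → S → A₁ → A₂ → ℝ) :
    ∑ t : Fin T, γ ^ (t : ℕ) * ∑ s, ∑ a, ∑ b, G.marginal π t s a b *
      (Q t s a b - γ * ∑ s', G.trans t s a b s' * π.averageValue Q t.succ s') =
    ∑ s, G.init s * π.averageValue Q 0 s := by
  -- `g t` is the discounted mean of the value at time `t`. Each summand is a difference of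
  -- consecutive values of `g`, and `g` vanishes at the end.
  set g : Fin (T + 1) → ℝ := fun t => γ ^ (t : ℕ) * ∑ s, G.stateMarginal π t s *
    π.averageValue Q t s with hg
  have h1 : ∀ t : Fin T, γ ^ (t : ℕ) * ∑ s, ∑ a, ∑ b, G.marginal π t s a b *
      (Q t s a b - γ * ∑ s', G.trans t s a b s' * π.averageValue Q t.succ s') =
      g t.castSucc - g t.succ := by
    intro t
    simp only [hg, stateMarginal_succ, PolicyProfile.averageValue_castSucc, Fin.val_succ,
      Fin.val_castSucc, pow_succ, mul_sub, Finset.sum_sub_distrib]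
    congr 1
    · congr 1
      refine Finset.sum_congr rfl fun s _ => ?_
      simp only [Finset.mul_sum, marginal]
      refine Finset.sum_congr rfl fun a _ => Finset.sum_congr rfl fun b _ => by ring
    · rw [mul_assoc]
      congr 1
      simp only [Finset.mul_sum, Finset.sum_mul]
      symm
      rw [Finset.sum_comm]
      refine Finset.sum_congr rfl fun s _ => ?_
      rw [Finset.sum_comm]
      refine Finset.sum_congr rfl fun a _ => ?_
      rw [Finset.sum_comm]
      refine Finset.sum_congr rfl fun b _ => Finset.sum_congr rfl fun s' _ => by ring
  have h2 := Fin.sum_univ_succ g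
  rw [Fin.sum_univ_castSucc] at h2
  have h3 : g (Fin.last T) = 0 := by simp [hg, PolicyProfile.averageValue_last]
  have h4 : g 0 = ∑ s, G.init s * π.averageValue Q 0 s := by simp [hg, stateMarginal_zero]
  simp only [h1, Finset.sum_sub_distrib]
  linarith

/-- The rewards at the state-action pairs of positive probability are bounded by `R`. -/
def RewardBounded (G : MarkovGame S A₁ A₂ T) (π : PolicyProfile S A₁ A₂ T) (R : ℝ) : Prop :=
  ∀ t s a b, G.marginal π t s a b ≠ 0 → ∀ᵐ r ∂(G.reward t s a b), |r| ≤ R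

/-- The state-action pairs of positive probability under `π` have positive probability under `πb`.
-/
def Covers (G : MarkovGame S A₁ A₂ T) (πb π : PolicyProfile S A₁ A₂ T) : Prop :=
  ∀ t s a b, G.marginal πb t s a b = 0 → G.marginal π t s a b = 0

/-- By induction along the steps. Overlap at the visited states suffices, because the target profile
does not reach the others. -/
theorem stateMarginal_eq_zero_of_prob (G : MarkovGame S A₁ A₂ T) {πb π : PolicyProfile S A₁ A₂ T}
    (h : ∀ t s a b, 0 < G.stateMarginal πb t.castSucc s → πb.prob t s a b = 0 →
      π.prob t s a b = 0) (t : Fin (T + 1)) (s : S) (h0 : G.stateMarginal πb t s = 0) :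
    G.stateMarginal π t s = 0 := by
  induction t using Fin.induction generalizing s with
  | zero => simpa only [stateMarginal_zero] using h0
  | succ t ih =>
    rw [stateMarginal_succ] at h0 ⊢
    have hnn : ∀ s₁ a b, 0 ≤ G.trans t s₁ a b s * G.marginal πb t s₁ a b := fun s₁ a b =>
      mul_nonneg (G.trans_nonneg _ _ _ _ _) (G.marginal_nonneg _ _ _ _ _)
    refine Finset.sum_eq_zero fun s₁ _ => Finset.sum_eq_zero fun a _ =>
      Finset.sum_eq_zero fun b _ => ?_
    have e1 := (Finset.sum_eq_zero_iff_of_nonneg fun s _ => Finset.sum_nonneg fun a _ =>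
      Finset.sum_nonneg fun b _ => hnn s a b).1 h0 s₁ (Finset.mem_univ _)
    have e2 := (Finset.sum_eq_zero_iff_of_nonneg fun a _ =>
      Finset.sum_nonneg fun b _ => hnn s₁ a b).1 e1 a (Finset.mem_univ _)
    have e3 := (Finset.sum_eq_zero_iff_of_nonneg fun b _ => hnn s₁ a b).1 e2 b (Finset.mem_univ _)
    rcases mul_eq_zero.1 e3 with e4 | e4
    · rw [e4, zero_mul]
    · simp only [marginal] at e4 ⊢
      by_cases hs : G.stateMarginal πb t.castSucc s₁ = 0
      · rw [ih s₁ hs, mul_zero, mul_zero]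
      · rw [h t s₁ a b (lt_of_le_of_ne (G.stateMarginal_nonneg _ _ _) (Ne.symm hs))
          ((mul_eq_zero.1 e4).resolve_right hs), zero_mul, mul_zero]

theorem covers_of_prob (G : MarkovGame S A₁ A₂ T) {πb π : PolicyProfile S A₁ A₂ T}
    (h : ∀ t s a b, 0 < G.stateMarginal πb t.castSucc s → πb.prob t s a b = 0 →
      π.prob t s a b = 0) : G.Covers πb π := by
  intro t s a b h0
  simp only [marginal] at h0 ⊢
  by_cases hs : G.stateMarginal πb t.castSucc s = 0
  · rw [G.stateMarginal_eq_zero_of_prob h _ _ hs, mul_zero]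
  · rw [h t s a b (lt_of_le_of_ne (G.stateMarginal_nonneg _ _ _) (Ne.symm hs))
      ((mul_eq_zero.1 h0).resolve_right hs), zero_mul]

theorem RewardBounded.of_covers {G : MarkovGame S A₁ A₂ T} {πb π : PolicyProfile S A₁ A₂ T} {R : ℝ}
    (h : G.RewardBounded πb R) (hc : G.Covers πb π) : G.RewardBounded π R :=
  fun t s a b hm => h t s a b fun h0 => hm (hc t s a b h0)

theorem RewardBounded.integrable {G : MarkovGame S A₁ A₂ T} {π : PolicyProfile S A₁ A₂ T} {R : ℝ}
    (h : G.RewardBounded π R) {t : Fin T} {s : S} {a : A₁} {b : A₂}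
    (hm : G.marginal π t s a b ≠ 0) : Integrable (fun r => r) (G.reward t s a b) :=
  Integrable.of_bound measurable_id.aestronglyMeasurable R (h t s a b hm)

/-- The change of measure from behavior to target. Where the denominator is zero the ratio is 0 by
convention, and covering makes the target marginal zero as well. -/
theorem Covers.marginal_mul_marginalRatio {G : MarkovGame S A₁ A₂ T}
    {πb π : PolicyProfile S A₁ A₂ T} (h : G.Covers πb π) (t : Fin T) (s : S) (a : A₁) (b : A₂) :
    G.marginal πb t s a b * G.marginalRatio πb π t s a b = G.marginal π t s a b := by
  by_cases hm : G.marginal πb t s a b = 0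
  · rw [h t s a b hm, hm, zero_mul]
  · rw [marginalRatio, mul_div_cancel₀ _ hm]

theorem stepMean_tdStep (G : MarkovGame S A₁ A₂ T) (γ : ℝ) (t : Fin T) (c q : S → A₁ → A₂ → ℝ)
    (V : S → ℝ) {s : S} {a : A₁} {b : A₂} (h : Integrable (fun r => r) (G.reward t s a b)) :
    G.stepMean t (tdStep γ c q V) s a b =
      c s a b * (G.meanReward t s a b + γ * ∑ s', G.trans t s a b s' * V s' - q s a b) := by
  have h1 : ∀ s', ∫ r, tdStep γ c q V s a b r s' ∂(G.reward t s a b) =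
      c s a b * (G.meanReward t s a b + γ * V s' - q s a b) := by
    intro s'
    simp only [tdStep, meanReward, add_sub_assoc]
    rw [integral_const_mul, integral_add h (integrable_const _)]
    simp
  simp only [stepMean, h1]
  have h2 : ∀ s', G.trans t s a b s' * (c s a b * (G.meanReward t s a b + γ * V s' - q s a b)) =
      c s a b * ((G.meanReward t s a b - q s a b) * G.trans t s a b s' +
        γ * (G.trans t s a b s' * V s')) := fun s' => by ring
  simp only [h2, ← Finset.mul_sum, Finset.sum_add_distrib, G.trans_sum]
  ring

theorem RewardBounded.exists_stepBounded_tdStep {G : MarkovGame S A₁ A₂ T}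
    {π : PolicyProfile S A₁ A₂ T} {R : ℝ} (h : G.RewardBounded π R) (γ : ℝ) (t : Fin T)
    (c q : S → A₁ → A₂ → ℝ) (V : S → ℝ) :
    ∃ B, G.StepBounded π t (tdStep γ c q V) B := by
  set f : S × A₁ × A₂ × S → ℝ := fun x =>
    |c x.1 x.2.1 x.2.2.1| * (|R| + |γ * V x.2.2.2| + |q x.1 x.2.1 x.2.2.1|) with hf
  have hf0 : ∀ x, 0 ≤ f x := fun x => by positivity
  refine ⟨∑ x, f x, fun s a b s' => ?_, fun s a b hm => ?_⟩
  · unfold tdStep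
    fun_prop
  · filter_upwards [h t s a b hm] with r hr s'
    refine le_trans ?_ (Finset.single_le_sum (fun x _ => hf0 x) (Finset.mem_univ (s, a, b, s')))
    simp only [tdStep, hf, abs_mul (c s a b)]
    gcongr
    refine (abs_sub _ _).trans ?_
    gcongr
    exact (abs_add_le _ _).trans (add_le_add (hr.trans (le_abs_self R)) le_rfl)

variable [MeasurableSingletonClass S] [MeasurableSingletonClass A₁] [MeasurableSingletonClass A₂]

/-- The value of a profile in terms of the marginal state-action distributions. -/
theorem RewardBounded.value_eq {G : MarkovGame S A₁ A₂ T} {π : PolicyProfile S A₁ A₂ T} {R : ℝ}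
    (h : G.RewardBounded π R) (γ : ℝ) :
    G.value γ π = ∑ t : Fin T, γ ^ (t : ℕ) * ∑ s, ∑ a, ∑ b,
      G.marginal π t s a b * G.meanReward t s a b := by
  have hb : ∀ t, G.StepBounded π t (fun _ _ _ r _ => r) R := fun t =>
    ⟨fun _ _ _ _ => measurable_id, fun s a b hm => by
      filter_upwards [h t s a b hm] with r hr _ using hr⟩
  have hmean : ∀ t s a b, G.stepMean t (fun _ _ _ r _ => r) s a b = G.meanReward t s a b := by
    intro t s a b
    simp [stepMean, meanReward, ← Finset.sum_mul, G.trans_sum]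
  have hi := fun t => (hb t).integral_eq
  simp only [hmean] at hi
  refine (integral_finsetSum _ fun t _ => (hb t).integrable.const_mul (γ ^ (t : ℕ))).trans ?_
  refine Finset.sum_congr rfl fun t _ => ?_
  rw [← hi t, ← integral_const_mul]

/-- For the true `Q` the bracket in the telescoping identity is the mean reward. -/
theorem RewardBounded.value_eq_sum_init {G : MarkovGame S A₁ A₂ T} {π : PolicyProfile S A₁ A₂ T}
    {R : ℝ} (h : G.RewardBounded π R) (γ : ℝ) :
    G.value γ π = ∑ s, G.init s * G.stateValue γ π 0 s := by
  rw [h.value_eq γ, stateValue_eq_averageValue, ← G.sum_marginal_mul_sub γ π (G.qValue γ π),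
    ← stateValue_eq_averageValue]
  simp only [qValue, add_sub_cancel_right]

theorem RewardBounded.integral_drlSummand {G : MarkovGame S A₁ A₂ T}
    {πb : PolicyProfile S A₁ A₂ T} {R : ℝ} (h : G.RewardBounded πb R) (γ : ℝ)
    (π : PolicyProfile S A₁ A₂ T) (Q μ : Fin T → S → A₁ → A₂ → ℝ) :
    ∫ τ, drlSummand γ π Q μ τ ∂(G.trajLaw πb) = ∑ s, G.init s * π.averageValue Q 0 s +
      ∑ t : Fin T, γ ^ (t : ℕ) * ∑ s, ∑ a, ∑ b, G.marginal πb t s a b * (μ t s a b *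
        (G.meanReward t s a b + γ * ∑ s', G.trans t s a b s' * π.averageValue Q t.succ s' -
          Q t s a b)) := by
  simp only [drlSummand_eq]
  have hint : ∀ t : Fin T, Integrable (fun τ : Trajectory S A₁ A₂ T => γ ^ (t : ℕ) *
      τ.step t (tdStep γ (μ t) (Q t) (π.averageValue Q t.succ))) (G.trajLaw πb) := fun t => by
    obtain ⟨B, hB⟩ := h.exists_stepBounded_tdStep γ t (μ t) (Q t) (π.averageValue Q t.succ)
    exact hB.integrable.const_mul _
  have hint0 : Integrable (fun τ : Trajectory S A₁ A₂ T => π.averageValue Q 0 τ.initState)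
      (G.trajLaw πb) := by
    refine Integrable.of_bound (C := ∑ s, |π.averageValue Q 0 s|) ?_ (ae_of_all _ fun τ => ?_)
    · exact (Trajectory.measurable_of_measurable_rew fun s a b => (measurable_const :
        Measurable fun _ : Fin T → ℝ => π.averageValue Q 0 (s 0))).aestronglyMeasurable
    · exact Finset.single_le_sum (f := fun s => |π.averageValue Q 0 s|) (fun _ _ => abs_nonneg _)
        (Finset.mem_univ τ.initState)
  rw [integral_add hint0 (integrable_finsetSum _ fun t _ => hint t),
    integral_finsetSum _ fun t _ => hint t, integral_initState]
  congr 1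
  refine Finset.sum_congr rfl fun t _ => ?_
  obtain ⟨B, hB⟩ := h.exists_stepBounded_tdStep γ t (μ t) (Q t) (π.averageValue Q t.succ)
  rw [integral_const_mul, hB.integral_eq]
  congr 1
  refine Finset.sum_congr rfl fun s _ => Finset.sum_congr rfl fun a _ =>
    Finset.sum_congr rfl fun b _ => ?_
  by_cases hm : G.marginal πb t s a b = 0
  · rw [hm, zero_mul, zero_mul]
  · rw [G.stepMean_tdStep γ t _ _ _ (h.integrable hm)]

/-- The bias of the doubly robust summand is a product of the errors of the two nuisance functions.
-/
theorem RewardBounded.integral_drlSummand_sub_value {G : MarkovGame S A₁ A₂ T}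
    {πb π : PolicyProfile S A₁ A₂ T} {R : ℝ} (h : G.RewardBounded πb R) (hc : G.Covers πb π) (γ : ℝ)
    (Q μ : Fin T → S → A₁ → A₂ → ℝ) :
    ∫ τ, drlSummand γ π Q μ τ ∂(G.trajLaw πb) - G.value γ π =
      ∑ t : Fin T, γ ^ (t : ℕ) * ∑ s, ∑ a, ∑ b, G.marginal πb t s a b *
        ((μ t s a b - G.marginalRatio πb π t s a b) *
        (γ * ∑ s', G.trans t s a b s' *
          (π.averageValue Q t.succ s' - G.stateValue γ π t.succ s') -
          (Q t s a b - G.qValue γ π t s a b))) := by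
  -- Telescoping writes the start value as a sum against target marginals, that is, behavior
  -- marginals times the true ratio. All terms then run over the same pairs, and the difference of
  -- the ratios factors out of `r + γ P V - Q`; the Bellman equation replaces the mean reward.
  rw [h.integral_drlSummand γ π Q μ, (h.of_covers hc).value_eq γ, ← G.sum_marginal_mul_sub γ π Q,
    ← Finset.sum_add_distrib, ← Finset.sum_sub_distrib]
  refine Finset.sum_congr rfl fun t _ => ?_
  rw [← mul_add, ← mul_sub]
  congr 1
  simp only [← Finset.sum_add_distrib, ← Finset.sum_sub_distrib]
  refine Finset.sum_congr rfl fun s _ => Finset.sum_congr rfl fun a _ =>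
    Finset.sum_congr rfl fun b _ => ?_
  simp only [← hc.marginal_mul_marginalRatio t s a b, qValue, mul_sub, Finset.sum_sub_distrib]
  ring

/-- At the true nuisance functions the doubly robust summand has the value as its mean. -/
theorem RewardBounded.integral_drlSummand_true {G : MarkovGame S A₁ A₂ T}
    {πb π : PolicyProfile S A₁ A₂ T} {R : ℝ} (h : G.RewardBounded πb R) (hc : G.Covers πb π)
    (γ : ℝ) : ∫ τ, drlSummand γ π (G.qValue γ π) (G.marginalRatio πb π) τ ∂(G.trajLaw πb) =
      G.value γ π := by
  rw [← sub_eq_zero, h.integral_drlSummand_sub_value hc]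
  simp

/-- At a state visited under the behavior profile, the target profile only plays action pairs that
the behavior profile plays too, so errors off the support do not enter the average. -/
theorem abs_averageValue_sub_le (G : MarkovGame S A₁ A₂ T) {πb π : PolicyProfile S A₁ A₂ T}
    (hprob : ∀ t s a b, 0 < G.stateMarginal πb t.castSucc s → πb.prob t s a b = 0 →
      π.prob t s a b = 0) (Q Q' : Fin T → S → A₁ → A₂ → ℝ)
    {x : ℝ} (hx : 0 ≤ x) (hQ : ∀ t s a b, G.marginal πb t s a b ≠ 0 → |Q t s a b - Q' t s a b| ≤ x)
    (t : Fin (T + 1)) (s : S) (hs : G.stateMarginal πb t s ≠ 0) :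
    |π.averageValue Q t s - π.averageValue Q' t s| ≤ x := by
  cases t using Fin.lastCases with
  | last => simpa [PolicyProfile.averageValue_last] using hx
  | cast t =>
    simp only [PolicyProfile.averageValue_castSucc, ← Finset.sum_sub_distrib, ← mul_sub]
    calc |∑ a, ∑ b, π.prob t s a b * (Q t s a b - Q' t s a b)|
        ≤ ∑ a, |∑ b, π.prob t s a b * (Q t s a b - Q' t s a b)| := Finset.abs_sum_le_sum_abs _ _
      _ ≤ ∑ a, ∑ b, |π.prob t s a b * (Q t s a b - Q' t s a b)| :=
          Finset.sum_le_sum fun a _ => Finset.abs_sum_le_sum_abs _ _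
      _ ≤ ∑ a, ∑ b, π.prob t s a b * x := by
          refine Finset.sum_le_sum fun a _ => Finset.sum_le_sum fun b _ => ?_
          rw [abs_mul, abs_of_nonneg (π.prob_nonneg t s a b)]
          by_cases hb : πb.prob t s a b = 0
          · rw [hprob t s a b (lt_of_le_of_ne (G.stateMarginal_nonneg _ _ _) (Ne.symm hs)) hb]
            simp
          · exact mul_le_mul_of_nonneg_left (hQ t s a b (mul_ne_zero hb hs))
              (π.prob_nonneg t s a b)
      _ = x := by simp only [← Finset.sum_mul, π.prob_sum, one_mul]

theorem stateMarginal_succ_ne_zero (G : MarkovGame S A₁ A₂ T) {π : PolicyProfile S A₁ A₂ T}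
    {t : Fin T} {s : S} {a : A₁} {b : A₂} {s' : S} (hm : G.marginal π t s a b ≠ 0)
    (ht : G.trans t s a b s' ≠ 0) : G.stateMarginal π t.succ s' ≠ 0 := by
  rw [stateMarginal_succ]
  have hnn : ∀ s a b, 0 ≤ G.trans t s a b s' * G.marginal π t s a b := fun s a b =>
    mul_nonneg (G.trans_nonneg _ _ _ _ _) (G.marginal_nonneg _ _ _ _ _)
  refine ne_of_gt (lt_of_lt_of_le (lt_of_le_of_ne (hnn s a b) (Ne.symm (mul_ne_zero ht hm))) ?_)
  refine le_trans ?_ (Finset.single_le_sum (f := fun s => ∑ a, ∑ b, G.trans t s a b s' *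
    G.marginal π t s a b) (fun s _ => Finset.sum_nonneg fun a _ => Finset.sum_nonneg fun b _ =>
      hnn s a b) (Finset.mem_univ s))
  refine le_trans ?_ (Finset.single_le_sum (f := fun a => ∑ b, G.trans t s a b s' *
    G.marginal π t s a b) (fun a _ => Finset.sum_nonneg fun b _ => hnn s a b) (Finset.mem_univ a))
  exact Finset.single_le_sum (f := fun b => G.trans t s a b s' *
    G.marginal π t s a b) (fun b _ => hnn s a b) (Finset.mem_univ b)

theorem sum_sum_marginal (G : MarkovGame S A₁ A₂ T) (π : PolicyProfile S A₁ A₂ T) (t : Fin T) :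
    ∑ s, ∑ a, ∑ b, G.marginal π t s a b = 1 := by
  simp only [sum_marginal, sum_stateMarginal]

theorem abs_sum_marginal_mul_le (G : MarkovGame S A₁ A₂ T) (π : PolicyProfile S A₁ A₂ T)
    (t : Fin T) (f : S → A₁ → A₂ → ℝ) {x : ℝ}
    (hf : ∀ s a b, G.marginal π t s a b ≠ 0 → |f s a b| ≤ x) :
    |∑ s, ∑ a, ∑ b, G.marginal π t s a b * f s a b| ≤ x := by
  calc |∑ s, ∑ a, ∑ b, G.marginal π t s a b * f s a b|
      ≤ ∑ s, |∑ a, ∑ b, G.marginal π t s a b * f s a b| := Finset.abs_sum_le_sum_abs _ _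
    _ ≤ ∑ s, ∑ a, |∑ b, G.marginal π t s a b * f s a b| :=
        Finset.sum_le_sum fun s _ => Finset.abs_sum_le_sum_abs _ _
    _ ≤ ∑ s, ∑ a, ∑ b, |G.marginal π t s a b * f s a b| :=
        Finset.sum_le_sum fun s _ => Finset.sum_le_sum fun a _ => Finset.abs_sum_le_sum_abs _ _
    _ ≤ ∑ s, ∑ a, ∑ b, G.marginal π t s a b * x := by
        refine Finset.sum_le_sum fun s _ => Finset.sum_le_sum fun a _ =>
          Finset.sum_le_sum fun b _ => ?_
        rw [abs_mul, abs_of_nonneg (G.marginal_nonneg π t s a b)]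
        by_cases hm : G.marginal π t s a b = 0
        · simp [hm]
        · exact mul_le_mul_of_nonneg_left (hf s a b hm) (G.marginal_nonneg _ _ _ _ _)
    _ = x := by simp only [← Finset.sum_mul, sum_sum_marginal, one_mul]

theorem abs_sum_trans_mul_le (G : MarkovGame S A₁ A₂ T) (t : Fin T) (s : S) (a : A₁) (b : A₂)
    (f : S → ℝ) {x : ℝ} (hf : ∀ s', G.trans t s a b s' ≠ 0 → |f s'| ≤ x) :
    |∑ s', G.trans t s a b s' * f s'| ≤ x := by
  calc |∑ s', G.trans t s a b s' * f s'|
      ≤ ∑ s', |G.trans t s a b s' * f s'| := Finset.abs_sum_le_sum_abs _ _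
    _ ≤ ∑ s', G.trans t s a b s' * x := by
        refine Finset.sum_le_sum fun s' _ => ?_
        rw [abs_mul, abs_of_nonneg (G.trans_nonneg t s a b s')]
        by_cases hm : G.trans t s a b s' = 0
        · simp [hm]
        · exact mul_le_mul_of_nonneg_left (hf s' hm) (G.trans_nonneg _ _ _ _ _)
    _ = x := by simp only [← Finset.sum_mul, G.trans_sum, one_mul]

/-- In each of the `T` steps the ratio error multiplies two errors of `Q`: the one at the current
pair and the averaged one at the next state. Successors of visited pairs are visited, so both are at
most `x`. -/
theorem RewardBounded.abs_integral_drlSummand_sub_value_le {G : MarkovGame S A₁ A₂ T}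
    {πb π : PolicyProfile S A₁ A₂ T} {R : ℝ} (h : G.RewardBounded πb R)
    (hprob : ∀ t s a b, 0 < G.stateMarginal πb t.castSucc s → πb.prob t s a b = 0 →
      π.prob t s a b = 0) {γ : ℝ} (hγ₀ : 0 ≤ γ) (hγ₁ : γ ≤ 1)
    (Q μ : Fin T → S → A₁ → A₂ → ℝ) {x y : ℝ} (hx : 0 ≤ x) (hy : 0 ≤ y)
    (hQ : ∀ t s a b, G.marginal πb t s a b ≠ 0 → |Q t s a b - G.qValue γ π t s a b| ≤ x)
    (hμ : ∀ t s a b, G.marginal πb t s a b ≠ 0 →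
      |μ t s a b - G.marginalRatio πb π t s a b| ≤ y) :
    |∫ τ, drlSummand γ π Q μ τ ∂(G.trajLaw πb) - G.value γ π| ≤ 2 * T * (x * y) := by
  rw [h.integral_drlSummand_sub_value (G.covers_of_prob hprob), stateValue_eq_averageValue]
  refine (Finset.abs_sum_le_sum_abs _ _).trans ?_
  have hterm : ∀ t ∈ Finset.univ, |γ ^ ((t : Fin T) : ℕ) * ∑ s, ∑ a, ∑ b,
      G.marginal πb t s a b * ((μ t s a b - G.marginalRatio πb π t s a b) *
        (γ * ∑ s', G.trans t s a b s' *
          (π.averageValue Q t.succ s' - π.averageValue (G.qValue γ π) t.succ s') -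
          (Q t s a b - G.qValue γ π t s a b)))| ≤ y * (x + x) := by
    intro t _
    rw [abs_mul, abs_of_nonneg (pow_nonneg hγ₀ _)]
    refine (mul_le_of_le_one_left (abs_nonneg _) (pow_le_one₀ hγ₀ hγ₁)).trans ?_
    refine G.abs_sum_marginal_mul_le πb t _ fun s a b hm => ?_
    rw [abs_mul]
    refine mul_le_mul (hμ t s a b hm) ?_ (abs_nonneg _) hy
    refine (abs_sub _ _).trans (add_le_add ?_ (hQ t s a b hm))
    rw [abs_mul, abs_of_nonneg hγ₀]
    refine (mul_le_of_le_one_left (abs_nonneg _) hγ₁).trans ?_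
    exact G.abs_sum_trans_mul_le t s a b _ fun s' hs' =>
      G.abs_averageValue_sub_le hprob Q _ hx hQ t.succ s' (G.stateMarginal_succ_ne_zero hm hs')
  refine (Finset.sum_le_card_nsmul _ _ _ hterm).trans (le_of_eq ?_)
  simp
  ring

end MarkovGame

/-! ### Convergence in probability to zero -/

section ConvergenceInMeasure

variable {Ω : Type*} [MeasurableSpace Ω] {P : Measure Ω}

/-- A union bound from which domination, sums and products follow. It needs no measurability, since
outer measures are subadditive. -/
theorem tendstoInMeasure_zero_of_subset {f : ℕ → Ω → ℝ}
    (h : ∀ ε : ℝ, 0 < ε → ∃ g₁ g₂ : ℕ → Ω → ℝ, ∃ ε' : ℝ, 0 < ε' ∧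
      TendstoInMeasure P g₁ atTop (fun _ => 0) ∧ TendstoInMeasure P g₂ atTop (fun _ => 0) ∧
      ∀ᶠ n in atTop, ∀ ω, ε ≤ |f n ω| → ε' ≤ |g₁ n ω| ∨ ε' ≤ |g₂ n ω|) :
    TendstoInMeasure P f atTop (fun _ => 0) := by
  rw [tendstoInMeasure_iff_norm]
  intro ε hε
  obtain ⟨g₁, g₂, ε', hε', h1, h2, hsub⟩ := h ε hε
  rw [tendstoInMeasure_iff_norm] at h1 h2
  have h3 := (h1 ε' hε').add (h2 ε' hε')
  rw [add_zero] at h3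
  refine tendsto_of_tendsto_of_tendsto_of_le_of_le' tendsto_const_nhds h3
    (Eventually.of_forall fun _ => zero_le) ?_
  filter_upwards [hsub] with n hn
  refine (measure_mono fun ω hω => ?_).trans (measure_union_le _ _)
  simp only [sub_zero, Real.norm_eq_abs, Set.mem_ofPred_eq, Set.mem_union] at hω ⊢
  exact hn ω hω

theorem MeasureTheory.TendstoInMeasure.zero_of_abs_le {f g : ℕ → Ω → ℝ}
    (hg : TendstoInMeasure P g atTop (fun _ => 0)) (h : ∀ᶠ n in atTop, ∀ ω, |f n ω| ≤ |g n ω|) :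
    TendstoInMeasure P f atTop (fun _ => 0) :=
  tendstoInMeasure_zero_of_subset fun ε hε => ⟨g, g, ε, hε, hg, hg, by
    filter_upwards [h] with n hn ω hω using Or.inl (hω.trans (hn ω))⟩

theorem MeasureTheory.TendstoInMeasure.zero_add_zero {f g : ℕ → Ω → ℝ}
    (hf : TendstoInMeasure P f atTop (fun _ => 0)) (hg : TendstoInMeasure P g atTop (fun _ => 0)) :
    TendstoInMeasure P (fun n ω => f n ω + g n ω) atTop (fun _ => 0) :=
  tendstoInMeasure_zero_of_subset fun ε hε => ⟨f, g, ε / 2, by positivity, hf, hg,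
    Eventually.of_forall fun n ω hω => by
      by_contra! hcon
      linarith [abs_add_le (f n ω) (g n ω)]⟩

theorem MeasureTheory.TendstoInMeasure.zero_mul_zero {f g : ℕ → Ω → ℝ}
    (hf : TendstoInMeasure P f atTop (fun _ => 0)) (hg : TendstoInMeasure P g atTop (fun _ => 0)) :
    TendstoInMeasure P (fun n ω => f n ω * g n ω) atTop (fun _ => 0) :=
  tendstoInMeasure_zero_of_subset fun ε hε => ⟨f, g, √ε, Real.sqrt_pos.2 hε, hf, hg,
    Eventually.of_forall fun n ω hω => by
      by_contra! hcon
      have := mul_lt_mul'' hcon.1 hcon.2 (abs_nonneg _) (abs_nonneg _)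
      rw [Real.mul_self_sqrt hε.le, ← abs_mul] at this
      linarith⟩

theorem MeasureTheory.TendstoInMeasure.const_mul_zero {f : ℕ → Ω → ℝ}
    (hf : TendstoInMeasure P f atTop (fun _ => 0)) (c : ℝ) :
    TendstoInMeasure P (fun n ω => c * f n ω) atTop (fun _ => 0) :=
  tendstoInMeasure_zero_of_subset fun ε hε => ⟨f, f, ε / (|c| + 1), by positivity, hf, hf,
    Eventually.of_forall fun n ω hω => by
      left
      rw [div_le_iff₀ (by positivity)]
      rw [abs_mul] at hω
      nlinarith [abs_nonneg (f n ω)]⟩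

theorem tendstoInMeasure_zero_zero : TendstoInMeasure P (fun (_ : ℕ) (_ : Ω) => (0 : ℝ)) atTop
    (fun _ => 0) := by
  rw [tendstoInMeasure_iff_norm]
  intro ε hε
  have : {x : Ω | ε ≤ ‖(0 : ℝ) - 0‖} = ∅ := by
    ext x
    simp [hε]
  simp only [this, measure_empty]
  exact tendsto_const_nhds

theorem MeasureTheory.TendstoInMeasure.sum_zero {ι : Type*} (s : Finset ι) {f : ι → ℕ → Ω → ℝ}
    (hf : ∀ i, TendstoInMeasure P (f i) atTop (fun _ => 0)) :
    TendstoInMeasure P (fun n ω => ∑ i ∈ s, f i n ω) atTop (fun _ => 0) := by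
  classical
  induction s using Finset.induction_on with
  | empty => simpa using tendstoInMeasure_zero_zero
  | insert i s hi ih =>
    simp only [Finset.sum_insert hi]
    exact TendstoInMeasure.zero_add_zero (hf i) ih

/-- Bounded convergence in mean square. -/
theorem MeasureTheory.TendstoInMeasure.tendsto_integral_sq [IsProbabilityMeasure P] {f : ℕ → Ω → ℝ}
    (hf : TendstoInMeasure P f atTop (fun _ => 0)) (hm : ∀ n, Measurable (f n)) {M : ℝ}
    (hM : ∀ n ω, |f n ω| ≤ M) : Tendsto (fun n => ∫ ω, f n ω ^ 2 ∂P) atTop (𝓝 0) := by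
  rw [tendstoInMeasure_iff_measureReal_norm] at hf
  simp only [sub_zero, Real.norm_eq_abs] at hf
  rw [Metric.tendsto_atTop]
  intro ε hε
  -- The square is at most `η²` plus `M²` on the event that `|f n|` reaches `η`; with this `η` both
  -- parts are at most half of `ε` in the limit.
  set η := √(ε / 2) with hη
  have hη0 : 0 < η := Real.sqrt_pos.2 (by positivity)
  have hη2 : η ^ 2 = ε / 2 := Real.sq_sqrt (by positivity)
  have h1 := (hf η hη0).const_mul (M ^ 2)
  rw [mul_zero, Metric.tendsto_atTop] at h1
  obtain ⟨N, hN⟩ := h1 (ε / 2) (by positivity)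
  refine ⟨N, fun n hn => ?_⟩
  have h2 := hN n hn
  rw [Real.dist_eq, sub_zero, abs_of_nonneg (by positivity)] at h2
  rw [Real.dist_eq, sub_zero, abs_of_nonneg (integral_nonneg fun _ => sq_nonneg _)]
  set E := {ω | η ≤ |f n ω|} with hE
  have hEm : MeasurableSet E := measurableSet_le measurable_const (hm n).abs
  have hle : ∀ ω, f n ω ^ 2 ≤ η ^ 2 + E.indicator (fun _ => M ^ 2) ω := by
    intro ω
    by_cases hω : ω ∈ E
    · rw [Set.indicator_of_mem hω]
      have := sq_le_sq' (by linarith [hM n ω, abs_nonneg (f n ω)]) (hM n ω)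
      rw [sq_abs] at this
      nlinarith [sq_nonneg η]
    · rw [Set.indicator_of_notMem hω, add_zero]
      have h3 : |f n ω| < η := not_le.1 hω
      have := sq_le_sq' (by linarith [abs_nonneg (f n ω)]) h3.le
      rwa [sq_abs] at this
  have hint : Integrable (fun ω => E.indicator (fun _ => M ^ 2) ω) P :=
    (integrable_const _).indicator hEm
  have h4 : ∫ ω, f n ω ^ 2 ∂P ≤ ∫ ω, (η ^ 2 + E.indicator (fun _ => M ^ 2) ω) ∂P := by
    refine integral_mono ?_ ((integrable_const _).add hint) hle
    refine Integrable.of_bound ((hm n).pow_const 2).aestronglyMeasurable (M ^ 2)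
      (ae_of_all _ fun ω => ?_)
    rw [Real.norm_eq_abs, abs_pow]
    exact pow_le_pow_left₀ (abs_nonneg _) (hM n ω) 2
  rw [integral_add (integrable_const _) hint, integral_indicator_const _ hEm] at h4
  simp only [integral_const, probReal_univ, smul_eq_mul] at h4
  linarith [mul_comm (P.real E) (M ^ 2)]

/-- Chebyshev's inequality. -/
theorem tendstoInMeasure_zero_of_integral_sq [IsProbabilityMeasure P] {f : ℕ → Ω → ℝ}
    (hint : ∀ n, Integrable (fun ω => f n ω ^ 2) P)
    (h : Tendsto (fun n => ∫ ω, f n ω ^ 2 ∂P) atTop (𝓝 0)) :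
    TendstoInMeasure P f atTop (fun _ => 0) := by
  rw [tendstoInMeasure_iff_measureReal_norm]
  intro ε hε
  simp only [sub_zero, Real.norm_eq_abs]
  have h1 := h.const_mul (ε ^ 2)⁻¹
  rw [mul_zero] at h1
  refine tendsto_of_tendsto_of_tendsto_of_le_of_le tendsto_const_nhds h1
    (fun _ => measureReal_nonneg) fun n => ?_
  have h2 := mul_meas_ge_le_integral_of_nonneg (ae_of_all P fun ω => sq_nonneg (f n ω)) (hint n)
    (ε ^ 2)
  have h3 : {ω | ε ≤ |f n ω|} = {ω | ε ^ 2 ≤ f n ω ^ 2} := by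
    ext ω
    simp only [Set.mem_ofPred_eq]
    rw [← sq_abs (f n ω)]
    exact (pow_le_pow_iff_left₀ hε.le (abs_nonneg _) two_ne_zero).symm
  simp only [h3]
  rw [le_inv_mul_iff₀ (by positivity)]
  exact h2

end ConvergenceInMeasure

/-! ### Second moments under cross-fitting -/

section CrossFitting

variable {Ω 𝒳 : Type*} [MeasurableSpace Ω] [MeasurableSpace 𝒳] {P : Measure Ω}
  [IsProbabilityMeasure P] {L : Measure 𝒳} [IsProbabilityMeasure L] {X : ℕ → Ω → 𝒳}

/-- Given the data outside of the fold and the other observation, `X i` still has law `L`, under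
which the estimated function has mean zero. -/
theorem integral_mul_eq_zero_of_fold {n K : ℕ} (hX : ∀ i, Measurable (X i))
    (hlaw : ∀ i, P.map (X i) = L) (hindep : iIndepFun X P) (p : Fin n → Fin K) (k : Fin K)
    (g : ({j : Fin n // p j ≠ k} → 𝒳) → 𝒳 → ℝ) (hg : Measurable (Function.uncurry g))
    (hmean : ∀ D, ∫ x, g D x ∂L = 0) {i i' : Fin n} (hi : p i = k) (hii' : i ≠ i')
    (hint : Integrable (fun ω => g (fun j => X j.1 ω) (X i ω) * g (fun j => X j.1 ω) (X i' ω)) P) :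
    ∫ ω, g (fun j => X j.1 ω) (X i ω) * g (fun j => X j.1 ω) (X i' ω) ∂P = 0 := by
  classical
  set U : Ω → ({j : Fin n // p j ≠ k} → 𝒳) × 𝒳 := fun ω => (fun j => X j.1 ω, X i' ω) with hU
  have hUm : Measurable U := by fun_prop
  -- The index `i` lies in the fold and differs from `i'`, so `U` is a function of the observations
  -- with the other indices.
  have hind : IndepFun U (X i) P := by
    have h := hindep.indepFun_finset ((Finset.range n).erase (i : ℕ)) {(i : ℕ)} (by simp) hX
    have hm1 : Measurable fun (z : ((Finset.range n).erase (i : ℕ) : Finset ℕ) → 𝒳) =>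
        ((fun j => z ⟨(j.1 : ℕ), Finset.mem_erase.2 ⟨fun e => j.2 (by
          rw [Fin.ext e]; exact hi), Finset.mem_range.2 j.1.2⟩⟩,
          z ⟨(i' : ℕ), Finset.mem_erase.2 ⟨fun e => hii' (Fin.ext e.symm),
            Finset.mem_range.2 i'.2⟩⟩) : ({j : Fin n // p j ≠ k} → 𝒳) × 𝒳) := by
      fun_prop
    have hm2 : Measurable fun (z : ({(i : ℕ)} : Finset ℕ) → 𝒳) =>
        z ⟨(i : ℕ), Finset.mem_singleton_self _⟩ := by fun_prop
    exact h.comp hm1 hm2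
  have hmap := hind.map_prod_eq_prod_map_map hUm.aemeasurable (hX i).aemeasurable
  rw [hlaw i] at hmap
  set f : (({j : Fin n // p j ≠ k} → 𝒳) × 𝒳) × 𝒳 → ℝ := fun z => g z.1.1 z.2 * g z.1.1 z.1.2
    with hf
  have hfm : Measurable f := by
    refine Measurable.mul ?_ ?_
    · exact hg.comp (measurable_fst.fst.prodMk measurable_snd)
    · exact hg.comp measurable_fst
  have hUX : Measurable fun ω => (U ω, X i ω) := hUm.prodMk (hX i)
  have e1 : ∫ ω, f (U ω, X i ω) ∂P = ∫ z, f z ∂((P.map U).prod L) := by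
    rw [← hmap, integral_map hUX.aemeasurable hfm.aestronglyMeasurable]
  have hint' : Integrable f ((P.map U).prod L) := by
    rw [← hmap, integrable_map_measure hfm.aestronglyMeasurable hUX.aemeasurable]
    exact hint
  have := Measure.isProbabilityMeasure_map (μ := P) hUm.aemeasurable
  change ∫ ω, f (U ω, X i ω) ∂P = 0
  rw [e1, integral_prod _ hint']
  simp only [hf, integral_mul_const, hmean, zero_mul, integral_zero]

/-- The centered sum over a fold of a function estimated outside of the fold has a second moment of
the order of the size of the fold. -/
theorem integral_sq_sum_fold_le {n K : ℕ} (hX : ∀ i, Measurable (X i))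
    (hlaw : ∀ i, P.map (X i) = L) (hindep : iIndepFun X P) (p : Fin n → Fin K) (k : Fin K)
    (h : ({j : Fin n // p j ≠ k} → 𝒳) → 𝒳 → ℝ) (hh : Measurable (Function.uncurry h))
    (δ : ({j : Fin n // p j ≠ k} → 𝒳) → ℝ) (hδm : Measurable δ) {M : ℝ} (hδM : ∀ D, δ D ≤ M)
    (hδ : ∀ᵐ x ∂L, ∀ D, |h D x| ≤ δ D) :
    Integrable (fun ω => (∑ i with p i = k, (h (fun j => X j.1 ω) (X i ω) -
      ∫ x, h (fun j => X j.1 ω) x ∂L)) ^ 2) P ∧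
    ∫ ω, (∑ i with p i = k, (h (fun j => X j.1 ω) (X i ω) -
      ∫ x, h (fun j => X j.1 ω) x ∂L)) ^ 2 ∂P ≤ n * ∫ ω, 4 * δ (fun j => X j.1 ω) ^ 2 ∂P := by
  classical
  set g : ({j : Fin n // p j ≠ k} → 𝒳) → 𝒳 → ℝ := fun D x => h D x - ∫ x, h D x ∂L with hg
  have hδ0 : ∀ D, 0 ≤ δ D := fun D => by
    obtain ⟨x, hx⟩ := hδ.exists
    exact (abs_nonneg _).trans (hx D)
  have hgm : Measurable (Function.uncurry g) := by
    refine hh.sub ?_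
    have : Measurable fun D => ∫ x, h D x ∂L :=
      (hh.stronglyMeasurable.integral_prod_right' (ν := L)).measurable
    exact this.comp measurable_fst
  have hhint : ∀ D, Integrable (h D) L := fun D =>
    Integrable.of_bound (hh.comp measurable_prodMk_left).aestronglyMeasurable (δ D) (by
      filter_upwards [hδ] with x hx using hx D)
  have hmean : ∀ D, ∫ x, g D x ∂L = 0 := fun D => by
    simp only [hg]
    rw [integral_sub (hhint D) (integrable_const _)]
    simp
  have hmb : ∀ D, |∫ x, h D x ∂L| ≤ δ D := fun D => by
    have := norm_integral_le_of_norm_le_const (μ := L) (f := h D) (C := δ D) (by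
      filter_upwards [hδ] with x hx using hx D)
    simpa using this
  have hgb : ∀ᵐ x ∂L, ∀ D, |g D x| ≤ 2 * δ D := by
    filter_upwards [hδ] with x hx D
    refine (abs_sub _ _).trans ?_
    linarith [hx D, hmb D]
  -- The null set does not depend on `D`; this allows the random data to be inserted for `D` below.
  have hgbX : ∀ i : ℕ, ∀ᵐ ω ∂P, ∀ D, |g D (X i ω)| ≤ 2 * δ D := fun i => by
    rw [← hlaw i] at hgb
    exact ae_of_ae_map (hX i).aemeasurable hgb
  set Dω : Ω → ({j : Fin n // p j ≠ k} → 𝒳) := fun ω j => X j.1 ω with hDω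
  have hDm : Measurable Dω := by fun_prop
  have hgXm : ∀ i : ℕ, Measurable fun ω => g (Dω ω) (X i ω) := fun i =>
    hgm.comp (hDm.prodMk (hX i))
  have hprod : ∀ i j : ℕ, Integrable (fun ω => g (Dω ω) (X i ω) * g (Dω ω) (X j ω)) P := by
    intro i j
    refine Integrable.of_bound ((hgXm i).mul (hgXm j)).aestronglyMeasurable
      ((2 * M) * (2 * M)) ?_
    filter_upwards [hgbX i, hgbX j] with ω hi hj
    rw [norm_mul, Real.norm_eq_abs, Real.norm_eq_abs]
    have h1 := hδM (Dω ω)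
    have h2 := hδ0 (Dω ω)
    exact mul_le_mul ((hi _).trans (by linarith)) ((hj _).trans (by linarith)) (abs_nonneg _)
      (by linarith)
  have hexp : ∀ ω, (∑ i with p i = k, g (Dω ω) (X i ω)) ^ 2 =
      ∑ i with p i = k, ∑ j with p j = k, g (Dω ω) (X i ω) * g (Dω ω) (X j ω) := fun ω => by
    rw [sq, Finset.sum_mul_sum]
  change Integrable (fun ω => (∑ i with p i = k, g (Dω ω) (X i ω)) ^ 2) P ∧
    ∫ ω, (∑ i with p i = k, g (Dω ω) (X i ω)) ^ 2 ∂P ≤ n * ∫ ω, 4 * δ (Dω ω) ^ 2 ∂P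
  simp only [hexp]
  have hδint : Integrable (fun ω => 4 * δ (Dω ω) ^ 2) P := by
    refine Integrable.of_bound (((hδm.comp hDm).pow_const 2).const_mul 4).aestronglyMeasurable
      (4 * M ^ 2) (ae_of_all _ fun ω => ?_)
    rw [Real.norm_eq_abs, abs_of_nonneg (by positivity)]
    exact mul_le_mul_of_nonneg_left (pow_le_pow_left₀ (hδ0 _) (hδM _) 2) (by norm_num)
  refine ⟨integrable_finsetSum _ fun i _ => integrable_finsetSum _ fun j _ => hprod i j, ?_⟩
  rw [integral_finsetSum _ fun (i : Fin n) _ => integrable_finsetSum _ fun (j : Fin n) _ => hprod i j]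
  -- The cross terms vanish, so each `i` contributes only its diagonal term, at most `(2δ)²`; the
  -- factor 2 comes from centering.
  have hterm : ∀ i ∈ Finset.univ.filter fun i => p i = k,
      ∫ ω, ∑ j with p j = k, g (Dω ω) (X i ω) * g (Dω ω) (X j ω) ∂P ≤
        ∫ ω, 4 * δ (Dω ω) ^ 2 ∂P := by
    intro i hi
    rw [integral_finsetSum _ fun (j : Fin n) _ => hprod i j, Finset.sum_eq_single i]
    · refine integral_mono_ae (hprod i i) hδint ?_
      filter_upwards [hgbX i] with ω hω
      have h1 := hω (Dω ω)
      have h2 := mul_le_mul h1 h1 (abs_nonneg _) (by linarith [hδ0 (Dω ω)])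
      rw [abs_mul_abs_self] at h2
      linarith
    · intro j hj hji
      exact integral_mul_eq_zero_of_fold hX hlaw hindep p k g hgm hmean
        (Finset.mem_filter.1 hi).2 hji.symm (hprod i j)
    · exact fun hcon => absurd hi hcon
  refine (Finset.sum_le_card_nsmul _ _ _ hterm).trans ?_
  rw [nsmul_eq_mul]
  refine mul_le_mul_of_nonneg_right ?_ (integral_nonneg fun ω => by positivity)
  exact_mod_cast (Finset.card_le_univ _).trans (by simp)

/-- The second moment bound for random folds that are independent of the data. -/
theorem integral_sq_sum_random_fold_le {n K : ℕ} (hX : ∀ i, Measurable (X i))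
    (hlaw : ∀ i, P.map (X i) = L) (hindep : iIndepFun X P) (fold : Ω → Fin n → Fin K)
    (hfold : Measurable fold) (hfold_indep : IndepFun fold (fun ω (i : Fin n) => X i ω) P)
    (k : Fin K) (h : (p : Fin n → Fin K) → ({j : Fin n // p j ≠ k} → 𝒳) → 𝒳 → ℝ)
    (hh : ∀ p, Measurable (Function.uncurry (h p)))
    (δ : (p : Fin n → Fin K) → ({j : Fin n // p j ≠ k} → 𝒳) → ℝ) (hδm : ∀ p, Measurable (δ p))
    {M : ℝ} (hδM : ∀ p D, δ p D ≤ M) (hδ : ∀ p, ∀ᵐ x ∂L, ∀ D, |h p D x| ≤ δ p D) :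
    Integrable (fun ω => (∑ i with fold ω i = k, (h (fold ω) (fun j => X j.1 ω) (X i ω) -
      ∫ x, h (fold ω) (fun j => X j.1 ω) x ∂L)) ^ 2) P ∧
    ∫ ω, (∑ i with fold ω i = k, (h (fold ω) (fun j => X j.1 ω) (X i ω) -
      ∫ x, h (fold ω) (fun j => X j.1 ω) x ∂L)) ^ 2 ∂P ≤
        n * ∫ ω, 4 * δ (fold ω) (fun j => X j.1 ω) ^ 2 ∂P := by
  classical
  set Y : (Fin n → Fin K) → (Fin n → 𝒳) → ℝ := fun p x =>
    (∑ i with p i = k, (h p (fun j => x j.1) (x i) - ∫ y, h p (fun j => x j.1) y ∂L)) ^ 2 with hY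
  set Δ : (Fin n → Fin K) → (Fin n → 𝒳) → ℝ := fun p x => 4 * δ p (fun j => x j.1) ^ 2 with hΔ
  set W : Ω → Fin n → 𝒳 := fun ω i => X i ω with hW
  have hWm : Measurable W := by fun_prop
  have hYm : ∀ p, Measurable (Y p) := fun p => by
    refine Measurable.pow_const (Finset.measurable_sum _ fun i _ => Measurable.sub ?_ ?_) 2
    · have : Measurable fun x : Fin n → 𝒳 =>
        ((fun j => x j.1, x i) : ({j : Fin n // p j ≠ k} → 𝒳) × 𝒳) := by fun_prop
      exact (hh p).comp this
    · have : Measurable fun D => ∫ x, h p D x ∂L :=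
        ((hh p).stronglyMeasurable.integral_prod_right' (ν := L)).measurable
      have h2 : Measurable fun x : Fin n → 𝒳 =>
        ((fun j => x j.1) : {j : Fin n // p j ≠ k} → 𝒳) := by fun_prop
      exact this.comp h2
  have hΔm : ∀ p, Measurable (Δ p) := fun p => by
    have h2 : Measurable fun x : Fin n → 𝒳 =>
        ((fun j => x j.1) : {j : Fin n // p j ≠ k} → 𝒳) := by fun_prop
    exact (((hδm p).comp h2).pow_const 2).const_mul 4
  have hfix := fun p => integral_sq_sum_fold_le hX hlaw hindep p k (h p) (hh p) (δ p) (hδm p)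
    (hδM p) (hδ p)
  have hδ0 : ∀ p D, 0 ≤ δ p D := fun p D => by
    obtain ⟨x, hx⟩ := (hδ p).exists
    exact (abs_nonneg _).trans (hx D)
  have hΔint : ∀ p, Integrable (fun ω => Δ p (W ω)) P := fun p => by
    refine Integrable.of_bound ((hΔm p).comp hWm).aestronglyMeasurable
      (4 * M ^ 2) (ae_of_all _ fun ω => ?_)
    simp only [hΔ]
    rw [Real.norm_eq_abs, abs_of_nonneg (by positivity)]
    exact mul_le_mul_of_nonneg_left (pow_le_pow_left₀ (hδ0 _ _) (hδM _ _) 2) (by norm_num)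
  -- There are finitely many partitions. Decomposing by the realized one and using its independence
  -- of the data, the expectation is a mixture of those for fixed partitions, to which the previous
  -- bound applies.
  set I : (Fin n → Fin K) → (Fin n → Fin K) → ℝ := fun p q => if q = p then 1 else 0 with hI
  have hIm : ∀ p, Measurable (I p) := fun p => Measurable.ite (measurableSet_singleton p)
    measurable_const measurable_const
  have hsplit : ∀ (Φ : (Fin n → Fin K) → (Fin n → 𝒳) → ℝ) ω, Φ (fold ω) (W ω) =
      ∑ p, I p (fold ω) * Φ p (W ω) := fun Φ ω => by
    rw [Finset.sum_eq_single (fold ω)]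
    · simp [hI]
    · intro q _ hq
      simp [hI, hq.symm]
    · simp
  have hIint : ∀ (Φ : (Fin n → Fin K) → (Fin n → 𝒳) → ℝ),
      (∀ p, Integrable (fun ω => Φ p (W ω)) P) →
      ∀ p, Integrable (fun ω => I p (fold ω) * Φ p (W ω)) P := by
    intro Φ hΦ p
    refine (hΦ p).bdd_mul (c := 1) ((hIm p).comp hfold).aestronglyMeasurable
      (ae_of_all _ fun ω => ?_)
    simp only [hI]
    split_ifs <;> simp
  have hInt : ∀ (Φ : (Fin n → Fin K) → (Fin n → 𝒳) → ℝ), (∀ p, Measurable (Φ p)) →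
      (∀ p, Integrable (fun ω => Φ p (W ω)) P) → ∫ ω, Φ (fold ω) (W ω) ∂P =
      ∑ p, (∫ ω, I p (fold ω) ∂P) * ∫ ω, Φ p (W ω) ∂P := by
    intro Φ hΦm hΦ
    simp only [hsplit Φ]
    rw [integral_finsetSum _ fun p _ => hIint Φ hΦ p]
    refine Finset.sum_congr rfl fun p _ => ?_
    have h1 : IndepFun (fun ω => I p (fold ω)) (fun ω => Φ p (W ω)) P :=
      hfold_indep.comp (hIm p) (hΦm p)
    exact h1.integral_fun_mul_eq_mul_integral ((hIm p).comp hfold).aestronglyMeasurable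
      ((hΦm p).comp hWm).aestronglyMeasurable
  constructor
  · change Integrable (fun ω => Y (fold ω) (W ω)) P
    simp only [hsplit Y]
    exact integrable_finsetSum _ fun p _ => hIint Y (fun p => (hfix p).1) p
  · change ∫ ω, Y (fold ω) (W ω) ∂P ≤ n * ∫ ω, Δ (fold ω) (W ω) ∂P
    rw [hInt Y hYm fun p => (hfix p).1, hInt Δ hΔm hΔint, Finset.mul_sum]
    refine Finset.sum_le_sum fun p _ => ?_
    rw [mul_left_comm]
    refine mul_le_mul_of_nonneg_left (hfix p).2 (integral_nonneg fun ω => ?_)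
    simp only [hI]
    split_ifs <;> simp

end CrossFitting

/-! ### Dependence of the summand on the nuisance functions, and measurability -/

namespace MarkovGame

variable {S A₁ A₂ : Type*} [Fintype S] [Fintype A₁] [Fintype A₂] {T : ℕ}
    [MeasurableSpace S] [MeasurableSpace A₁] [MeasurableSpace A₂]

variable [MeasurableSingletonClass S] [MeasurableSingletonClass A₁] [MeasurableSingletonClass A₂]

theorem l2Norm_nonneg (G : MarkovGame S A₁ A₂ T) (πb : PolicyProfile S A₁ A₂ T) (t : Fin T)
    (f : S → A₁ → A₂ → ℝ) : 0 ≤ G.l2Norm πb t f := Real.sqrt_nonneg _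

/-- On the support of the state-action distribution the `L²` norm controls the values. -/
theorem exists_abs_le_l2Norm (G : MarkovGame S A₁ A₂ T) (πb : PolicyProfile S A₁ A₂ T) :
    ∃ c : ℝ, 0 ≤ c ∧ ∀ t f s a b, G.marginal πb t s a b ≠ 0 →
      |f s a b| ≤ c * G.l2Norm πb t f := by
  -- On the support, the value at a pair is at most the norm divided by the root of the mass of that
  -- pair. Adding all these factors gives a uniform constant; pairs of mass zero contribute 0.
  set w : Fin T × S × A₁ × A₂ → ℝ := fun x => (√(G.marginal πb x.1 x.2.1 x.2.2.1 x.2.2.2))⁻¹ with hw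
  have hw0 : ∀ x, 0 ≤ w x := fun x => by positivity
  refine ⟨∑ x, w x, Finset.sum_nonneg fun x _ => hw0 x, fun t f s a b hm => ?_⟩
  have h1 : w (t, s, a, b) ≤ ∑ x, w x :=
    Finset.single_le_sum (fun x _ => hw0 x) (Finset.mem_univ _)
  refine le_trans ?_ (mul_le_mul_of_nonneg_right h1 (G.l2Norm_nonneg πb t f))
  have hpos : 0 < G.marginal πb t s a b := lt_of_le_of_ne (G.marginal_nonneg _ _ _ _ _) (Ne.symm hm)
  simp only [hw]
  rw [le_inv_mul_iff₀ (Real.sqrt_pos.2 hpos), ← Real.sqrt_sq_eq_abs, ← Real.sqrt_mul hpos.le]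
  refine Real.sqrt_le_sqrt ?_
  have hnn : ∀ s a b, 0 ≤ G.marginal πb t s a b * f s a b ^ 2 := fun s a b =>
    mul_nonneg (G.marginal_nonneg _ _ _ _ _) (sq_nonneg _)
  refine le_trans ?_ (Finset.single_le_sum (f := fun s => ∑ a, ∑ b, G.marginal πb t s a b *
    f s a b ^ 2) (fun s _ => Finset.sum_nonneg fun a _ => Finset.sum_nonneg fun b _ =>
      hnn s a b) (Finset.mem_univ s))
  refine le_trans ?_ (Finset.single_le_sum (f := fun a => ∑ b, G.marginal πb t s a b *
    f s a b ^ 2) (fun a _ => Finset.sum_nonneg fun b _ => hnn s a b) (Finset.mem_univ a))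
  exact Finset.single_le_sum (f := fun b => G.marginal πb t s a b * f s a b ^ 2)
    (fun b _ => hnn s a b) (Finset.mem_univ b)

theorem l2Norm_le (G : MarkovGame S A₁ A₂ T) (πb : PolicyProfile S A₁ A₂ T) (t : Fin T)
    (f : S → A₁ → A₂ → ℝ) {x : ℝ} (hx : 0 ≤ x) (hf : ∀ s a b, |f s a b| ≤ x) :
    G.l2Norm πb t f ≤ x := by
  refine Real.sqrt_le_iff.2 ⟨hx, ?_⟩
  refine (le_abs_self _).trans (G.abs_sum_marginal_mul_le πb t (fun s a b => f s a b ^ 2)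
    fun s a b _ => ?_)
  rw [abs_pow]
  exact pow_le_pow_left₀ (abs_nonneg _) (hf s a b) 2

theorem exists_abs_le_three {B₁ B₂ : Type*} [Fintype B₁] [Fintype B₂] {B₀ : Type*} [Fintype B₀]
    {B₃ : Type*} [Fintype B₃]
    (f : B₀ → B₁ → B₂ → B₃ → ℝ) : ∃ c : ℝ, 0 ≤ c ∧ ∀ i j k l, |f i j k l| ≤ c :=
  ⟨∑ x : B₀ × B₁ × B₂ × B₃, |f x.1 x.2.1 x.2.2.1 x.2.2.2|,
    Finset.sum_nonneg fun _ _ => abs_nonneg _, fun i j k l =>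
    Finset.single_le_sum (f := fun x : B₀ × B₁ × B₂ × B₃ => |f x.1 x.2.1 x.2.2.1 x.2.2.2|)
      (fun _ _ => abs_nonneg _) (Finset.mem_univ (i, j, k, l))⟩

/-- Almost surely the summand of the estimator is Lipschitz in the nuisance functions. -/
theorem RewardBounded.ae_abs_drlSummand_sub_le {G : MarkovGame S A₁ A₂ T}
    {πb π : PolicyProfile S A₁ A₂ T} {R : ℝ} (h : G.RewardBounded πb R)
    (hprob : ∀ t s a b, 0 < G.stateMarginal πb t.castSucc s → πb.prob t s a b = 0 →
      π.prob t s a b = 0) {γ : ℝ} (hγ₀ : 0 ≤ γ) (hγ₁ : γ ≤ 1) {M : ℝ} (hM : 0 ≤ M) :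
    ∃ c : ℝ, 0 ≤ c ∧ ∀ᵐ τ ∂(G.trajLaw πb), ∀ (Q μ : Fin T → S → A₁ → A₂ → ℝ) (x y : ℝ),
      0 ≤ x → 0 ≤ y → (∀ t s a b, |μ t s a b| ≤ M) →
      (∀ t s a b, G.marginal πb t s a b ≠ 0 → |Q t s a b - G.qValue γ π t s a b| ≤ x) →
      (∀ t s a b, G.marginal πb t s a b ≠ 0 →
        |μ t s a b - G.marginalRatio πb π t s a b| ≤ y) →
      |drlSummand γ π Q μ τ - drlSummand γ π (G.qValue γ π) (G.marginalRatio πb π) τ| ≤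
        c * (x + y) := by
  obtain ⟨cq, hcq0, hcq⟩ := exists_abs_le_three (G.qValue γ π)
  -- The two `Unit` arguments only pad the state value to four arguments.
  obtain ⟨cw, hcw0, hcw⟩ := exists_abs_le_three
    (fun (_ _ : Unit) t s => π.averageValue (G.qValue γ π) t s)
  set B := |R| + cw + cq with hB
  have hB0 : 0 ≤ B := by positivity
  -- The start value contributes `x` and each step at most `y * B + 2 * M * x`, where `B` bounds the
  -- true temporal difference.
  refine ⟨1 + T * (B + 2 * M), by positivity, ?_⟩
  -- Only the visited pairs and the rewards decide which trajectories are excluded, so one null set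
  -- serves all `Q` and `μ`.
  have hae := ae_all_iff.2 fun t => G.ae_of_ae_reward πb t (fun _ _ _ r => |r| ≤ R) (h t)
  filter_upwards [hae] with τ hτ Q μ x y hx hy hμM hQ hμ
  have hW : ∀ t, |π.averageValue Q t (τ.1 t) - π.averageValue (G.qValue γ π) t (τ.1 t)| ≤ x := by
    intro t
    cases t using Fin.lastCases with
    | last => simpa [PolicyProfile.averageValue_last] using hx
    | cast t =>
      refine G.abs_averageValue_sub_le hprob Q _ hx hQ _ _ fun h0 => (hτ t).1 ?_
      simp only [marginal, Trajectory.state, h0, mul_zero]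
  rw [drlSummand_eq, drlSummand_eq, add_sub_add_comm, ← Finset.sum_sub_distrib]
  refine (abs_add_le _ _).trans ?_
  have hsum : |∑ t : Fin T, (γ ^ (t : ℕ) * τ.step t (tdStep γ (μ t) (Q t) (π.averageValue Q t.succ)) -
      γ ^ (t : ℕ) * τ.step t (tdStep γ (G.marginalRatio πb π t) (G.qValue γ π t)
        (π.averageValue (G.qValue γ π) t.succ)))| ≤ T * (y * B + M * (2 * x)) := by
    refine (Finset.abs_sum_le_sum_abs _ _).trans ?_
    have hterm : ∀ t ∈ Finset.univ, |(γ ^ ((t : Fin T) : ℕ) *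
        τ.step t (tdStep γ (μ t) (Q t) (π.averageValue Q t.succ)) -
      γ ^ (t : ℕ) * τ.step t (tdStep γ (G.marginalRatio πb π t) (G.qValue γ π t)
        (π.averageValue (G.qValue γ π) t.succ)))| ≤ y * B + M * (2 * x) := by
      intro t _
      rw [← mul_sub, abs_mul, abs_of_nonneg (pow_nonneg hγ₀ _)]
      refine (mul_le_of_le_one_left (abs_nonneg _) (pow_le_one₀ hγ₀ hγ₁)).trans ?_
      simp only [Trajectory.step, tdStep]
      obtain ⟨hm, hr⟩ := hτ t
      have h1 := hQ t _ _ _ hm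
      have h2 := hμ t _ _ _ hm
      have h3 : |π.averageValue Q t.succ (τ.nextState t) -
        π.averageValue (G.qValue γ π) t.succ (τ.nextState t)| ≤ x := hW t.succ
      have h4 := hcq t (τ.state t) (τ.act₁ t) (τ.act₂ t)
      have h5 := hcw () () t.succ (τ.nextState t)
      have h6 := hμM t (τ.state t) (τ.act₁ t) (τ.act₂ t)
      generalize μ t (τ.state t) (τ.act₁ t) (τ.act₂ t) = m' at *
      generalize G.marginalRatio πb π t (τ.state t) (τ.act₁ t) (τ.act₂ t) = m at *
      generalize Q t (τ.state t) (τ.act₁ t) (τ.act₂ t) = q' at *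
      generalize G.qValue γ π t (τ.state t) (τ.act₁ t) (τ.act₂ t) = q at *
      generalize π.averageValue Q t.succ (τ.nextState t) = w' at *
      generalize π.averageValue (G.qValue γ π) t.succ (τ.nextState t) = w at *
      generalize τ.rew t = r at *
      -- The ratio error is paired with the true temporal difference and the value errors with the
      -- estimated ratio, so that a bound on `Q` is not needed.
      have e : m' * (r + γ * w' - q') - m * (r + γ * w - q) =
          (m' - m) * (r + γ * w - q) + m' * (γ * (w' - w) - (q' - q)) := by ring
      rw [e]
      refine (abs_add_le _ _).trans ?_
      rw [abs_mul, abs_mul]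
      have h7 : |r + γ * w - q| ≤ B := by
        refine (abs_sub _ _).trans (add_le_add ((abs_add_le _ _).trans (add_le_add
          (hr.trans (le_abs_self R)) ?_)) h4)
        rw [abs_mul, abs_of_nonneg hγ₀]
        exact (mul_le_of_le_one_left (abs_nonneg _) hγ₁).trans h5
      have h8 : |γ * (w' - w) - (q' - q)| ≤ 2 * x := by
        refine (abs_sub _ _).trans ?_
        rw [two_mul, abs_mul, abs_of_nonneg hγ₀]
        exact add_le_add ((mul_le_of_le_one_left (abs_nonneg _) hγ₁).trans h3) h1
      exact add_le_add (mul_le_mul h2 h7 (abs_nonneg _) hy) (mul_le_mul h6 h8 (abs_nonneg _) hM)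
    refine (Finset.sum_le_card_nsmul _ _ _ hterm).trans (le_of_eq ?_)
    simp only [Finset.card_univ, Fintype.card_fin, nsmul_eq_mul]
  have h0 := hW 0
  have hT : (0 : ℝ) ≤ T := Nat.cast_nonneg T
  refine (add_le_add h0 hsum).trans ?_
  have e1 : 0 ≤ T * (x * B) := by positivity
  have e2 : 0 ≤ T * (M * (2 * y)) := by positivity
  nlinarith

end MarkovGame

/-- Joint measurability in the data and in the new trajectory. The estimators see the trajectory
only through finitely many states and actions, so measurability in the data for fixed arguments is
enough. -/
theorem measurable_drlSummand {S A₁ A₂ α : Type*} [Fintype S] [Fintype A₁] [Fintype A₂] {T : ℕ}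
    [MeasurableSpace S] [MeasurableSingletonClass S] [MeasurableSpace A₁]
    [MeasurableSingletonClass A₁] [MeasurableSpace A₂] [MeasurableSingletonClass A₂]
    [MeasurableSpace α] (γ : ℝ) (π : PolicyProfile S A₁ A₂ T)
    {Q μ : α → Fin T → S → A₁ → A₂ → ℝ} (hQ : ∀ t s a b, Measurable fun D => Q D t s a b)
    (hμ : ∀ t s a b, Measurable fun D => μ D t s a b) :
    Measurable fun z : α × Trajectory S A₁ A₂ T => drlSummand γ π (Q z.1) (μ z.1) z.2 := by
  have hz : ∀ (c : α → S → A₁ → A₂ → ℝ), (∀ s a b, Measurable fun D => c D s a b) → ∀ t,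
      Measurable fun z : α × Trajectory S A₁ A₂ T =>
        c z.1 (z.2.state t) (z.2.act₁ t) (z.2.act₂ t) := by
    intro c hc t
    have h1 : Measurable fun w : α × (S × A₁ × A₂) => c w.1 w.2.1 w.2.2.1 w.2.2.2 :=
      measurable_from_prod_countable_left fun y => hc y.1 y.2.1 y.2.2
    have h2 : Measurable fun z : α × Trajectory S A₁ A₂ T =>
        (z.1, (z.2.state t, z.2.act₁ t, z.2.act₂ t)) := by
      unfold Trajectory.state Trajectory.act₁ Trajectory.act₂
      fun_prop
    exact h1.comp h2
  have hs : ∀ (t : Fin (T + 1)) (c : α → S → ℝ), (∀ s, Measurable fun D => c D s) →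
      Measurable fun z : α × Trajectory S A₁ A₂ T => c z.1 (z.2.1 t) := by
    intro t c hc
    have h1 : Measurable fun w : α × S => c w.1 w.2 :=
      measurable_from_prod_countable_left fun y => hc y
    have h2 : Measurable fun z : α × Trajectory S A₁ A₂ T => (z.1, z.2.1 t) := by
      fun_prop
    exact h1.comp h2
  have hW : ∀ t s, Measurable fun D => π.averageValue (Q D) t s := by
    intro t s
    cases t using Fin.lastCases with
    | last => simp [PolicyProfile.averageValue_last]
    | cast t =>
      simp only [PolicyProfile.averageValue_castSucc]
      exact Finset.measurable_sum _ fun a _ => Finset.measurable_sum _ fun b _ =>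
        (hQ t s a b).const_mul _
  simp only [drlSummand_eq]
  refine (hs 0 (fun D s => π.averageValue (Q D) 0 s) (hW 0)).add
    (Finset.measurable_sum _ fun t _ => Measurable.const_mul ?_ _)
  simp only [Trajectory.step, tdStep]
  refine (hz (fun D => μ D t) (hμ t) t).mul ((Measurable.add ?_
    ((hs t.succ (fun D s => π.averageValue (Q D) t.succ s) (hW _)).const_mul γ)).sub
      (hz (fun D => Q D t) (hQ t) t))
  unfold Trajectory.rew
  fun_prop

theorem measurable_of_fold {Ω 𝒳 : Type*} [MeasurableSpace Ω] [MeasurableSpace 𝒳] {n K : ℕ}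
    {X : ℕ → Ω → 𝒳} (hX : ∀ i, Measurable (X i)) {fold : Ω → Fin n → Fin K}
    (hfold : Measurable fold) {Φ : (Fin n → Fin K) → (Fin n → 𝒳) → ℝ} (hΦ : ∀ p, Measurable (Φ p)) :
    Measurable fun ω => Φ (fold ω) (fun i => X i ω) := by
  have h1 : Measurable fun z : (Fin n → Fin K) × (Fin n → 𝒳) => Φ z.1 z.2 :=
    measurable_from_prod_countable_right hΦ
  have h2 : Measurable fun ω => (fold ω, fun i : Fin n => X i ω) := by fun_prop
  exact h1.comp h2

theorem measurable_drlSummand_trajectory {S A₁ A₂ : Type*} [Fintype S] [Fintype A₁] [Fintype A₂]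
    {T : ℕ} [MeasurableSpace S] [MeasurableSingletonClass S] [MeasurableSpace A₁]
    [MeasurableSingletonClass A₁] [MeasurableSpace A₂] [MeasurableSingletonClass A₂] (γ : ℝ)
    (π : PolicyProfile S A₁ A₂ T) (Q μ : Fin T → S → A₁ → A₂ → ℝ) :
    Measurable (drlSummand γ π Q μ) := by
  refine Trajectory.measurable_of_measurable_rew fun s a b => ?_
  simp only [drlSummand_eq, Trajectory.step, tdStep, Trajectory.initState, Trajectory.state,
    Trajectory.nextState, Trajectory.act₁, Trajectory.act₂, Trajectory.rew]
  fun_prop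

theorem sqrt_mul_one_div_mul_sub (n : ℕ) (s v : ℝ) :
    √(n : ℝ) * (1 / (n : ℝ) * s - v) = (√(n : ℝ))⁻¹ * (s - n * v) := by
  rcases Nat.eq_zero_or_pos n with rfl | hn
  · simp
  · have h1 : (0 : ℝ) < n := by exact_mod_cast hn
    have h2 : 0 < √(n : ℝ) := Real.sqrt_pos.2 h1
    have h3 : √(n : ℝ) * √(n : ℝ) = n := Real.mul_self_sqrt h1.le
    rw [eq_inv_mul_iff_mul_eq₀ h2.ne', ← mul_assoc, h3]
    field_simp

/-! ### Moments and the asymptotically linear expansion -/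

namespace MarkovGame

variable {S A₁ A₂ : Type*} [Fintype S] [Fintype A₁] [Fintype A₂] {T : ℕ}
    [MeasurableSpace S] [MeasurableSpace A₁] [MeasurableSpace A₂]
    [MeasurableSingletonClass S] [MeasurableSingletonClass A₁] [MeasurableSingletonClass A₂]

theorem memLp_initState (G : MarkovGame S A₁ A₂ T) (πb : PolicyProfile S A₁ A₂ T) (f : S → ℝ)
    (p : ENNReal) :
    MemLp (fun τ : Trajectory S A₁ A₂ T => f τ.initState) p (G.trajLaw πb) := by
  refine MemLp.of_bound ?_ (∑ s, |f s|) (ae_of_all _ fun τ => ?_)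
  · exact (Trajectory.measurable_of_measurable_rew fun s a b => (measurable_const :
      Measurable fun _ : Fin T → ℝ => f (s 0))).aestronglyMeasurable
  · exact Finset.single_le_sum (f := fun s => |f s|) (fun _ _ => abs_nonneg _)
      (Finset.mem_univ τ.initState)

theorem RewardBounded.memLp_drlSummand {G : MarkovGame S A₁ A₂ T}
    {πb : PolicyProfile S A₁ A₂ T} {R : ℝ} (h : G.RewardBounded πb R) (γ : ℝ)
    (π : PolicyProfile S A₁ A₂ T) (Q μ : Fin T → S → A₁ → A₂ → ℝ) (p : ENNReal) :
    MemLp (drlSummand γ π Q μ) p (G.trajLaw πb) := by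
  have e : drlSummand γ π Q μ = fun τ => π.averageValue Q 0 τ.initState + ∑ t : Fin T,
      γ ^ (t : ℕ) * τ.step t (tdStep γ (μ t) (Q t) (π.averageValue Q t.succ)) :=
    funext fun τ => drlSummand_eq γ π Q μ τ
  rw [e]
  refine (G.memLp_initState πb _ p).add (memLp_finsetSum _ fun t _ => ?_)
  obtain ⟨B, hB⟩ := h.exists_stepBounded_tdStep γ t (μ t) (Q t) (π.averageValue Q t.succ)
  exact (hB.memLp p).const_mul _

theorem rewardBounded_of_ae {G : MarkovGame S A₁ A₂ T} {πb : PolicyProfile S A₁ A₂ T} {R : ℝ}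
    (h : ∀ᵐ τ ∂(G.trajLaw πb), ∀ t, |τ.rew t| ≤ R) : G.RewardBounded πb R :=
  fun t s a b hm => G.ae_reward_of_ae πb t (E := {r | |r| ≤ R})
    (measurableSet_le measurable_norm measurable_const)
    (by filter_upwards [h] with τ hτ using hτ t) s a b hm

theorem measurable_l2Norm {α : Type*} [MeasurableSpace α] (G : MarkovGame S A₁ A₂ T)
    (πb : PolicyProfile S A₁ A₂ T) (t : Fin T) {f : α → S → A₁ → A₂ → ℝ}
    (hf : ∀ s a b, Measurable fun D => f D s a b) :
    Measurable fun D => G.l2Norm πb t (f D) := by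
  unfold l2Norm
  refine Measurable.sqrt (Finset.measurable_sum _ fun s _ => Finset.measurable_sum _ fun a _ =>
    Finset.measurable_sum _ fun b _ => ((hf s a b).pow_const 2).const_mul _)

end MarkovGame

/-- The estimator minus the truth, as a centered sum and errors of the folds. -/
theorem sqrt_mul_drlEstimator_sub {S A₁ A₂ : Type*} [Fintype A₁] [Fintype A₂] {T K : ℕ}
    (γ v : ℝ) (π : PolicyProfile S A₁ A₂ T) (Qhat μhat : CrossFitEstimator S A₁ A₂ T K) (n : ℕ)
    (p : Fin n → Fin K) (D : ℕ → Trajectory S A₁ A₂ T) (ψ : Trajectory S A₁ A₂ T → ℝ)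
    (m : Fin K → ℝ) :
    √(n : ℝ) * (drlEstimator γ π Qhat μhat n p (fun i => D i) - v) =
      (√(n : ℝ))⁻¹ * (∑ i ∈ Finset.range n, ψ (D i) - n * v) +
      ∑ k, ((√(n : ℝ))⁻¹ * ∑ i with p i = k, (drlSummand γ π (Qhat n p k fun j => D j.1)
          (μhat n p k fun j => D j.1) (D i) - ψ (D i) - m k) +
        (√(n : ℝ))⁻¹ * ((Finset.univ.filter fun i => p i = k).card * m k)) := by
  rw [drlEstimator, sqrt_mul_one_div_mul_sub]
  simp only [← mul_add, ← Finset.mul_sum]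
  congr 1
  have h1 : ∀ k, ∑ i with p i = k, (drlSummand γ π (Qhat n p k fun j => D j.1)
      (μhat n p k fun j => D j.1) (D i) - ψ (D i) - m k) +
      (Finset.univ.filter fun i => p i = k).card * m k =
      ∑ i with p i = k, (drlSummand γ π (Qhat n p (p i) fun j => D j.1)
      (μhat n p (p i) fun j => D j.1) (D i) - ψ (D i)) := by
    intro k
    rw [Finset.sum_sub_distrib, Finset.sum_const, nsmul_eq_mul, sub_add_cancel]
    refine Finset.sum_congr rfl fun i hi => ?_
    -- The type of the data argument depends on `k`, so `k` is eliminated by substitution and not by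
    -- rewriting.
    obtain rfl := (Finset.mem_filter.1 hi).2
    rfl
  simp only [h1]
  rw [Finset.sum_fiberwise, Finset.sum_sub_distrib, Finset.sum_range]
  ring

namespace MarkovGame

variable {S A₁ A₂ : Type*} [Fintype S] [Fintype A₁] [Fintype A₂] {T : ℕ}
    [MeasurableSpace S] [MeasurableSpace A₁] [MeasurableSpace A₂]
    [MeasurableSingletonClass S] [MeasurableSingletonClass A₁] [MeasurableSingletonClass A₂]

theorem measurable_drlEstimator {K n : ℕ} (γ : ℝ) (π : PolicyProfile S A₁ A₂ T)
    {Qhat μhat : CrossFitEstimator S A₁ A₂ T K} (p : Fin n → Fin K)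
    (hQ_meas : ∀ n p k t s a b, Measurable fun D => Qhat n p k D t s a b)
    (hμ_meas : ∀ n p k t s a b, Measurable fun D => μhat n p k D t s a b) :
    Measurable (drlEstimator γ π Qhat μhat n p) := by
  unfold drlEstimator
  refine Measurable.const_mul (Finset.measurable_sum _ fun i _ => ?_) _
  have h1 := measurable_drlSummand γ π (Q := fun D => Qhat n p (p i) D)
    (μ := fun D => μhat n p (p i) D) (hQ_meas n p (p i)) (hμ_meas n p (p i))
  have h2 : Measurable fun D : Fin n → Trajectory S A₁ A₂ T =>
      ((fun j => D j.1, D i) : ({j : Fin n // p j ≠ p i} → Trajectory S A₁ A₂ T) × _) := by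
    fun_prop
  exact h1.comp h2

set_option maxHeartbeats 1000000 in
/-- The estimator is asymptotically linear, with the summand at the true nuisance functions as its
influence function. -/
theorem tendstoInMeasure_drlEstimator_sub (G : MarkovGame S A₁ A₂ T)
    {γ : ℝ} (hγ₀ : 0 ≤ γ) (hγ₁ : γ ≤ 1) {πb π : PolicyProfile S A₁ A₂ T} {C Rmax : ℝ}
    (hprob : ∀ t s a b, 0 < G.stateMarginal πb t.castSucc s → πb.prob t s a b = 0 →
      π.prob t s a b = 0)
    (hR : G.RewardBounded πb Rmax)
    {Ω : Type*} [MeasurableSpace Ω] {P : Measure Ω} [IsProbabilityMeasure P]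
    {X : ℕ → Ω → Trajectory S A₁ A₂ T}
    (hX : ∀ i, Measurable (X i))
    (hlaw : ∀ i, P.map (X i) = G.trajLaw πb)
    (hindep : iIndepFun X P)
    {K : ℕ} {fold : (n : ℕ) → Ω → Fin n → Fin K}
    (hfold : ∀ n, Measurable (fold n))
    (hfold_indep : ∀ n, IndepFun (fold n) (fun ω (i : Fin n) => X i ω) P)
    {Qhat μhat : CrossFitEstimator S A₁ A₂ T K}
    (hQ_meas : ∀ n p k t s a b, Measurable fun D => Qhat n p k D t s a b)
    (hμ_meas : ∀ n p k t s a b, Measurable fun D => μhat n p k D t s a b)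
    (hQ_bound : ∀ n p k D t s a b, |Qhat n p k D t s a b| ≤ ((T : ℝ) - (t : ℕ)) * Rmax)
    (hμ_bound : ∀ n p k D t s a b,
      0 ≤ μhat n p k D t s a b ∧ μhat n p k D t s a b ≤ C ^ ((t : ℕ) + 1))
    {α₁ α₂ : ℝ} (hα₁ : 0 < α₁) (hα₂ : 0 < α₂) (hα : 1 / 2 ≤ α₁ + α₂)
    (hQ_rate : ∀ t k, TendstoInMeasure P
      (fun (n : ℕ) ω => (n : ℝ) ^ α₁ * G.l2Norm πb t fun s a b =>
        Qhat n (fold n ω) k (fun j => X j.1 ω) t s a b - G.qValue γ π t s a b)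
      atTop (fun _ => 0))
    (hμ_rate : ∀ t k, TendstoInMeasure P
      (fun (n : ℕ) ω => (n : ℝ) ^ α₂ * G.l2Norm πb t fun s a b =>
        μhat n (fold n ω) k (fun j => X j.1 ω) t s a b - G.marginalRatio πb π t s a b)
      atTop (fun _ => 0)) :
    TendstoInMeasure P (fun (n : ℕ) ω => √(n : ℝ) *
        (drlEstimator γ π Qhat μhat n (fold n ω) (fun i => X i ω) - G.value γ π) -
      (√(n : ℝ))⁻¹ * (∑ i ∈ Finset.range n,
        drlSummand γ π (G.qValue γ π) (G.marginalRatio πb π) (X i ω) - n * G.value γ π))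
      atTop (fun _ => 0) := by
  obtain ⟨c₂, hc₂0, hc₂⟩ := G.exists_abs_le_l2Norm πb
  obtain ⟨cq, hcq0, hcq⟩ := exists_abs_le_three (G.qValue γ π)
  obtain ⟨cm, hcm0, hcm⟩ := exists_abs_le_three (G.marginalRatio πb π)
  set M : ℝ := ∑ t : Fin T, |C ^ ((t : ℕ) + 1)| with hM
  have hM0 : 0 ≤ M := Finset.sum_nonneg fun _ _ => abs_nonneg _
  have hμM : ∀ n p k D t s a b, |μhat n p k D t s a b| ≤ M := fun n p k D t s a b => by
    rw [abs_of_nonneg (hμ_bound n p k D t s a b).1]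
    exact ((hμ_bound n p k D t s a b).2.trans (le_abs_self _)).trans
      (Finset.single_le_sum (f := fun t : Fin T => |C ^ ((t : ℕ) + 1)|) (fun _ _ => abs_nonneg _)
        (Finset.mem_univ t))
  have hQM : ∀ n p k D t s a b, |Qhat n p k D t s a b| ≤ T * |Rmax| := fun n p k D t s a b => by
    refine (hQ_bound n p k D t s a b).trans ?_
    have h1 : (0 : ℝ) ≤ (T : ℝ) - (t : ℕ) := by
      rw [sub_nonneg]
      exact_mod_cast t.2.le
    exact mul_le_mul (by linarith [(Nat.cast_nonneg (t : ℕ) : (0 : ℝ) ≤ ((t : ℕ) : ℝ))])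
      (le_abs_self _) (by
        -- The assumed bound on `Qhat` forces `Rmax` to be nonnegative, because `T - t` is positive
        -- for every step.
        have := (abs_nonneg _).trans (hQ_bound n p k D t s a b)
        by_contra hneg
        push Not at hneg
        have h2 : (0 : ℝ) < (T : ℝ) - (t : ℕ) := by
          rw [sub_pos]
          exact_mod_cast t.2
        nlinarith) (Nat.cast_nonneg _)
  obtain ⟨c, hc0, hc⟩ := hR.ae_abs_drlSummand_sub_le hprob hγ₀ hγ₁ hM0
  set ψ := drlSummand γ π (G.qValue γ π) (G.marginalRatio πb π) with hψ
  -- errors of the nuisance functions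
  set A : (n : ℕ) → (p : Fin n → Fin K) → (k : Fin K) →
      ({j : Fin n // p j ≠ k} → Trajectory S A₁ A₂ T) → ℝ := fun n p k D =>
    ∑ t, G.l2Norm πb t fun s a b => Qhat n p k D t s a b - G.qValue γ π t s a b with hA
  set B : (n : ℕ) → (p : Fin n → Fin K) → (k : Fin K) →
      ({j : Fin n // p j ≠ k} → Trajectory S A₁ A₂ T) → ℝ := fun n p k D =>
    ∑ t, G.l2Norm πb t fun s a b => μhat n p k D t s a b - G.marginalRatio πb π t s a b with hB
  have hA0 : ∀ n p k D, 0 ≤ A n p k D := fun n p k D =>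
    Finset.sum_nonneg fun t _ => G.l2Norm_nonneg _ _ _
  have hB0 : ∀ n p k D, 0 ≤ B n p k D := fun n p k D =>
    Finset.sum_nonneg fun t _ => G.l2Norm_nonneg _ _ _
  have hAM : ∀ n p k D, A n p k D ≤ T * (T * |Rmax| + cq) := fun n p k D => by
    refine (Finset.sum_le_card_nsmul _ _ (T * |Rmax| + cq) fun t _ => ?_).trans (le_of_eq
      (by simp only [Finset.card_univ, Fintype.card_fin, nsmul_eq_mul]))
    exact G.l2Norm_le πb t _ (by positivity) fun s a b =>
      (abs_sub _ _).trans (add_le_add (hQM n p k D t s a b) (hcq t s a b))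
  have hBM : ∀ n p k D, B n p k D ≤ T * (M + cm) := fun n p k D => by
    refine (Finset.sum_le_card_nsmul _ _ (M + cm) fun t _ => ?_).trans (le_of_eq
      (by simp only [Finset.card_univ, Fintype.card_fin, nsmul_eq_mul]))
    exact G.l2Norm_le πb t _ (by positivity) fun s a b =>
      (abs_sub _ _).trans (add_le_add (hμM n p k D t s a b) (hcm t s a b))
  have hAm : ∀ n p k, Measurable (A n p k) := fun n p k =>
    Finset.measurable_sum _ fun t _ => G.measurable_l2Norm πb t fun s a b =>
      (hQ_meas n p k t s a b).sub_const _
  have hBm : ∀ n p k, Measurable (B n p k) := fun n p k =>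
    Finset.measurable_sum _ fun t _ => G.measurable_l2Norm πb t fun s a b =>
      (hμ_meas n p k t s a b).sub_const _
  have hAerr : ∀ n p k D t s a b, G.marginal πb t s a b ≠ 0 →
      |Qhat n p k D t s a b - G.qValue γ π t s a b| ≤ c₂ * A n p k D := by
    intro n p k D t s a b hm
    refine (hc₂ t (fun s a b => Qhat n p k D t s a b - G.qValue γ π t s a b) s a b hm).trans
      (mul_le_mul_of_nonneg_left ?_ hc₂0)
    exact Finset.single_le_sum (f := fun t => G.l2Norm πb t fun s a b =>
      Qhat n p k D t s a b - G.qValue γ π t s a b) (fun _ _ => G.l2Norm_nonneg _ _ _)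
      (Finset.mem_univ t)
  have hBerr : ∀ n p k D t s a b, G.marginal πb t s a b ≠ 0 →
      |μhat n p k D t s a b - G.marginalRatio πb π t s a b| ≤ c₂ * B n p k D := by
    intro n p k D t s a b hm
    refine (hc₂ t (fun s a b => μhat n p k D t s a b - G.marginalRatio πb π t s a b) s a b hm).trans
      (mul_le_mul_of_nonneg_left ?_ hc₂0)
    exact Finset.single_le_sum (f := fun t => G.l2Norm πb t fun s a b =>
      μhat n p k D t s a b - G.marginalRatio πb π t s a b) (fun _ _ => G.l2Norm_nonneg _ _ _)
      (Finset.mem_univ t)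
  -- the error of the summand
  set h : (n : ℕ) → (p : Fin n → Fin K) → (k : Fin K) →
      ({j : Fin n // p j ≠ k} → Trajectory S A₁ A₂ T) → Trajectory S A₁ A₂ T → ℝ := fun n p k D τ =>
    drlSummand γ π (Qhat n p k D) (μhat n p k D) τ - ψ τ with hh
  set δ : (n : ℕ) → (p : Fin n → Fin K) → (k : Fin K) →
      ({j : Fin n // p j ≠ k} → Trajectory S A₁ A₂ T) → ℝ := fun n p k D =>
    c * (c₂ * A n p k D + c₂ * B n p k D) with hδ
  have hδ0 : ∀ n p k D, 0 ≤ δ n p k D := fun n p k D =>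
    mul_nonneg hc0 (add_nonneg (mul_nonneg hc₂0 (hA0 _ _ _ _)) (mul_nonneg hc₂0 (hB0 _ _ _ _)))
  have hδM : ∀ n p k D, δ n p k D ≤ c * (c₂ * (T * (T * |Rmax| + cq)) + c₂ * (T * (M + cm))) :=
    fun n p k D => mul_le_mul_of_nonneg_left (add_le_add
      (mul_le_mul_of_nonneg_left (hAM n p k D) hc₂0)
      (mul_le_mul_of_nonneg_left (hBM n p k D) hc₂0)) hc0
  have hδm : ∀ n p k, Measurable (δ n p k) := fun n p k =>
    (((hAm n p k).const_mul _).add ((hBm n p k).const_mul _)).const_mul _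
  have hhδ : ∀ n p k, ∀ᵐ τ ∂(G.trajLaw πb), ∀ D, |h n p k D τ| ≤ δ n p k D := fun n p k => by
    filter_upwards [hc] with τ hτ D
    exact hτ _ _ _ _ (mul_nonneg hc₂0 (hA0 n p k D)) (mul_nonneg hc₂0 (hB0 n p k D))
      (hμM n p k D) (hAerr n p k D) (hBerr n p k D)
  have hψm : Measurable ψ := measurable_drlSummand_trajectory _ _ _ _
  have hhm : ∀ n p k, Measurable (Function.uncurry (h n p k)) := fun n p k =>
    (measurable_drlSummand γ π (hQ_meas n p k) (hμ_meas n p k)).sub (hψm.comp measurable_snd)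
  set m : (n : ℕ) → (p : Fin n → Fin K) → (k : Fin K) →
      ({j : Fin n // p j ≠ k} → Trajectory S A₁ A₂ T) → ℝ := fun n p k D =>
    ∫ τ, h n p k D τ ∂(G.trajLaw πb) with hm
  -- As ψ has mean v, the mean error of the summand is its bias, which is of second order.
  have hmle : ∀ n p k D, |m n p k D| ≤ 2 * T * ((c₂ * A n p k D) * (c₂ * B n p k D)) := by
    intro n p k D
    have e : m n p k D = ∫ τ, drlSummand γ π (Qhat n p k D) (μhat n p k D) τ ∂(G.trajLaw πb) -
        G.value γ π := by
      simp only [hm, hh]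
      rw [integral_sub ((hR.memLp_drlSummand γ π _ _ 1).integrable le_rfl)
        ((hR.memLp_drlSummand γ π _ _ 1).integrable le_rfl),
        hR.integral_drlSummand_true (G.covers_of_prob hprob)]
    rw [e]
    exact hR.abs_integral_drlSummand_sub_value_le hprob hγ₀ hγ₁ _ _
      (mul_nonneg hc₂0 (hA0 n p k D)) (mul_nonneg hc₂0 (hB0 n p k D)) (hAerr n p k D)
      (hBerr n p k D)
  -- convergence of the errors
  have hAω : ∀ k, TendstoInMeasure P (fun (n : ℕ) ω => (n : ℝ) ^ α₁ *
      A n (fold n ω) k (fun j => X j.1 ω)) atTop (fun _ => 0) := fun k => by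
    simp only [hA, Finset.mul_sum]
    exact TendstoInMeasure.sum_zero _ fun t => hQ_rate t k
  have hBω : ∀ k, TendstoInMeasure P (fun (n : ℕ) ω => (n : ℝ) ^ α₂ *
      B n (fold n ω) k (fun j => X j.1 ω)) atTop (fun _ => 0) := fun k => by
    simp only [hB, Finset.mul_sum]
    exact TendstoInMeasure.sum_zero _ fun t => hμ_rate t k
  -- For positive exponents `n ^ α` is at least 1, so the rates imply plain consistency; the
  -- centered part needs no more.
  have hδω : ∀ k, TendstoInMeasure P (fun (n : ℕ) ω => δ n (fold n ω) k (fun j => X j.1 ω)) atTop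
      (fun _ => 0) := fun k => by
    refine TendstoInMeasure.zero_of_abs_le
      (((hAω k).zero_add_zero (hBω k)).const_mul_zero (c * c₂)) ?_
    filter_upwards [eventually_ge_atTop 1] with n hn ω
    have hn1 : (1 : ℝ) ≤ n := by exact_mod_cast hn
    have h1 := Real.one_le_rpow hn1 hα₁.le
    have h2 := Real.one_le_rpow hn1 hα₂.le
    have h3 := hA0 n (fold n ω) k (fun j => X j.1 ω)
    have h4 := hB0 n (fold n ω) k (fun j => X j.1 ω)
    rw [abs_of_nonneg (hδ0 _ _ _ _), abs_of_nonneg (by positivity)]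
    simp only [hδ, ← mul_add, ← mul_assoc]
    refine mul_le_mul_of_nonneg_left (add_le_add ?_ ?_) (mul_nonneg hc0 hc₂0)
    · exact le_mul_of_one_le_left h3 h1
    · exact le_mul_of_one_le_left h4 h2
  have hδωm : ∀ k n, Measurable fun ω => δ n (fold n ω) k (fun j => X j.1 ω) := fun k n => by
    refine measurable_of_fold hX (hfold n) (Φ := fun p D => δ n p k (fun j => D j.1)) fun p => ?_
    have h2 : Measurable fun D : Fin n → Trajectory S A₁ A₂ T =>
        ((fun j => D j.1) : {j : Fin n // p j ≠ k} → Trajectory S A₁ A₂ T) := by fun_prop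
    exact (hδm n p k).comp h2
  -- the two parts of the remainder
  have hζ : ∀ k, TendstoInMeasure P (fun (n : ℕ) ω => (√(n : ℝ))⁻¹ * ∑ i with fold n ω i = k,
      (h n (fold n ω) k (fun j => X j.1 ω) (X i ω) - m n (fold n ω) k (fun j => X j.1 ω)))
      atTop (fun _ => 0) := fun k => by
    have hb := fun n => integral_sq_sum_random_fold_le hX hlaw hindep (fold n) (hfold n)
      (hfold_indep n) k (fun p => h n p k) (fun p => hhm n p k) (fun p => δ n p k)
      (fun p => hδm n p k) (fun p => hδM n p k) (fun p => hhδ n p k)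
    refine tendstoInMeasure_zero_of_integral_sq (fun n => ?_) ?_
    · simp only [mul_pow]
      exact (hb n).1.const_mul _
    · have h0 := (hδω k).tendsto_integral_sq (hδωm k) (M := c * (c₂ * (T * (T * |Rmax| + cq)) +
        c₂ * (T * (M + cm)))) fun n ω => by
          rw [abs_of_nonneg (hδ0 _ _ _ _)]
          exact hδM _ _ _ _
      have h1 := h0.const_mul 4
      rw [mul_zero] at h1
      refine tendsto_of_tendsto_of_tendsto_of_le_of_le' tendsto_const_nhds h1
        (Eventually.of_forall fun n => integral_nonneg fun ω => sq_nonneg _) ?_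
      filter_upwards [eventually_ge_atTop 1] with n hn
      have hn1 : (0 : ℝ) < n := by exact_mod_cast hn
      -- The squared normalization cancels the factor `n` of the moment bound, which leaves the mean
      -- square of `δ`.
      simp only [mul_pow, inv_pow, Real.sq_sqrt hn1.le]
      rw [integral_const_mul, inv_mul_le_iff₀ hn1]
      have h2 := (hb n).2
      rw [integral_const_mul] at h2
      exact h2
  -- A fold has at most `n` elements, so the bias is multiplied by at most `√n`, and this is at most
  -- `n ^ α₁ * n ^ α₂`: each error of the product receives its own rate.
  have hβ : ∀ k, TendstoInMeasure P (fun (n : ℕ) ω => (√(n : ℝ))⁻¹ *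
      ((Finset.univ.filter fun i => fold n ω i = k).card * m n (fold n ω) k (fun j => X j.1 ω)))
      atTop (fun _ => 0) := fun k => by
    refine TendstoInMeasure.zero_of_abs_le
      (((hAω k).zero_mul_zero (hBω k)).const_mul_zero (2 * T * (c₂ * c₂))) ?_
    filter_upwards [eventually_ge_atTop 1] with n hn ω
    have hn1 : (1 : ℝ) ≤ n := by exact_mod_cast hn
    have hn0 : (0 : ℝ) < n := by linarith
    have h3 := hA0 n (fold n ω) k (fun j => X j.1 ω)
    have h4 := hB0 n (fold n ω) k (fun j => X j.1 ω)
    have h5 := hmle n (fold n ω) k (fun j => X j.1 ω)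
    have hcard : ((Finset.univ.filter fun i => fold n ω i = k).card : ℝ) ≤ n := by
      exact_mod_cast (Finset.card_le_univ _).trans (by simp)
    have hs : √(n : ℝ) ≤ (n : ℝ) ^ α₁ * (n : ℝ) ^ α₂ := by
      rw [← Real.rpow_add hn0, Real.sqrt_eq_rpow]
      exact Real.rpow_le_rpow_of_exponent_le hn1 hα
    have hs0 : 0 < √(n : ℝ) := Real.sqrt_pos.2 hn0
    rw [abs_mul, abs_mul, abs_of_nonneg (inv_nonneg.2 hs0.le), Nat.abs_cast,
      abs_of_nonneg (by positivity : (0 : ℝ) ≤ 2 * T * (c₂ * c₂) * _)]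
    calc (√(n : ℝ))⁻¹ * (((Finset.univ.filter fun i => fold n ω i = k).card : ℝ) *
          |m n (fold n ω) k (fun j => X j.1 ω)|)
        ≤ (√(n : ℝ))⁻¹ * (n * (2 * T * ((c₂ * A n (fold n ω) k (fun j => X j.1 ω)) *
          (c₂ * B n (fold n ω) k (fun j => X j.1 ω))))) := by gcongr
      _ = √(n : ℝ) * (2 * T * ((c₂ * A n (fold n ω) k (fun j => X j.1 ω)) *
          (c₂ * B n (fold n ω) k (fun j => X j.1 ω)))) := by
          rw [← mul_assoc]
          congr 1
          rw [inv_mul_eq_iff_eq_mul₀ hs0.ne', Real.mul_self_sqrt hn0.le]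
      _ ≤ ((n : ℝ) ^ α₁ * (n : ℝ) ^ α₂) * (2 * T * ((c₂ * A n (fold n ω) k (fun j => X j.1 ω)) *
          (c₂ * B n (fold n ω) k (fun j => X j.1 ω)))) := by gcongr
      _ = _ := by ring
  have hfin := TendstoInMeasure.sum_zero Finset.univ fun k => (hζ k).zero_add_zero (hβ k)
  refine hfin.congr (fun n => ae_of_all _ fun ω => ?_) (ae_eq_refl _)
  have hdec := sqrt_mul_drlEstimator_sub γ (G.value γ π) π Qhat μhat n (fold n ω) (fun i => X i ω) ψ
    (fun k => m n (fold n ω) k (fun j => X j.1 ω))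
  simp only [hdec, hh, add_sub_cancel_left]

end MarkovGame

/-! ### The variance of the influence function -/

/-- The state and the actions of a step. -/
def Trajectory.stateAction {S A₁ A₂ : Type*} {T : ℕ} (t : Fin T) (τ : Trajectory S A₁ A₂ T) :
    S × A₁ × A₂ := (τ.state t, τ.act₁ t, τ.act₂ t)

namespace MarkovGame

variable {S A₁ A₂ : Type*} [Fintype S] [Fintype A₁] [Fintype A₂] {T : ℕ}
    [MeasurableSpace S] [MeasurableSpace A₁] [MeasurableSpace A₂]
    [MeasurableSingletonClass S] [MeasurableSingletonClass A₁] [MeasurableSingletonClass A₂]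

/-- The temporal difference at the true values, weighted by `c`. -/
noncomputable def trueTd (G : MarkovGame S A₁ A₂ T) (γ : ℝ) (π : PolicyProfile S A₁ A₂ T)
    (t : Fin T) (c : S → A₁ → A₂ → ℝ) : S → A₁ → A₂ → ℝ → S → ℝ :=
  tdStep γ c (G.qValue γ π t) (G.stateValue γ π t.succ)

/-- This is the Bellman equation. It is restricted to the support because the rewards are known to
be integrable only there. -/
theorem RewardBounded.stepMean_trueTd {G : MarkovGame S A₁ A₂ T} {πb : PolicyProfile S A₁ A₂ T}
    {R : ℝ} (h : G.RewardBounded πb R) (γ : ℝ) (π : PolicyProfile S A₁ A₂ T) (t : Fin T)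
    (c : S → A₁ → A₂ → ℝ) (s : S) (a : A₁) (b : A₂) (hm : G.marginal πb t s a b ≠ 0) :
    G.stepMean t (G.trueTd γ π t c) s a b = 0 := by
  rw [trueTd, G.stepMean_tdStep γ t _ _ _ (h.integrable hm), qValue, sub_self, mul_zero]

theorem RewardBounded.exists_stepBounded_trueTd {G : MarkovGame S A₁ A₂ T}
    {πb : PolicyProfile S A₁ A₂ T}
    {R : ℝ} (h : G.RewardBounded πb R) (γ : ℝ) (π : PolicyProfile S A₁ A₂ T) (t : Fin T)
    (c : S → A₁ → A₂ → ℝ) : ∃ B, G.StepBounded πb t (G.trueTd γ π t c) B :=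
  h.exists_stepBounded_tdStep γ t _ _ _

theorem RewardBounded.integral_trueTd {G : MarkovGame S A₁ A₂ T} {πb : PolicyProfile S A₁ A₂ T}
    {R : ℝ} (h : G.RewardBounded πb R) (γ : ℝ) (π : PolicyProfile S A₁ A₂ T) (t : Fin T)
    (c : S → A₁ → A₂ → ℝ) : ∫ τ, τ.step t (G.trueTd γ π t c) ∂(G.trajLaw πb) = 0 := by
  obtain ⟨B, hB⟩ := h.exists_stepBounded_trueTd γ π t c
  rw [hB.integral_eq]
  refine Finset.sum_eq_zero fun s _ => Finset.sum_eq_zero fun a _ =>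
    Finset.sum_eq_zero fun b _ => ?_
  by_cases hm : G.marginal πb t s a b = 0
  · rw [hm, zero_mul]
  · rw [h.stepMean_trueTd γ π t c s a b hm, mul_zero]

theorem measurable_stateAction (t : Fin T) :
    Measurable (Trajectory.stateAction t : Trajectory S A₁ A₂ T → S × A₁ × A₂) := by
  unfold Trajectory.stateAction Trajectory.state Trajectory.act₁ Trajectory.act₂
  fun_prop

theorem integrable_comp_stateAction (G : MarkovGame S A₁ A₂ T) (πb : PolicyProfile S A₁ A₂ T)
    (t : Fin T) (f : S × A₁ × A₂ → ℝ) :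
    Integrable (fun τ : Trajectory S A₁ A₂ T => f (τ.stateAction t)) (G.trajLaw πb) := by
  refine Integrable.of_bound (C := ∑ x, |f x|)
    ((measurable_of_countable f).comp (measurable_stateAction t)).aestronglyMeasurable
    (ae_of_all _ fun τ => ?_)
  exact Finset.single_le_sum (f := fun x => |f x|) (fun _ _ => abs_nonneg _)
    (Finset.mem_univ (τ.stateAction t))

theorem RewardBounded.integrable_target {G : MarkovGame S A₁ A₂ T} {πb : PolicyProfile S A₁ A₂ T}
    {R : ℝ} (h : G.RewardBounded πb R) (γ : ℝ) (t : Fin T) (V : S → ℝ) :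
    Integrable (fun τ : Trajectory S A₁ A₂ T => τ.rew t + γ * V (τ.nextState t))
      (G.trajLaw πb) := by
  obtain ⟨B, hB⟩ := h.exists_stepBounded_tdStep γ t (fun _ _ _ => 1) (fun _ _ _ => 0) V
  refine hB.integrable.congr (ae_of_all _ fun τ => ?_)
  simp [Trajectory.step, tdStep]

/-- Over an event determined by the pair, the integral of the difference is the mean of a true
temporal difference weighted by minus the indicator, hence zero. -/
theorem RewardBounded.condExp_eq {G : MarkovGame S A₁ A₂ T} {πb : PolicyProfile S A₁ A₂ T}
    {R : ℝ} (h : G.RewardBounded πb R) (γ : ℝ) (π : PolicyProfile S A₁ A₂ T) (t : Fin T) :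
    (fun τ : Trajectory S A₁ A₂ T => G.qValue γ π t (τ.state t) (τ.act₁ t) (τ.act₂ t))
      =ᵐ[G.trajLaw πb] (G.trajLaw πb)[fun τ => τ.rew t + γ * G.stateValue γ π t.succ (τ.nextState t) |
        MeasurableSpace.comap (Trajectory.stateAction t) inferInstance] := by
  classical
  set f : S × A₁ × A₂ → ℝ := fun x => G.qValue γ π t x.1 x.2.1 x.2.2 with hf
  have hfint : Integrable (fun τ : Trajectory S A₁ A₂ T => f (τ.stateAction t)) (G.trajLaw πb) :=
    G.integrable_comp_stateAction πb t f
  have hXint := h.integrable_target γ t (G.stateValue γ π t.succ)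
  refine ae_eq_condExp_of_forall_setIntegral_eq (measurable_stateAction t).comap_le hXint
    (fun s _ _ => hfint.integrableOn) ?_ ?_
  · rintro _ ⟨B, hB, rfl⟩ -
    have hBm : MeasurableSet (Trajectory.stateAction t ⁻¹' B : Set (Trajectory S A₁ A₂ T)) :=
      measurable_stateAction t hB
    change ∫ τ in _, f (τ.stateAction t) ∂(G.trajLaw πb) = _
    rw [← sub_eq_zero, ← integral_sub hfint.integrableOn hXint.integrableOn,
      ← integral_indicator hBm]
    have h0 := h.integral_trueTd γ π t (fun s a b => B.indicator (fun _ => -1) (s, a, b))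
    rw [← h0]
    refine integral_congr_ae (ae_of_all _ fun τ => ?_)
    simp only [Trajectory.step, trueTd, tdStep, hf]
    by_cases hmem : τ.stateAction t ∈ B
    · rw [Set.indicator_of_mem (show τ ∈ Trajectory.stateAction t ⁻¹' B from hmem),
        Set.indicator_of_mem (show (τ.state t, τ.act₁ t, τ.act₂ t) ∈ B from hmem)]
      simp only [Trajectory.stateAction]
      ring
    · rw [Set.indicator_of_notMem (show τ ∉ Trajectory.stateAction t ⁻¹' B from hmem),
        Set.indicator_of_notMem (show (τ.state t, τ.act₁ t, τ.act₂ t) ∉ B from hmem), zero_mul]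
  · have h1 : Measurable[MeasurableSpace.comap (Trajectory.stateAction t) inferInstance]
        (fun τ : Trajectory S A₁ A₂ T => f (τ.stateAction t)) :=
      (measurable_of_countable f).comp (comap_measurable _)
    exact h1.stronglyMeasurable.aestronglyMeasurable

/-- The conditional variance is the conditional mean of the squared temporal difference, by
`RewardBounded.condExp_eq`. The weight is measurable for the conditioning σ-algebra and moves
inside. -/
theorem RewardBounded.integral_mul_condVar {G : MarkovGame S A₁ A₂ T}
    {πb : PolicyProfile S A₁ A₂ T} {R : ℝ} (h : G.RewardBounded πb R) (γ : ℝ)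
    (π : PolicyProfile S A₁ A₂ T) (t : Fin T) (c : S → A₁ → A₂ → ℝ) :
    ∫ τ, c (τ.state t) (τ.act₁ t) (τ.act₂ t) ^ 2 *
      (Var[fun τ' => τ'.rew t + γ * G.stateValue γ π t.succ (τ'.nextState t); G.trajLaw πb |
        MeasurableSpace.comap (Trajectory.stateAction t) inferInstance]) τ ∂(G.trajLaw πb) =
    ∫ τ, τ.step t (G.trueTd γ π t c) ^ 2 ∂(G.trajLaw πb) := by
  set m : MeasurableSpace (Trajectory S A₁ A₂ T) :=
    MeasurableSpace.comap (Trajectory.stateAction t) inferInstance with hm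
  have hle := (measurable_stateAction (S := S) (A₁ := A₁) (A₂ := A₂) t).comap_le
  set f : S × A₁ × A₂ → ℝ := fun x => c x.1 x.2.1 x.2.2 ^ 2 with hf
  set D : Trajectory S A₁ A₂ T → ℝ := fun τ => τ.step t (G.trueTd γ π t fun _ _ _ => 1) ^ 2 with hD
  have hDint : Integrable D (G.trajLaw πb) := by
    obtain ⟨B, hB⟩ := h.exists_stepBounded_trueTd γ π t (fun _ _ _ => 1)
    exact (hB.memLp 2).integrable_sq
  have hfDe : (fun τ : Trajectory S A₁ A₂ T => f (τ.stateAction t)) * D =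
      fun τ => τ.step t (G.trueTd γ π t c) ^ 2 := by
    funext τ
    simp only [Pi.mul_apply, hf, hD, Trajectory.step, trueTd, tdStep, Trajectory.stateAction]
    ring
  have hfDint : Integrable ((fun τ : Trajectory S A₁ A₂ T => f (τ.stateAction t)) * D)
      (G.trajLaw πb) := by
    rw [hfDe]
    obtain ⟨B, hB⟩ := h.exists_stepBounded_trueTd γ π t c
    exact (hB.memLp 2).integrable_sq
  have hfm : StronglyMeasurable[m] (fun τ : Trajectory S A₁ A₂ T => f (τ.stateAction t)) := by
    have h1 : Measurable[m] (fun τ : Trajectory S A₁ A₂ T => f (τ.stateAction t)) :=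
      (measurable_of_countable f).comp (comap_measurable _)
    exact h1.stronglyMeasurable
  have hvar : Var[fun τ' => τ'.rew t + γ * G.stateValue γ π t.succ (τ'.nextState t); G.trajLaw πb | m]
      =ᵐ[G.trajLaw πb] (G.trajLaw πb)[D | m] := by
    refine condExp_congr_ae ?_
    filter_upwards [h.condExp_eq γ π t] with τ hτ
    simp only [Pi.pow_apply, Pi.sub_apply, hD, Trajectory.step, trueTd, tdStep, one_mul]
    rw [hτ]
  have hpull := condExp_mul_of_stronglyMeasurable_left hfm hfDint hDint
  rw [← hfDe]
  refine Eq.trans (integral_congr_ae ?_) (integral_condExp hle)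
  filter_upwards [hvar, hpull] with τ h1 h2
  rw [h1, h2]
  simp only [Pi.mul_apply, hf, Trajectory.stateAction]

/-- The efficient influence function, up to its mean, is the doubly robust summand at the true
nuisance functions; its variance is `Υ_EB`. -/
theorem RewardBounded.variance_drlSummand {G : MarkovGame S A₁ A₂ T}
    {πb : PolicyProfile S A₁ A₂ T} {R : ℝ} (h : G.RewardBounded πb R) (γ : ℝ)
    (π : PolicyProfile S A₁ A₂ T) :
    Var[drlSummand γ π (G.qValue γ π) (G.marginalRatio πb π); G.trajLaw πb] =
      G.upsilonEB γ πb π := by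
  set W : Trajectory S A₁ A₂ T → ℝ := fun τ => G.stateValue γ π 0 τ.initState with hW
  set Y : Fin T → Trajectory S A₁ A₂ T → ℝ := fun t τ =>
    γ ^ (t : ℕ) * τ.step t (G.trueTd γ π t (G.marginalRatio πb π t)) with hY
  have hψ : drlSummand γ π (G.qValue γ π) (G.marginalRatio πb π) = W + ∑ t, Y t := by
    funext τ
    rw [drlSummand_eq, ← stateValue_eq_averageValue]
    simp only [Pi.add_apply, Finset.sum_apply, hW, hY, trueTd]
  have hWL : MemLp W 2 (G.trajLaw πb) := G.memLp_initState πb _ 2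
  have hYL : ∀ t, MemLp (Y t) 2 (G.trajLaw πb) := fun t => by
    obtain ⟨B, hB⟩ := h.exists_stepBounded_trueTd γ π t (G.marginalRatio πb π t)
    exact (hB.memLp 2).const_mul _
  have hY0 : ∀ t, ∫ τ, Y t τ ∂(G.trajLaw πb) = 0 := fun t => by
    simp only [hY]
    rw [integral_const_mul, h.integral_trueTd, mul_zero]
  have hWY : ∀ t, cov[W, Y t; G.trajLaw πb] = 0 := fun t => by
    rw [covariance_eq_sub hWL (hYL t), hY0 t, mul_zero, sub_zero]
    obtain ⟨B, hB⟩ := h.exists_stepBounded_trueTd γ π t (G.marginalRatio πb π t)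
    have h1 := hB.integral_initState_mul_eq_zero (fun s => γ ^ (t : ℕ) * G.stateValue γ π 0 s)
      (h.stepMean_trueTd γ π t _)
    rw [← h1]
    refine integral_congr_ae (ae_of_all _ fun τ => ?_)
    simp only [Pi.mul_apply, hW, hY]
    ring
  -- Martingale differences at different steps are uncorrelated, so only the diagonal of the double
  -- sum of covariances survives.
  have hYY : ∀ u t, u < t → cov[Y u, Y t; G.trajLaw πb] = 0 := fun u t hut => by
    rw [covariance_eq_sub (hYL u) (hYL t), hY0 t, mul_zero, sub_zero]
    obtain ⟨B, hB⟩ := h.exists_stepBounded_trueTd γ π t (G.marginalRatio πb π t)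
    obtain ⟨B', hB'⟩ := h.exists_stepBounded_trueTd γ π u (G.marginalRatio πb π u)
    have h1 := hB.integral_mul_eq_zero hut hB' (h.stepMean_trueTd γ π t _)
    have h2 : Y u * Y t = fun τ => (γ ^ (u : ℕ) * γ ^ (t : ℕ)) *
        (τ.step u (G.trueTd γ π u (G.marginalRatio πb π u)) *
        τ.step t (G.trueTd γ π t (G.marginalRatio πb π t))) := by
      funext τ
      simp only [Pi.mul_apply, hY]
      ring
    rw [h2, integral_const_mul, h1, mul_zero]
  have hYY' : ∀ u t, t ≠ u → cov[Y u, Y t; G.trajLaw πb] = 0 := fun u t hut => by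
    rcases lt_or_gt_of_ne hut with h1 | h1
    · rw [covariance_comm, hYY t u h1]
    · exact hYY u t h1
  have hsumL : MemLp (∑ t, Y t) 2 (G.trajLaw πb) := memLp_finsetSum' _ fun t _ => hYL t
  rw [hψ, variance_add hWL hsumL, covariance_sum_right (fun t => hYL t) hWL,
    Finset.sum_eq_zero fun t _ => hWY t, mul_zero, add_zero, variance_sum fun t => hYL t, upsilonEB]
  congr 1
  refine Finset.sum_congr rfl fun t _ => ?_
  rw [Finset.sum_eq_single t (fun u _ hu => hYY' t u hu) (by simp),
    covariance_self (hYL t).aemeasurable, variance_of_integral_eq_zero (hYL t).aemeasurable (hY0 t)]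
  have h1 := h.integral_mul_condVar γ π t (G.marginalRatio πb π t)
  have h2 : ∀ τ : Trajectory S A₁ A₂ T, Y t τ ^ 2 = γ ^ (2 * (t : ℕ)) *
      τ.step t (G.trueTd γ π t (G.marginalRatio πb π t)) ^ 2 := fun τ => by
    simp only [hY]
    ring
  simp only [h2, mul_assoc]
  rw [integral_const_mul, integral_const_mul, ← h1]
  -- The σ-algebra written out in `upsilonEB` is the one generated by `Trajectory.stateAction t`, by
  -- unfolding.
  rfl

end MarkovGame

/-! ### The central limit theorem -/

/-- Convergence in distribution depends on the limit variable only through its law. -/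
theorem MeasureTheory.TendstoInDistribution.of_map_eq {ι Ω Ω' Ω'' E : Type*}
    [MeasurableSpace Ω] [MeasurableSpace Ω'] [MeasurableSpace Ω''] [TopologicalSpace E]
    [MeasurableSpace E] [OpensMeasurableSpace E] {P : Measure Ω} [IsProbabilityMeasure P]
    {P' : Measure Ω'} [IsProbabilityMeasure P'] {P'' : Measure Ω''} [IsProbabilityMeasure P'']
    {X : ι → Ω → E} {l : Filter ι} {Z : Ω' → E} {W : Ω'' → E}
    (h : TendstoInDistribution X l Z (fun _ => P) P') (hW : AEMeasurable W P'')
    (hZW : P'.map Z = P''.map W) : TendstoInDistribution X l W (fun _ => P) P'' where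
  forall_aemeasurable := h.forall_aemeasurable
  aemeasurable_limit := hW
  tendsto := by
    have h1 := h.tendsto
    simp only [hZW] at h1
    exact h1

/-- Centered Gaussian laws are symmetric; this gives the statement for player 2. -/
theorem MeasureTheory.TendstoInDistribution.neg_gaussianReal {Ω : Type*} [MeasurableSpace Ω]
    {P : Measure Ω} [IsProbabilityMeasure P] {X : ℕ → Ω → ℝ} {v : NNReal}
    (h : TendstoInDistribution X atTop (id : ℝ → ℝ) (fun _ => P) (gaussianReal 0 v)) :
    TendstoInDistribution (fun n ω => -X n ω) atTop (id : ℝ → ℝ) (fun _ => P)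
      (gaussianReal 0 v) := by
  have h1 := h.continuous_comp (g := fun x : ℝ => -x) continuous_neg
  refine h1.of_map_eq aemeasurable_id ?_
  rw [Measure.map_id, Function.comp_id, gaussianReal_map_neg, neg_zero]

/-- The central limit theorem for a function of an independent and identically distributed sequence.
-/
theorem tendstoInDistribution_inv_sqrt_mul_sum_comp {Ω 𝒳 : Type*} [MeasurableSpace Ω]
    [MeasurableSpace 𝒳] {P : Measure Ω} [IsProbabilityMeasure P] {L : Measure 𝒳}
    {X : ℕ → Ω → 𝒳} (hX : ∀ i, Measurable (X i)) (hlaw : ∀ i, P.map (X i) = L)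
    (hindep : iIndepFun X P) {ψ : 𝒳 → ℝ} (hψm : Measurable ψ) (hψ : MemLp ψ 2 L) :
    TendstoInDistribution
      (fun (n : ℕ) ω => (√(n : ℝ))⁻¹ * (∑ i ∈ Finset.range n, ψ (X i ω) - n * ∫ x, ψ x ∂L))
      atTop (id : ℝ → ℝ) (fun _ => P) (gaussianReal 0 (Var[ψ; L]).toNNReal) := by
  have hmean : ∫ ω, ψ (X 0 ω) ∂P = ∫ x, ψ x ∂L := by
    rw [← hlaw 0, integral_map (hX 0).aemeasurable hψm.aestronglyMeasurable]
  have hvar : Var[fun ω => ψ (X 0 ω); P] = Var[ψ; L] := by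
    rw [← hlaw 0, variance_map hψm.aemeasurable (hX 0).aemeasurable]
    rfl
  have hYlaw : HasLaw (id : ℝ → ℝ) (gaussianReal 0 (Var[fun ω => ψ (X 0 ω); P]).toNNReal)
      (gaussianReal 0 (Var[ψ; L]).toNNReal) := ⟨aemeasurable_id, by rw [Measure.map_id, hvar]⟩
  have hL : MemLp (fun ω => ψ (X 0 ω)) 2 P := by
    rw [← hlaw 0] at hψ
    exact hψ.comp_of_map (hX 0).aemeasurable
  have h := tendstoInDistribution_inv_sqrt_mul_sum_sub (X := fun i ω => ψ (X i ω)) hYlaw hL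
    (hindep.comp (fun _ => ψ) fun _ => hψm) fun i => by
      refine ⟨(hψm.comp (hX i)).aemeasurable, (hψm.comp (hX 0)).aemeasurable, ?_⟩
      have e : ∀ i, P.map (fun ω => ψ (X i ω)) = L.map ψ := fun i => by
        rw [← hlaw i, Measure.map_map hψm (hX i)]
        rfl
      rw [e i, e 0]
  simpa only [hmean] using h

namespace MarkovGame

variable {S A₁ A₂ : Type*} [Fintype S] [Fintype A₁] [Fintype A₂] {T : ℕ}
    [MeasurableSpace S] [MeasurableSpace A₁] [MeasurableSpace A₂]
    [MeasurableSingletonClass S] [MeasurableSingletonClass A₁] [MeasurableSingletonClass A₂]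

/-- Slutsky's lemma: the central limit theorem for ψ, plus a remainder that tends to zero in
probability. -/
theorem tendstoInDistribution_drlEstimator (G : MarkovGame S A₁ A₂ T)
    {γ : ℝ} (hγ₀ : 0 ≤ γ) (hγ₁ : γ ≤ 1) {πb π : PolicyProfile S A₁ A₂ T} {C Rmax : ℝ}
    (hprob : ∀ t s a b, 0 < G.stateMarginal πb t.castSucc s → πb.prob t s a b = 0 →
      π.prob t s a b = 0)
    (hR : G.RewardBounded πb Rmax)
    {Ω : Type*} [MeasurableSpace Ω] {P : Measure Ω} [IsProbabilityMeasure P]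
    {X : ℕ → Ω → Trajectory S A₁ A₂ T}
    (hX : ∀ i, Measurable (X i))
    (hlaw : ∀ i, P.map (X i) = G.trajLaw πb)
    (hindep : iIndepFun X P)
    {K : ℕ} {fold : (n : ℕ) → Ω → Fin n → Fin K}
    (hfold : ∀ n, Measurable (fold n))
    (hfold_indep : ∀ n, IndepFun (fold n) (fun ω (i : Fin n) => X i ω) P)
    {Qhat μhat : CrossFitEstimator S A₁ A₂ T K}
    (hQ_meas : ∀ n p k t s a b, Measurable fun D => Qhat n p k D t s a b)
    (hμ_meas : ∀ n p k t s a b, Measurable fun D => μhat n p k D t s a b)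
    (hQ_bound : ∀ n p k D t s a b, |Qhat n p k D t s a b| ≤ ((T : ℝ) - (t : ℕ)) * Rmax)
    (hμ_bound : ∀ n p k D t s a b,
      0 ≤ μhat n p k D t s a b ∧ μhat n p k D t s a b ≤ C ^ ((t : ℕ) + 1))
    {α₁ α₂ : ℝ} (hα₁ : 0 < α₁) (hα₂ : 0 < α₂) (hα : 1 / 2 ≤ α₁ + α₂)
    (hQ_rate : ∀ t k, TendstoInMeasure P
      (fun (n : ℕ) ω => (n : ℝ) ^ α₁ * G.l2Norm πb t fun s a b =>
        Qhat n (fold n ω) k (fun j => X j.1 ω) t s a b - G.qValue γ π t s a b)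
      atTop (fun _ => 0))
    (hμ_rate : ∀ t k, TendstoInMeasure P
      (fun (n : ℕ) ω => (n : ℝ) ^ α₂ * G.l2Norm πb t fun s a b =>
        μhat n (fold n ω) k (fun j => X j.1 ω) t s a b - G.marginalRatio πb π t s a b)
      atTop (fun _ => 0)) :
    TendstoInDistribution
      (fun (n : ℕ) ω => √(n : ℝ) *
        (drlEstimator γ π Qhat μhat n (fold n ω) (fun i => X i ω) - G.value γ π))
      atTop (id : ℝ → ℝ) (fun _ => P) (gaussianReal 0 (G.upsilonEB γ πb π).toNNReal) := by
  have hclt := tendstoInDistribution_inv_sqrt_mul_sum_comp hX hlaw hindep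
    (measurable_drlSummand_trajectory γ π (G.qValue γ π) (G.marginalRatio πb π))
    (hR.memLp_drlSummand γ π _ _ 2)
  have hrem := G.tendstoInMeasure_drlEstimator_sub hγ₀ hγ₁ hprob hR hX hlaw hindep hfold hfold_indep
    hQ_meas hμ_meas hQ_bound hμ_bound hα₁ hα₂ hα hQ_rate hμ_rate
  rw [hR.integral_drlSummand_true (G.covers_of_prob hprob)] at hclt
  simp only [hR.variance_drlSummand γ π] at hclt
  refine tendstoInDistribution_of_tendstoInMeasure_sub _ _ hclt hrem fun n => ?_
  exact ((measurable_of_fold hX (hfold n) fun p =>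
    measurable_drlEstimator γ π p hQ_meas hμ_meas).sub_const _).const_mul _ |>.aemeasurable

end MarkovGame

/-! ### Differentiation along families of laws -/

/-- A product rule in which one factor vanishes at 0, so that continuity of the other is enough. It
is meant for density ratios multiplied by means of temporal differences. -/
theorem hasDerivAt_mul_of_continuousAt {f g : ℝ → ℝ} {g' : ℝ} (hf : ContinuousAt f 0)
    (hg : HasDerivAt g g' 0) (h0 : g 0 = 0) : HasDerivAt (fun θ => f θ * g θ) (f 0 * g') 0 := by
  rw [hasDerivAt_iff_tendsto_slope_zero] at hg ⊢
  simp only [zero_add, h0, mul_zero, sub_zero, smul_eq_mul] at hg ⊢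
  have h1 := (hf.tendsto.mono_left nhdsWithin_le_nhds).mul hg
  refine h1.congr fun θ => by ring

section MeanSquare

variable {𝒳 : Type*} [MeasurableSpace 𝒳] {L : Measure 𝒳} [IsProbabilityMeasure L]

theorem sq_integral_le_integral_sq {f : 𝒳 → ℝ} (hf : MemLp f 2 L) :
    (∫ x, f x ∂L) ^ 2 ≤ ∫ x, f x ^ 2 ∂L := by
  have h1 := variance_nonneg f L
  rw [variance_eq_sub hf] at h1
  simp only [Pi.pow_apply] at h1
  linarith

/-- The Cauchy–Schwarz inequality, from the discriminant of the nonnegative quadratic `c ↦ ∫ (c f +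
g)²`. -/
theorem sq_integral_mul_le {f g : 𝒳 → ℝ} (hf : MemLp f 2 L) (hg : MemLp g 2 L) :
    (∫ x, f x * g x ∂L) ^ 2 ≤ (∫ x, f x ^ 2 ∂L) * ∫ x, g x ^ 2 ∂L := by
  have hfg : Integrable (fun x => f x * g x) L := hf.integrable_mul hg
  have hf2 := hf.integrable_sq
  have hg2 := hg.integrable_sq
  have key : ∀ c : ℝ, 0 ≤ (∫ x, f x ^ 2 ∂L) * (c * c) + (2 * ∫ x, f x * g x ∂L) * c +
      ∫ x, g x ^ 2 ∂L := by
    intro c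
    have h1 : ∫ x, (c * f x + g x) ^ 2 ∂L = (∫ x, f x ^ 2 ∂L) * (c * c) +
        (2 * ∫ x, f x * g x ∂L) * c + ∫ x, g x ^ 2 ∂L := by
      have e : ∀ x, (c * f x + g x) ^ 2 = c * c * f x ^ 2 + 2 * c * (f x * g x) + g x ^ 2 :=
        fun x => by ring
      simp only [e]
      have hA : Integrable (fun x => c * c * f x ^ 2 + 2 * c * (f x * g x)) L :=
        (hf2.const_mul _).add (hfg.const_mul _)
      rw [integral_add hA hg2, integral_add (hf2.const_mul _) (hfg.const_mul _), integral_const_mul, integral_const_mul]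
      ring
    rw [← h1]
    exact integral_nonneg fun x => sq_nonneg _
  have := discrim_le_zero key
  rw [discrim] at this
  nlinarith

/-- Expectations of bounded functions are differentiable along a family of densities that is
differentiable in quadratic mean. -/
theorem hasDerivAt_integral_of_quadratic_mean {law : ℝ → Measure 𝒳}
    (hlaw : ∀ θ, IsProbabilityMeasure (law θ)) (hlaw0 : law 0 = L) {d : ℝ → 𝒳 → ℝ}
    (hd0 : ∀ θ x, 0 ≤ d θ x) (hdm : ∀ θ, Measurable (d θ))
    (hd : ∀ᶠ θ in 𝓝 0, law θ = L.withDensity fun x => ENNReal.ofReal (d θ x))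
    {s : 𝒳 → ℝ} (hs : MemLp s 2 L)
    (hq : Tendsto (fun θ : ℝ => (∫ x, (√(d θ x) - 1 - θ / 2 * s x) ^ 2 ∂L) / θ ^ 2)
      (𝓝[≠] 0) (𝓝 0))
    {f : 𝒳 → ℝ} (hfm : Measurable f) {B : ℝ} (hfB : ∀ᵐ x ∂L, |f x| ≤ B) :
    HasDerivAt (fun θ => ∫ x, f x ∂(law θ)) (∫ x, f x * s x ∂L) 0 := by
  have hB0 : 0 ≤ B := by
    obtain ⟨x, hx⟩ := hfB.exists
    exact (abs_nonneg _).trans hx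
  rw [hasDerivAt_iff_tendsto_slope_zero]
  simp only [zero_add, hlaw0, smul_eq_mul]
  set I := ∫ x, s x ^ 2 ∂L with hI
  set q : ℝ → ℝ := fun θ => ∫ x, (√(d θ x) - 1 - θ / 2 * s x) ^ 2 ∂L with hqdef
  -- The right-hand side will dominate the error of the difference quotient; `q θ / θ ^ 2` tends to
  -- zero by differentiability in quadratic mean.
  have hbound : Tendsto (fun θ : ℝ => B * (|θ| / 2 * I + 2 * |θ| * (q θ / θ ^ 2) +
      2 * √(q θ / θ ^ 2))) (𝓝[≠] 0) (𝓝 0) := by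
    have h1 : Tendsto (fun θ : ℝ => |θ|) (𝓝[≠] 0) (𝓝 0) := by
      have : Tendsto (fun θ : ℝ => |θ|) (𝓝 0) (𝓝 |0|) := continuous_abs.tendsto 0
      rw [abs_zero] at this
      exact this.mono_left nhdsWithin_le_nhds
    have h2 : Tendsto (fun θ : ℝ => √(q θ / θ ^ 2)) (𝓝[≠] 0) (𝓝 0) := by
      have := (Real.continuous_sqrt.tendsto 0).comp hq
      rwa [Real.sqrt_zero] at this
    have h3 := ((((h1.div_const 2).mul_const I).add ((h1.const_mul 2).mul hq)).add
      (h2.const_mul 2)).const_mul B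
    simpa using h3
  rw [tendsto_iff_norm_sub_tendsto_zero]
  refine tendsto_of_tendsto_of_tendsto_of_le_of_le' tendsto_const_nhds hbound
    (Eventually.of_forall fun _ => norm_nonneg _) ?_
  filter_upwards [hd.filter_mono nhdsWithin_le_nhds, self_mem_nhdsWithin] with θ hθ hne
  have hne' : θ ≠ 0 := hne
  have hfi : Integrable f L := Integrable.of_bound hfm.aestronglyMeasurable B hfB
  have hdint : Integrable (d θ) L := by
    refine ⟨(hdm θ).aestronglyMeasurable, ?_⟩
    rw [hasFiniteIntegral_iff_ofReal (ae_of_all _ (hd0 θ))]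
    have h1 : (L.withDensity fun x => ENNReal.ofReal (d θ x)) Set.univ = 1 := by
      rw [← hθ]
      exact (hlaw θ).measure_univ
    rw [withDensity_apply _ MeasurableSet.univ, Measure.restrict_univ] at h1
    rw [h1]
    exact ENNReal.one_lt_top
  have hfd : ∫ x, f x ∂(law θ) = ∫ x, d θ x * f x ∂L := by
    rw [hθ, integral_withDensity_eq_integral_toReal_smul (hdm θ).ennreal_ofReal
      (ae_of_all _ fun _ => ENNReal.ofReal_lt_top)]
    refine integral_congr_ae (ae_of_all _ fun x => ?_)
    simp only [ENNReal.toReal_ofReal (hd0 θ x), smul_eq_mul]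
  set r : 𝒳 → ℝ := fun x => √(d θ x) - 1 - θ / 2 * s x with hr
  have hsqrt : MemLp (fun x => √(d θ x)) 2 L := by
    rw [memLp_two_iff_integrable_sq (hdm θ).sqrt.aestronglyMeasurable]
    simpa only [Real.sq_sqrt (hd0 θ _)] using hdint
  have hrL : MemLp r 2 L := (hsqrt.sub (memLp_const 1)).sub (hs.const_mul _)
  have hr2 : Integrable (fun x => r x ^ 2) L := hrL.integrable_sq
  have hr1 : Integrable (fun x => |r x|) L := (hrL.integrable one_le_two).abs
  have hs2 : Integrable (fun x => s x ^ 2) L := hs.integrable_sq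
  have hs1 : Integrable s L := hs.integrable one_le_two
  have hfsi : Integrable (fun x => f x * s x) L := hs1.bdd_mul hfm.aestronglyMeasurable hfB
  have hfdi : Integrable (fun x => d θ x * f x) L := hdint.mul_bdd hfm.aestronglyMeasurable hfB
  have hdiff : θ⁻¹ * (∫ x, f x ∂(law θ) - ∫ x, f x ∂L) - ∫ x, f x * s x ∂L =
      θ⁻¹ * ∫ x, f x * (d θ x - 1 - θ * s x) ∂L := by
    have e : ∀ x, f x * (d θ x - 1 - θ * s x) = d θ x * f x - f x - θ * (f x * s x) :=
      fun x => by ring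
    simp only [e]
    have hA : Integrable (fun x => d θ x * f x - f x) L := hfdi.sub hfi
    rw [integral_sub hA (hfsi.const_mul θ), integral_sub hfdi hfi, integral_const_mul,
      hfd]
    field_simp
  rw [hdiff, norm_mul, norm_inv, Real.norm_eq_abs, Real.norm_eq_abs]
  have hpt : ∀ᵐ x ∂L, ‖f x * (d θ x - 1 - θ * s x)‖ ≤
      B * (θ ^ 2 / 2 * s x ^ 2 + 2 * r x ^ 2 + 2 * |r x|) := by
    filter_upwards [hfB] with x hx
    rw [norm_mul, Real.norm_eq_abs, Real.norm_eq_abs]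
    refine mul_le_mul hx ?_ (abs_nonneg _) hB0
    -- With `√d = 1 + u` and `u = θ/2 s + r`, one has `d = 1 + 2u + u²`, and `2u` contributes
    -- exactly `θ s + 2r`.
    have h1 : d θ x - 1 - θ * s x = (θ / 2 * s x + r x) ^ 2 + 2 * r x := by
      have h2 : d θ x = √(d θ x) ^ 2 := (Real.sq_sqrt (hd0 θ x)).symm
      rw [h2]
      simp only [hr]
      ring
    rw [h1]
    refine (abs_add_le _ _).trans ?_
    rw [abs_of_nonneg (sq_nonneg _), abs_mul, abs_two]
    nlinarith [sq_nonneg (θ / 2 * s x - r x)]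
  have hint : |∫ x, f x * (d θ x - 1 - θ * s x) ∂L| ≤
      B * (θ ^ 2 / 2 * I + 2 * q θ + 2 * ∫ x, |r x| ∂L) := by
    have h1 := norm_integral_le_of_norm_le ((((hs2.const_mul (θ ^ 2 / 2)).add
      (hr2.const_mul 2)).add (hr1.const_mul 2)).const_mul B) hpt
    refine h1.trans (le_of_eq ?_)
    rw [integral_const_mul, integral_add' ((hs2.const_mul (θ ^ 2 / 2)).add
      (hr2.const_mul 2)) (hr1.const_mul 2), integral_add' (hs2.const_mul (θ ^ 2 / 2))
      (hr2.const_mul 2), integral_const_mul, integral_const_mul, integral_const_mul]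
  -- The first-order remainder is controlled by the root of `q θ`, which is `o(|θ|)` and so survives
  -- division by `θ`.
  have habs : ∫ x, |r x| ∂L ≤ √(q θ) := by
    refine Real.le_sqrt_of_sq_le ?_
    refine (sq_integral_le_integral_sq hrL.abs).trans (le_of_eq ?_)
    simp only [sq_abs, hqdef, hr, Pi.abs_apply]
  have hθ0 : 0 < |θ| := abs_pos.2 hne'
  rw [inv_mul_le_iff₀ hθ0]
  refine hint.trans ?_
  have e1 : √(q θ / θ ^ 2) = √(q θ) / |θ| := by
    rw [Real.sqrt_div' _ (sq_nonneg _), Real.sqrt_sq_eq_abs]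
  rw [e1, mul_left_comm]
  refine mul_le_mul_of_nonneg_left ?_ hB0
  have e2 : |θ| * (|θ| / 2 * I + 2 * |θ| * (q θ / θ ^ 2) + 2 * (√(q θ) / |θ|)) =
      θ ^ 2 / 2 * I + 2 * q θ + 2 * √(q θ) := by
    have h1 : θ ^ 2 = |θ| ^ 2 := (sq_abs θ).symm
    rw [h1]
    field_simp
  rw [e2]
  linarith

end MeanSquare

/-! ### The pathwise derivative of the value -/

namespace MarkovGame

variable {S A₁ A₂ : Type*} [Fintype S] [Fintype A₁] [Fintype A₂] {T : ℕ}
    [MeasurableSpace S] [MeasurableSpace A₁] [MeasurableSpace A₂]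

open scoped Classical in
/-- The indicator function of a state-action pair. -/
noncomputable def pairIndicator (s : S) (a : A₁) (b : A₂) (s' : S) (a' : A₁) (b' : A₂) : ℝ :=
  if s' = s ∧ a' = a ∧ b' = b then 1 else 0

theorem sum_pairIndicator_mul (f : S → A₁ → A₂ → ℝ) (s : S) (a : A₁) (b : A₂) :
    ∑ s', ∑ a', ∑ b', f s' a' b' * pairIndicator s a b s' a' b' = f s a b := by
  classical
  rw [Finset.sum_eq_single s, Finset.sum_eq_single a, Finset.sum_eq_single b]
  · simp [pairIndicator]
  · intro b' _ hb
    simp [pairIndicator, hb]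
  · simp
  · intro a' _ ha
    refine Finset.sum_eq_zero fun b' _ => ?_
    simp [pairIndicator, ha]
  · simp
  · intro s' _ hs
    refine Finset.sum_eq_zero fun a' _ => Finset.sum_eq_zero fun b' _ => ?_
    simp [pairIndicator, hs]
  · simp

theorem sum_mul_pairIndicator (f : S → A₁ → A₂ → ℝ) (s : S) (a : A₁) (b : A₂) :
    ∑ s', ∑ a', ∑ b', f s' a' b' * pairIndicator s' a' b' s a b = f s a b := by
  have e : ∀ s' a' b', pairIndicator s' a' b' s a b = pairIndicator s a b s' a' b' :=
    fun s' a' b' => by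
      simp only [pairIndicator]
      congr 1
      simp only [eq_comm]
  simp only [e, sum_pairIndicator_mul]

theorem abs_pairIndicator_le (s : S) (a : A₁) (b : A₂) (s' : S) (a' : A₁) (b' : A₂) :
    |pairIndicator s a b s' a' b'| ≤ 1 := by
  unfold pairIndicator
  split_ifs <;> simp

theorem trans_le_one (G : MarkovGame S A₁ A₂ T) (t : Fin T) (s : S) (a : A₁) (b : A₂) (s' : S) :
    G.trans t s a b s' ≤ 1 := by
  rw [← G.trans_sum t s a b]
  exact Finset.single_le_sum (f := fun s' => G.trans t s a b s')
    (fun _ _ => G.trans_nonneg _ _ _ _ _) (Finset.mem_univ s')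

variable [MeasurableSingletonClass S] [MeasurableSingletonClass A₁] [MeasurableSingletonClass A₂]

/-- Marginals and transitions appear here as expectations of bounded functions, so their continuity
along a submodel can be read off from the laws. -/
theorem integral_step_pairIndicator_mul (G : MarkovGame S A₁ A₂ T) (π : PolicyProfile S A₁ A₂ T)
    (t : Fin T) (s : S) (a : A₁) (b : A₂) (g : S → ℝ) :
    ∫ τ, τ.step t (fun s₁ a₁ b₁ _ s' => pairIndicator s a b s₁ a₁ b₁ * g s') ∂(G.trajLaw π) =
      G.marginal π t s a b * ∑ s', G.trans t s a b s' * g s' := by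
  have h := G.integral_step_of_bounded π t
    (fun s₁ a₁ b₁ _ s' => pairIndicator s a b s₁ a₁ b₁ * g s')
    (fun _ _ _ _ => measurable_const) (B := 1 * ∑ s', |g s'|) (fun s₁ a₁ b₁ _ s' => by
      rw [abs_mul]
      exact mul_le_mul (abs_pairIndicator_le _ _ _ _ _ _)
        (Finset.single_le_sum (f := fun s => |g s|) (fun _ _ => abs_nonneg _) (Finset.mem_univ s'))
        (abs_nonneg _) zero_le_one)
  rw [h, ← sum_pairIndicator_mul
    (fun s a b => G.marginal π t s a b * ∑ s', G.trans t s a b s' * g s')]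
  refine Finset.sum_congr rfl fun s₁ _ => Finset.sum_congr rfl fun a₁ _ =>
    Finset.sum_congr rfl fun b₁ _ => ?_
  rw [mul_assoc, stepMean]
  congr 1
  rw [Finset.sum_mul]
  refine Finset.sum_congr rfl fun s' _ => ?_
  rw [integral_const, probReal_univ, one_smul]
  ring

theorem RewardBounded.ae_abs_rew_le {G : MarkovGame S A₁ A₂ T} {πb : PolicyProfile S A₁ A₂ T}
    {R : ℝ} (h : G.RewardBounded πb R) : ∀ᵐ τ ∂(G.trajLaw πb), ∀ t, |τ.rew t| ≤ R := by
  rw [ae_all_iff]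
  intro t
  filter_upwards [G.ae_of_ae_reward πb t (fun _ _ _ r => |r| ≤ R) (h t)] with τ hτ using hτ.2

/-- Almost surely only pairs of positive mass are visited; absolute continuity transfers this to the
perturbed law. -/
theorem marginal_eq_zero_of_absolutelyContinuous {G H : MarkovGame S A₁ A₂ T}
    {πb πh : PolicyProfile S A₁ A₂ T} (hac : H.trajLaw πh ≪ G.trajLaw πb) {t : Fin T} {s : S}
    {a : A₁} {b : A₂} (h0 : G.marginal πb t s a b = 0) : H.marginal πh t s a b = 0 := by
  have h1 := G.ae_of_ae_reward πb t (fun _ _ _ _ => True) (fun _ _ _ _ => ae_of_all _ fun _ => trivial)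
  have h2 := H.integral_step_pairIndicator_mul πh t s a b (fun _ => 1)
  simp only [mul_one, H.trans_sum] at h2
  rw [← h2]
  refine integral_eq_zero_of_ae ?_
  filter_upwards [hac.ae_le h1] with τ hτ
  simp only [Trajectory.step, pairIndicator, Pi.zero_apply]
  rw [if_neg]
  rintro ⟨e1, e2, e3⟩
  exact hτ.1 (by rw [e1, e2, e3, h0])

/-- The value of the target profile in a perturbed game `H`, through the temporal differences at the
true values of `G`. -/
theorem value_eq_sum_marginalRatio_mul {G H : MarkovGame S A₁ A₂ T}
    {πh π : PolicyProfile S A₁ A₂ T} {R : ℝ} (hR : H.RewardBounded πh R) (hc : H.Covers πh π)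
    (γ : ℝ) : H.value γ π = ∫ τ, G.stateValue γ π 0 τ.initState ∂(H.trajLaw πh) +
      ∑ t : Fin T, γ ^ (t : ℕ) * ∑ s, ∑ a, ∑ b, H.marginalRatio πh π t s a b *
        ∫ τ, τ.step t (G.trueTd γ π t (pairIndicator s a b)) ∂(H.trajLaw πh) := by
  -- The telescoping identity of `H` is applied to the state-action values of `G`; the values of `G`
  -- cancel and the mean rewards of `H` remain.
  rw [(hR.of_covers hc).value_eq γ, integral_initState, stateValue_eq_averageValue,
    ← H.sum_marginal_mul_sub γ π (G.qValue γ π), ← Finset.sum_add_distrib]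
  refine Finset.sum_congr rfl fun t _ => ?_
  rw [← mul_add]
  congr 1
  simp only [← Finset.sum_add_distrib]
  refine Finset.sum_congr rfl fun s _ => Finset.sum_congr rfl fun a _ =>
    Finset.sum_congr rfl fun b _ => ?_
  have h1 : ∫ τ, τ.step t (G.trueTd γ π t (pairIndicator s a b)) ∂(H.trajLaw πh) =
      H.marginal πh t s a b * (H.meanReward t s a b + γ * ∑ s', H.trans t s a b s' *
        G.stateValue γ π t.succ s' - G.qValue γ π t s a b) := by
    obtain ⟨B, hB⟩ := hR.exists_stepBounded_tdStep γ t (pairIndicator s a b) (G.qValue γ π t)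
      (G.stateValue γ π t.succ)
    rw [trueTd, hB.integral_eq, ← sum_pairIndicator_mul (fun s a b => H.marginal πh t s a b *
      (H.meanReward t s a b + γ * ∑ s', H.trans t s a b s' *
        G.stateValue γ π t.succ s' - G.qValue γ π t s a b))]
    refine Finset.sum_congr rfl fun s₁ _ => Finset.sum_congr rfl fun a₁ _ =>
      Finset.sum_congr rfl fun b₁ _ => ?_
    by_cases hm : H.marginal πh t s₁ a₁ b₁ = 0
    · rw [hm, zero_mul, zero_mul, zero_mul]
    · rw [H.stepMean_tdStep γ t _ _ _ (hR.integrable hm)]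
      ring
  rw [h1, ← stateValue_eq_averageValue, ← mul_assoc, mul_comm (H.marginalRatio πh π t s a b),
    hc.marginal_mul_marginalRatio]
  ring

section Family

variable {G : MarkovGame S A₁ A₂ T} {πb π : PolicyProfile S A₁ A₂ T}
  {game : ℝ → MarkovGame S A₁ A₂ T} {behavior : ℝ → PolicyProfile S A₁ A₂ T}
  {score : Trajectory S A₁ A₂ T → ℝ}

/-- The expectations of bounded functions are differentiable at the truth, with the derivatives that
belong to the score. -/
def HasScore (G : MarkovGame S A₁ A₂ T) (πb : PolicyProfile S A₁ A₂ T)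
    (game : ℝ → MarkovGame S A₁ A₂ T) (behavior : ℝ → PolicyProfile S A₁ A₂ T)
    (score : Trajectory S A₁ A₂ T → ℝ) : Prop :=
  ∀ f : Trajectory S A₁ A₂ T → ℝ, Measurable f → ∀ B : ℝ, (∀ᵐ τ ∂(G.trajLaw πb), |f τ| ≤ B) →
    HasDerivAt (fun θ => ∫ τ, f τ ∂((game θ).trajLaw (behavior θ)))
      (∫ τ, f τ * score τ ∂(G.trajLaw πb)) 0

theorem HasScore.continuousAt_marginal_mul (hd : HasScore G πb game behavior score) (t : Fin T)
    (s : S) (a : A₁) (b : A₂) (g : S → ℝ) :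
    ContinuousAt (fun θ => (game θ).marginal (behavior θ) t s a b *
      ∑ s', (game θ).trans t s a b s' * g s') 0 := by
  have h := (hd (fun τ => τ.step t (fun s₁ a₁ b₁ _ s' => pairIndicator s a b s₁ a₁ b₁ * g s'))
    (Trajectory.measurable_step
      (F := fun s₁ a₁ b₁ _ s' => pairIndicator s a b s₁ a₁ b₁ * g s')
      (fun _ _ _ _ => measurable_const) t) (1 * ∑ s', |g s'|)
    (ae_of_all _ fun τ => by
      simp only [Trajectory.step]
      rw [abs_mul]
      exact mul_le_mul (abs_pairIndicator_le _ _ _ _ _ _)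
        (Finset.single_le_sum (f := fun s => |g s|) (fun _ _ => abs_nonneg _) (Finset.mem_univ _))
        (abs_nonneg _) zero_le_one)).continuousAt
  simpa only [integral_step_pairIndicator_mul] using h

theorem HasScore.continuousAt_marginal (hd : HasScore G πb game behavior score) (t : Fin T)
    (s : S) (a : A₁) (b : A₂) :
    ContinuousAt (fun θ => (game θ).marginal (behavior θ) t s a b) 0 := by
  simpa only [mul_one, trans_sum] using hd.continuousAt_marginal_mul t s a b fun _ => 1

/-- A transition probability is a quotient of two expectations with nonzero denominator. At pairs of
mass zero the law does not identify the transitions, and they may jump. -/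
theorem HasScore.continuousAt_trans (hd : HasScore G πb game behavior score) (h0 : game 0 = G)
    (h0' : behavior 0 = πb) {t : Fin T} {s : S} {a : A₁} {b : A₂}
    (hm : G.marginal πb t s a b ≠ 0) (s' : S) :
    ContinuousAt (fun θ => (game θ).trans t s a b s') 0 := by
  classical
  have h1 := hd.continuousAt_marginal_mul t s a b fun x => if x = s' then 1 else 0
  have h2 := hd.continuousAt_marginal t s a b
  have hm' : (game 0).marginal (behavior 0) t s a b ≠ 0 := by rwa [h0, h0']
  refine (h1.div h2 hm').congr ?_
  filter_upwards [h2.eventually_ne hm'] with θ hθ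
  simp [hθ]

/-- By induction on the step. Where transitions may jump, covering makes the target marginal tend to
zero; as transition probabilities are at most 1, their product is squeezed to zero. -/
theorem HasScore.continuousAt_stateMarginal (hd : HasScore G πb game behavior score)
    (h0 : game 0 = G) (h0' : behavior 0 = πb) (hc : G.Covers πb π) (t : Fin (T + 1)) (s : S) :
    ContinuousAt (fun θ => (game θ).stateMarginal π t s) 0 := by
  induction t using Fin.induction generalizing s with
  | zero =>
    classical
    have h := (hd (fun τ => if τ.initState = s then 1 else 0)
      (Trajectory.measurable_of_measurable_rew fun x _ _ =>
        (measurable_const : Measurable fun _ : Fin T → ℝ => if x 0 = s then (1 : ℝ) else 0)) 1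
      (ae_of_all _ fun τ => by split_ifs <;> simp)).continuousAt
    have e : ∀ θ, ∫ τ, (if Trajectory.initState τ = s then (1 : ℝ) else 0)
        ∂((game θ).trajLaw (behavior θ)) = (game θ).init s := fun θ => by
      rw [(game θ).integral_initState (behavior θ) (fun x => if x = s then 1 else 0)]
      simp
    simpa only [e, stateMarginal_zero] using h
  | succ t ih =>
    simp only [stateMarginal_succ]
    refine tendsto_finsetSum _ fun s₁ _ => tendsto_finsetSum _ fun a _ =>
      tendsto_finsetSum _ fun b _ => ?_
    have hπ : ContinuousAt (fun θ => (game θ).marginal π t s₁ a b) 0 := by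
      simp only [marginal]
      exact continuousAt_const.mul (ih s₁)
    by_cases hm : G.marginal πb t s₁ a b = 0
    · have hz : (game 0).marginal π t s₁ a b = 0 := by rw [h0]; exact hc t s₁ a b hm
      rw [hz, mul_zero]
      have hπ' : Tendsto (fun θ => (game θ).marginal π t s₁ a b) (𝓝 0) (𝓝 0) := by
        have := hπ.tendsto
        rwa [hz] at this
      refine squeeze_zero (fun θ => mul_nonneg ((game θ).trans_nonneg _ _ _ _ _)
        ((game θ).marginal_nonneg _ _ _ _ _)) (fun θ => ?_) hπ'
      exact mul_le_of_le_one_left ((game θ).marginal_nonneg _ _ _ _ _)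
        ((game θ).trans_le_one _ _ _ _ _)
    · exact (hd.continuousAt_trans h0 h0' hm s).mul hπ

/-- Close to the truth, pairs of positive mass keep it, by continuity and finiteness. By domination
no new states are reached. So an action pair that the perturbed behavior omits at a visited state is
omitted by the true behavior, where overlap applies. -/
theorem HasScore.eventually_covers (hd : HasScore G πb game behavior score)
    (h0 : game 0 = G) (h0' : behavior 0 = πb)
    (hac : ∀ᶠ θ in 𝓝 0, (game θ).trajLaw (behavior θ) ≪ G.trajLaw πb)
    (hprob : ∀ t s a b, 0 < G.stateMarginal πb t.castSucc s → πb.prob t s a b = 0 →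
      π.prob t s a b = 0) : ∀ᶠ θ in 𝓝 0, (game θ).Covers (behavior θ) π := by
  have hne : ∀ᶠ θ in 𝓝 (0 : ℝ), ∀ t s a b, G.marginal πb t s a b ≠ 0 →
      (game θ).marginal (behavior θ) t s a b ≠ 0 := by
    simp only [eventually_all]
    intro t s a b hm
    exact (hd.continuousAt_marginal t s a b).eventually_ne (by rwa [h0, h0'])
  filter_upwards [hac, hne] with θ hθ hθ'
  refine (game θ).covers_of_prob fun t s a b hs hb => ?_
  have hs0 : G.stateMarginal πb t.castSucc s ≠ 0 := by
    intro hz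
    refine hs.ne' ?_
    rw [← sum_marginal]
    refine Finset.sum_eq_zero fun a _ => Finset.sum_eq_zero fun b _ => ?_
    exact marginal_eq_zero_of_absolutelyContinuous hθ (by rw [marginal, hz, mul_zero])
  refine hprob t s a b (lt_of_le_of_ne (G.stateMarginal_nonneg _ _ _) hs0.symm) ?_
  by_contra hcon
  exact hθ' t s a b (mul_ne_zero hcon hs0) (by rw [marginal, hb, zero_mul])

/-- Along a family with a score, the derivative of the value of the target profile is the inner
product of the score with the doubly robust summand at the true nuisance functions. -/
theorem HasScore.hasDerivAt_value (hd : HasScore G πb game behavior score)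
    (h0 : game 0 = G) (h0' : behavior 0 = πb) (hs : Integrable score (G.trajLaw πb))
    (hac : ∀ᶠ θ in 𝓝 0, (game θ).trajLaw (behavior θ) ≪ G.trajLaw πb)
    (hprob : ∀ t s a b, 0 < G.stateMarginal πb t.castSucc s → πb.prob t s a b = 0 →
      π.prob t s a b = 0) {R : ℝ} (hR : G.RewardBounded πb R) (γ : ℝ) :
    HasDerivAt (fun θ => (game θ).value γ π)
      (∫ τ, drlSummand γ π (G.qValue γ π) (G.marginalRatio πb π) τ * score τ ∂(G.trajLaw πb))
      0 := by
  have hc := G.covers_of_prob hprob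
  have hRθ : ∀ᶠ θ in 𝓝 0, (game θ).RewardBounded (behavior θ) R := by
    filter_upwards [hac] with θ hθ using rewardBounded_of_ae (hθ.ae_le hR.ae_abs_rew_le)
  have hval : (fun θ => (game θ).value γ π) =ᶠ[𝓝 0] fun θ =>
      ∫ τ, G.stateValue γ π 0 τ.initState ∂((game θ).trajLaw (behavior θ)) +
      ∑ t : Fin T, γ ^ (t : ℕ) * ∑ s, ∑ a, ∑ b, (game θ).marginalRatio (behavior θ) π t s a b *
        ∫ τ, τ.step t (G.trueTd γ π t (pairIndicator s a b))
          ∂((game θ).trajLaw (behavior θ)) := by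
    filter_upwards [hRθ, hd.eventually_covers h0 h0' hac hprob] with θ h1 h2
    exact value_eq_sum_marginalRatio_mul h1 h2 γ
  refine HasDerivAt.congr_of_eventuallyEq ?_ hval
  have htdm : ∀ t c, Measurable fun τ : Trajectory S A₁ A₂ T => τ.step t (G.trueTd γ π t c) := by
    intro t c
    obtain ⟨B, hB⟩ := hR.exists_stepBounded_trueTd γ π t c
    exact Trajectory.measurable_step hB.measurable t
  have hterm : ∀ t s a b, HasDerivAt (fun θ => (game θ).marginalRatio (behavior θ) π t s a b *
      ∫ τ, τ.step t (G.trueTd γ π t (pairIndicator s a b)) ∂((game θ).trajLaw (behavior θ)))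
      (G.marginalRatio πb π t s a b *
        ∫ τ, τ.step t (G.trueTd γ π t (pairIndicator s a b)) * score τ ∂(G.trajLaw πb)) 0 := by
    intro t s a b
    -- At a pair of mass zero the perturbed denominators vanish too, by domination, so the ratios
    -- are 0 near the truth. Elsewhere the ratio is continuous and the mean temporal difference
    -- vanishes at 0.
    by_cases hm : G.marginal πb t s a b = 0
    · have hz : G.marginalRatio πb π t s a b = 0 := by rw [marginalRatio, hm, div_zero]
      rw [hz, zero_mul]
      refine (hasDerivAt_const (0 : ℝ) (0 : ℝ)).congr_of_eventuallyEq ?_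
      filter_upwards [hac] with θ hθ
      rw [marginalRatio, marginal_eq_zero_of_absolutelyContinuous hθ hm, div_zero, zero_mul]
    · have hcont : ContinuousAt (fun θ => (game θ).marginalRatio (behavior θ) π t s a b) 0 := by
        simp only [marginalRatio]
        refine ContinuousAt.div ?_ (hd.continuousAt_marginal t s a b) (by rwa [h0, h0'])
        simp only [marginal]
        exact continuousAt_const.mul (hd.continuousAt_stateMarginal h0 h0' hc t.castSucc s)
      obtain ⟨B, hB⟩ := hR.exists_stepBounded_trueTd γ π t (pairIndicator s a b)
      have h1 := hasDerivAt_mul_of_continuousAt hcont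
        (hd _ (htdm t (pairIndicator s a b)) B hB.ae_bound)
        (by rw [h0, h0']; exact hR.integral_trueTd γ π t _)
      rwa [h0, h0'] at h1
  have hinit : HasDerivAt
      (fun θ => ∫ τ, G.stateValue γ π 0 τ.initState ∂((game θ).trajLaw (behavior θ)))
      (∫ τ, G.stateValue γ π 0 τ.initState * score τ ∂(G.trajLaw πb)) 0 :=
    hd _ (Trajectory.measurable_of_measurable_rew fun s _ _ =>
        (measurable_const : Measurable fun _ : Fin T → ℝ => G.stateValue γ π 0 (s 0)))
      (∑ s, |G.stateValue γ π 0 s|) (ae_of_all _ fun τ =>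
        Finset.single_le_sum (f := fun s => |G.stateValue γ π 0 s|) (fun _ _ => abs_nonneg _)
          (Finset.mem_univ τ.initState))
  have hsum := hinit.add (HasDerivAt.fun_sum (u := Finset.univ) fun t _ =>
    (HasDerivAt.fun_sum (u := Finset.univ) fun s _ => HasDerivAt.fun_sum (u := Finset.univ)
      fun a _ => HasDerivAt.fun_sum (u := Finset.univ) fun b _ => hterm t s a b).const_mul
        (γ ^ (t : ℕ)))
  refine hsum.congr_deriv ?_
  have hint : ∀ t c, Integrable (fun τ : Trajectory S A₁ A₂ T =>
      τ.step t (G.trueTd γ π t c) * score τ) (G.trajLaw πb) := fun t c => by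
    obtain ⟨B, hB⟩ := hR.exists_stepBounded_trueTd γ π t c
    exact hs.bdd_mul hB.aestronglyMeasurable hB.ae_bound
  have hint0 : Integrable (fun τ : Trajectory S A₁ A₂ T =>
      G.stateValue γ π 0 τ.initState * score τ) (G.trajLaw πb) :=
    hs.bdd_mul (G.memLp_initState πb (G.stateValue γ π 0) 1).aestronglyMeasurable
      (ae_of_all _ fun τ => Finset.single_le_sum (f := fun s => |G.stateValue γ π 0 s|)
        (fun _ _ => abs_nonneg _) (Finset.mem_univ τ.initState))
  -- The pair indicators served to pull the parameter-dependent ratio out of the integral; at the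
  -- truth they are summed again into one weighted temporal difference.
  have hstep : ∀ t : Fin T, ∑ s, ∑ a, ∑ b, G.marginalRatio πb π t s a b *
      ∫ τ, τ.step t (G.trueTd γ π t (pairIndicator s a b)) * score τ ∂(G.trajLaw πb) =
      ∫ τ, τ.step t (G.trueTd γ π t (G.marginalRatio πb π t)) * score τ ∂(G.trajLaw πb) := by
    intro t
    simp only [← integral_const_mul]
    have hi := fun s a b => (hint t (pairIndicator s a b)).const_mul (G.marginalRatio πb π t s a b)
    simp only [← integral_finsetSum _ fun b _ => hi _ _ b]
    simp only [← integral_finsetSum _ fun a _ => integrable_finsetSum _ fun b _ => hi _ a b]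
    rw [← integral_finsetSum _ fun s _ => integrable_finsetSum _ fun a _ =>
      integrable_finsetSum _ fun b _ => hi s a b]
    refine integral_congr_ae (ae_of_all _ fun τ => ?_)
    simp only [Trajectory.step, trueTd, tdStep, ← mul_assoc, ← Finset.sum_mul,
      sum_mul_pairIndicator]
  simp only [hstep, drlSummand_eq, add_mul, Finset.sum_mul, ← stateValue_eq_averageValue]
  rw [integral_add hint0 (integrable_finsetSum _ fun t _ => ?_), integral_finsetSum _ fun t _ => ?_]
  · congr 1
    refine Finset.sum_congr rfl fun t _ => ?_
    rw [← integral_const_mul]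
    refine integral_congr_ae (ae_of_all _ fun τ => ?_)
    simp only [trueTd, mul_assoc]
  all_goals
    simp only [mul_assoc]
    exact (hint t (G.marginalRatio πb π t)).const_mul _

end Family

/-! ### The upper bound on the Cramér–Rao quotients -/

section Submodel

variable {G : MarkovGame S A₁ A₂ T} {γ : ℝ} {πb π : PolicyProfile S A₁ A₂ T}

theorem RegularSubmodel.hasScore (M : RegularSubmodel G γ πb π) :
    HasScore G πb M.game M.behavior M.score := fun _ hf _ hB =>
  hasDerivAt_integral_of_quadratic_mean (fun _ => inferInstance)
    (by rw [M.game_zero, M.behavior_zero]) M.density_nonneg M.density_measurable M.law_eq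
    M.score_memLp M.quadratic_mean hf hB

/-- Differentiate the total mass, which is constantly 1. -/
theorem RegularSubmodel.integral_score (M : RegularSubmodel G γ πb π) :
    ∫ τ, M.score τ ∂(G.trajLaw πb) = 0 := by
  have h := M.hasScore (fun _ => 1) measurable_const 1 (ae_of_all _ fun _ => by simp)
  simp only [integral_const, probReal_univ, one_smul, one_mul] at h
  exact h.unique (hasDerivAt_const _ _)

theorem RegularSubmodel.valueDeriv_eq (M : RegularSubmodel G γ πb π)
    (hprob : ∀ t s a b, 0 < G.stateMarginal πb t.castSucc s → πb.prob t s a b = 0 →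
      π.prob t s a b = 0) {R : ℝ} (hR : G.RewardBounded πb R) :
    M.valueDeriv = ∫ τ, drlSummand γ π (G.qValue γ π) (G.marginalRatio πb π) τ * M.score τ
      ∂(G.trajLaw πb) := by
  refine M.hasDerivAt_value.unique (M.hasScore.hasDerivAt_value M.game_zero M.behavior_zero
    (M.score_memLp.integrable one_le_two) ?_ hprob hR γ)
  filter_upwards [M.law_eq] with θ hθ
  rw [hθ]
  exact withDensity_absolutelyContinuous _ _

/-- As the score is centered, ψ may be centered too, and Cauchy–Schwarz applies. Vanishing
information needs no separate case: a product bound in `[0, ∞]` always implies the quotient bound.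
-/
theorem RegularSubmodel.cramerRao_le (M : RegularSubmodel G γ πb π)
    (hprob : ∀ t s a b, 0 < G.stateMarginal πb t.castSucc s → πb.prob t s a b = 0 →
      π.prob t s a b = 0) {R : ℝ} (hR : G.RewardBounded πb R) :
    M.cramerRao ≤ ENNReal.ofReal (G.upsilonEB γ πb π) := by
  set ψ := drlSummand γ π (G.qValue γ π) (G.marginalRatio πb π) with hψ
  have hψL : MemLp ψ 2 (G.trajLaw πb) := hR.memLp_drlSummand γ π _ _ 2
  set v := ∫ τ, ψ τ ∂(G.trajLaw πb) with hv
  have hψc : MemLp (fun τ => ψ τ - v) 2 (G.trajLaw πb) := hψL.sub (memLp_const v)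
  have h1 : M.valueDeriv = ∫ τ, (ψ τ - v) * M.score τ ∂(G.trajLaw πb) := by
    have hi : Integrable (fun τ => ψ τ * M.score τ) (G.trajLaw πb) :=
      hψL.integrable_mul M.score_memLp
    rw [M.valueDeriv_eq hprob hR]
    simp only [sub_mul]
    rw [integral_sub hi
      ((M.score_memLp.integrable one_le_two).const_mul v), integral_const_mul, M.integral_score,
      mul_zero, sub_zero]
  have h2 : ∫ τ, (ψ τ - v) ^ 2 ∂(G.trajLaw πb) = G.upsilonEB γ πb π := by
    rw [← hR.variance_drlSummand γ π, variance_eq_integral hψL.aemeasurable]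
  have h3 := sq_integral_mul_le hψc M.score_memLp
  rw [← h1, h2] at h3
  have h4 : 0 ≤ G.upsilonEB γ πb π := by
    rw [← h2]
    exact integral_nonneg fun _ => sq_nonneg _
  unfold cramerRao
  refine ENNReal.div_le_of_le_mul ?_
  rw [← ENNReal.ofReal_mul h4]
  exact ENNReal.ofReal_le_ofReal h3

end Submodel

end MarkovGame

/-! ### Product densities and their uniform tangents -/

/-- A product measure is determined by its values on boxes, where the indicator and the density both
factorize. -/
theorem MeasureTheory.Measure.pi_withDensity_ofReal {ι : Type*} [Fintype ι] {μ : ι → Measure ℝ}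
    [∀ i, IsProbabilityMeasure (μ i)] {a : ι → ℝ → ℝ} (ha0 : ∀ i x, 0 ≤ a i x)
    (hai : ∀ i, Integrable (a i) (μ i)) :
    Measure.pi (fun i => (μ i).withDensity fun x => ENNReal.ofReal (a i x)) =
      (Measure.pi μ).withDensity fun x => ENNReal.ofReal (∏ i, a i (x i)) := by
  have hfin : ∀ i, IsFiniteMeasure ((μ i).withDensity fun x => ENNReal.ofReal (a i x)) := fun i =>
    isFiniteMeasure_withDensity_ofReal (hai i).2
  refine Measure.pi_eq fun s hs => ?_
  have hE : MeasurableSet (Set.univ.pi s) := MeasurableSet.univ_pi hs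
  have hprod : Integrable (fun x : ι → ℝ => ∏ i, a i (x i)) (Measure.pi μ) :=
    Integrable.fintype_prod hai
  rw [withDensity_apply _ hE, ← ofReal_integral_eq_lintegral_ofReal hprod.integrableOn
    (ae_of_all _ fun x => Finset.prod_nonneg fun i _ => ha0 i _), ← integral_indicator hE]
  have e : ∀ x : ι → ℝ, (Set.univ.pi s).indicator (fun x => ∏ i, a i (x i)) x =
      ∏ i, (s i).indicator (a i) (x i) := by
    intro x
    by_cases hx : x ∈ Set.univ.pi s
    · rw [Set.indicator_of_mem hx]
      exact Finset.prod_congr rfl fun i _ => (Set.indicator_of_mem (hx i (Set.mem_univ i)) _).symm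
    · rw [Set.indicator_of_notMem hx]
      simp only [Set.mem_pi, Set.mem_univ, true_imp_iff, not_forall] at hx
      obtain ⟨i, hi⟩ := hx
      exact (Finset.prod_eq_zero (Finset.mem_univ i) (Set.indicator_of_notMem hi _)).symm
  simp only [e]
  rw [integral_fintype_prod_eq_prod (fun i => (s i).indicator (a i)),
    ENNReal.ofReal_prod_of_nonneg fun i _ => integral_nonneg fun x =>
      Set.indicator_nonneg (fun x _ => ha0 i x) x]
  refine Finset.prod_congr rfl fun i _ => ?_
  rw [integral_indicator (hs i), withDensity_apply _ (hs i),
    ofReal_integral_eq_lintegral_ofReal (hai i).integrableOn (ae_of_all _ (ha0 i))]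

/-- The functions `p θ` are `1 + θ x + O(θ²)`, uniformly. -/
def UniformTangent {𝒳 : Type*} (p : ℝ → 𝒳 → ℝ) (x : 𝒳 → ℝ) : Prop :=
  ∃ C, 0 ≤ C ∧ ∀ θ, |θ| ≤ 1 → ∀ τ, |x τ| ≤ C ∧ |p θ τ - 1 - θ * x τ| ≤ C * θ ^ 2

namespace UniformTangent

variable {𝒳 : Type*} {p q : ℝ → 𝒳 → ℝ} {x y : 𝒳 → ℝ}

theorem one_add_mul {K : ℝ} (hx : ∀ τ, |x τ| ≤ K) : UniformTangent (fun θ τ => 1 + θ * x τ) x := by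
  refine ⟨|K|, abs_nonneg _, fun θ _ τ => ⟨(hx τ).trans (le_abs_self K), ?_⟩⟩
  have e : 1 + θ * x τ - 1 - θ * x τ = 0 := by ring
  rw [e, abs_zero]
  positivity

theorem one : UniformTangent (fun _ _ => 1 : ℝ → 𝒳 → ℝ) (fun _ => 0) :=
  ⟨0, le_rfl, fun θ _ τ => by simp⟩

theorem abs_sub_one_le {C : ℝ} {θ : ℝ} (hθ : |θ| ≤ 1) {d z : ℝ}
    (hz : |z| ≤ C) (h : |d - 1 - θ * z| ≤ C * θ ^ 2) : |d - 1| ≤ 2 * C * |θ| := by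
  have hC : 0 ≤ C := (abs_nonneg _).trans hz
  have e : d - 1 = (d - 1 - θ * z) + θ * z := by ring
  rw [e]
  refine (abs_add_le _ _).trans ?_
  rw [abs_mul]
  have h1 : θ ^ 2 ≤ |θ| := by
    rw [← sq_abs]
    nlinarith [abs_nonneg θ]
  nlinarith [mul_le_mul_of_nonneg_left hz (abs_nonneg θ), mul_le_mul_of_nonneg_left h1 hC]

theorem mul (hp : UniformTangent p x) (hq : UniformTangent q y) :
    UniformTangent (fun θ τ => p θ τ * q θ τ) (fun τ => x τ + y τ) := by
  obtain ⟨C, hC, hp⟩ := hp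
  obtain ⟨D, hD, hq⟩ := hq
  refine ⟨C * (1 + 2 * D) + (1 + C) * D + C * D, by positivity, fun θ hθ τ => ?_⟩
  obtain ⟨hx, hp⟩ := hp θ hθ τ
  obtain ⟨hy, hq⟩ := hq θ hθ τ
  constructor
  · refine (abs_add_le _ _).trans ?_
    nlinarith [mul_nonneg hC hD]
  · have e : p θ τ * q θ τ - 1 - θ * (x τ + y τ) = (p θ τ - 1 - θ * x τ) * q θ τ +
        (1 + θ * x τ) * (q θ τ - 1 - θ * y τ) + x τ * y τ * θ ^ 2 := by ring
    have h1 : |q θ τ| ≤ 1 + 2 * D := by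
      have h2 := abs_sub_one_le hθ hy hq
      have h3 : |q θ τ| ≤ |q θ τ - 1| + |1| := by
        simpa using abs_add_le (q θ τ - 1) 1
      rw [abs_one] at h3
      nlinarith
    have h2 : |1 + θ * x τ| ≤ 1 + C := by
      refine (abs_add_le _ _).trans ?_
      rw [abs_one, abs_mul]
      nlinarith [abs_nonneg θ, abs_nonneg (x τ)]
    rw [e]
    refine (abs_add_le _ _).trans ?_
    refine (add_le_add_left (abs_add_le _ _) _).trans ?_
    rw [abs_mul, abs_mul, abs_mul, abs_mul, abs_of_nonneg (sq_nonneg θ)]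
    have h3 := mul_le_mul hp h1 (abs_nonneg _) (by positivity)
    have h4 := mul_le_mul h2 hq (abs_nonneg _) (by positivity)
    have h5 := mul_le_mul_of_nonneg_right (mul_le_mul hx hy (abs_nonneg _) hC) (sq_nonneg θ)
    linarith

theorem prod {ι : Type*} (s : Finset ι) {p : ι → ℝ → 𝒳 → ℝ} {x : ι → 𝒳 → ℝ}
    (h : ∀ i ∈ s, UniformTangent (p i) (x i)) :
    UniformTangent (fun θ τ => ∏ i ∈ s, p i θ τ) (fun τ => ∑ i ∈ s, x i τ) := by
  classical
  induction s using Finset.induction_on with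
  | empty => simpa using one
  | insert i s hi ih =>
    simp only [Finset.prod_insert hi, Finset.sum_insert hi]
    exact (h i (Finset.mem_insert_self i s)).mul
      (ih fun j hj => h j (Finset.mem_insert_of_mem hj))

/-- The left side is half of `(√d - 1)²`, while `(d - 1)²` is that square times `(√d + 1)²`, which
is at least 1. -/
theorem abs_sqrt_sub_le {d : ℝ} (hd : 0 ≤ d) : |√d - 1 - (d - 1) / 2| ≤ (d - 1) ^ 2 / 2 := by
  have h1 : d = √d ^ 2 := (Real.sq_sqrt hd).symm
  have h2 := Real.sqrt_nonneg d
  have e : √d - 1 - (d - 1) / 2 = -((√d - 1) ^ 2 / 2) := by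
    nth_rewrite 2 [h1]
    ring
  have e2 : (d - 1) ^ 2 = (√d - 1) ^ 2 * (√d + 1) ^ 2 := by
    nth_rewrite 1 [h1]
    ring
  rw [e, abs_neg, abs_of_nonneg (by positivity), e2]
  have h3 : 1 ≤ (√d + 1) ^ 2 := by nlinarith
  nlinarith [mul_le_mul_of_nonneg_left h3 (sq_nonneg (√d - 1))]

theorem exists_abs_sqrt_sub_le (h : UniformTangent p x) :
    ∃ C, ∀ θ, |θ| ≤ 1 → ∀ τ, 0 ≤ p θ τ → |√(p θ τ) - 1 - θ / 2 * x τ| ≤ C * θ ^ 2 := by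
  obtain ⟨C, hC, h⟩ := h
  refine ⟨2 * C ^ 2 + C / 2, fun θ hθ τ h0 => ?_⟩
  obtain ⟨hx, h⟩ := h θ hθ τ
  have e : √(p θ τ) - 1 - θ / 2 * x τ = (√(p θ τ) - 1 - (p θ τ - 1) / 2) +
      (p θ τ - 1 - θ * x τ) / 2 := by ring
  have h1 := abs_sub_one_le hθ hx h
  have h2 : (p θ τ - 1) ^ 2 ≤ 4 * C ^ 2 * θ ^ 2 := by
    rw [← sq_abs, ← sq_abs θ]
    nlinarith [abs_nonneg (p θ τ - 1)]
  rw [e]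
  refine (abs_add_le _ _).trans ?_
  rw [abs_div, abs_two]
  have h3 := abs_sqrt_sub_le h0
  linarith

/-- The squared remainder is `O(θ⁴)` uniformly. Only small parameters matter, so `d` may differ from
`p` where `p` fails to be a density. -/
theorem tendsto_quadratic_mean [MeasurableSpace 𝒳] {L : Measure 𝒳} [IsProbabilityMeasure L]
    (h : UniformTangent p x) {d : ℝ → 𝒳 → ℝ} (hd0 : ∀ θ τ, 0 ≤ d θ τ)
    (hdp : ∀ᶠ θ in 𝓝 0, d θ = p θ) :
    Tendsto (fun θ : ℝ => (∫ τ, (√(d θ τ) - 1 - θ / 2 * x τ) ^ 2 ∂L) / θ ^ 2) (𝓝[≠] 0) (𝓝 0) := by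
  obtain ⟨C, hC⟩ := h.exists_abs_sqrt_sub_le
  have hlim : Tendsto (fun θ : ℝ => C ^ 2 * θ ^ 2) (𝓝[≠] 0) (𝓝 0) := by
    have : Tendsto (fun θ : ℝ => C ^ 2 * θ ^ 2) (𝓝 0) (𝓝 (C ^ 2 * 0 ^ 2)) :=
      (by fun_prop : Continuous fun θ : ℝ => C ^ 2 * θ ^ 2).tendsto 0
    simp only [ne_eq, OfNat.ofNat_ne_zero, not_false_eq_true, zero_pow, mul_zero] at this
    exact this.mono_left nhdsWithin_le_nhds
  have h1 : ∀ᶠ θ in 𝓝 (0 : ℝ), |θ| ≤ 1 := by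
    have : Tendsto (fun θ : ℝ => |θ|) (𝓝 0) (𝓝 |0|) := continuous_abs.tendsto 0
    rw [abs_zero] at this
    exact this.eventually_le_const zero_lt_one
  refine squeeze_zero' (Eventually.of_forall fun θ => div_nonneg
    (integral_nonneg fun _ => sq_nonneg _) (sq_nonneg _)) ?_ hlim
  filter_upwards [hdp.filter_mono nhdsWithin_le_nhds, h1.filter_mono nhdsWithin_le_nhds,
    self_mem_nhdsWithin] with θ hθ hθ1 hne
  have hne' : θ ≠ 0 := hne
  rw [div_le_iff₀ (by positivity)]
  have h2 : ∀ τ, ‖(√(d θ τ) - 1 - θ / 2 * x τ) ^ 2‖ ≤ (C * θ ^ 2) ^ 2 := fun τ => by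
    rw [Real.norm_eq_abs, abs_pow, hθ]
    exact pow_le_pow_left₀ (abs_nonneg _) (hC θ hθ1 τ (by rw [← hθ]; exact hd0 θ τ)) 2
  have h3 := norm_integral_le_of_norm_le_const (μ := L) (ae_of_all _ h2)
  rw [probReal_univ, mul_one] at h3
  refine (le_abs_self _).trans (h3.trans (le_of_eq ?_))
  ring

end UniformTangent

/-! ### Tilted games -/

namespace MarkovGame

variable {S A₁ A₂ : Type*} [Fintype S] [Fintype A₁] [Fintype A₂] {T : ℕ}

/-- Densities that turn a game into another one. -/
structure Tilt (G : MarkovGame S A₁ A₂ T) where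
  init : S → ℝ
  init_nonneg : ∀ s, 0 ≤ init s
  init_sum : ∑ s, G.init s * init s = 1
  trans : Fin T → S → A₁ → A₂ → S → ℝ
  trans_nonneg : ∀ t s a b s', 0 ≤ trans t s a b s'
  trans_sum : ∀ t s a b, ∑ s', G.trans t s a b s' * trans t s a b s' = 1
  reward : Fin T → S → A₁ → A₂ → ℝ → ℝ
  reward_measurable : ∀ t s a b, Measurable (reward t s a b)
  reward_nonneg : ∀ t s a b r, 0 ≤ reward t s a b r
  integral_reward : ∀ t s a b, ∫ r, reward t s a b r ∂(G.reward t s a b) = 1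

theorem Tilt.integrable_reward {G : MarkovGame S A₁ A₂ T} (D : G.Tilt) (t : Fin T) (s : S) (a : A₁)
    (b : A₂) : Integrable (D.reward t s a b) (G.reward t s a b) :=
  integrable_of_integral_eq_one (D.integral_reward t s a b)

/-- The game with the densities `D` relative to `G`. -/
noncomputable def tilted (G : MarkovGame S A₁ A₂ T) (D : G.Tilt) : MarkovGame S A₁ A₂ T where
  init s := G.init s * D.init s
  init_nonneg s := mul_nonneg (G.init_nonneg s) (D.init_nonneg s)
  init_sum := D.init_sum
  trans t s a b s' := G.trans t s a b s' * D.trans t s a b s'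
  trans_nonneg t s a b s' := mul_nonneg (G.trans_nonneg t s a b s') (D.trans_nonneg t s a b s')
  trans_sum := D.trans_sum
  reward t s a b := (G.reward t s a b).withDensity fun r => ENNReal.ofReal (D.reward t s a b r)
  reward_prob t s a b := by
    refine ⟨?_⟩
    rw [withDensity_apply _ MeasurableSet.univ, Measure.restrict_univ,
      ← ofReal_integral_eq_lintegral_ofReal (D.integrable_reward t s a b)
        (ae_of_all _ (D.reward_nonneg t s a b)), D.integral_reward, ENNReal.ofReal_one]

/-- The density of the law of a trajectory. -/
noncomputable def Tilt.density {G : MarkovGame S A₁ A₂ T} (D : G.Tilt)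
    (τ : Trajectory S A₁ A₂ T) : ℝ :=
  D.init τ.initState * ∏ t, τ.step t fun s a b r s' => D.trans t s a b s' * D.reward t s a b r

theorem Tilt.density_nonneg {G : MarkovGame S A₁ A₂ T} (D : G.Tilt) (τ : Trajectory S A₁ A₂ T) :
    0 ≤ D.density τ :=
  mul_nonneg (D.init_nonneg _) <| Finset.prod_nonneg fun _ _ =>
    mul_nonneg (D.trans_nonneg _ _ _ _ _) (D.reward_nonneg _ _ _ _ _)

variable [MeasurableSpace S] [MeasurableSpace A₁] [MeasurableSpace A₂]

theorem lintegral_trajLaw (G : MarkovGame S A₁ A₂ T) (π : PolicyProfile S A₁ A₂ T)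
    {f : Trajectory S A₁ A₂ T → ENNReal} (hf : Measurable f) :
    ∫⁻ τ, f τ ∂(G.trajLaw π) = ∑ s : Fin (T + 1) → S, ∑ a : Fin T → A₁, ∑ b : Fin T → A₂,
      ENNReal.ofReal (G.pathWeight π s a b) *
        ∫⁻ r, f (s, a, b, r)
          ∂(Measure.pi fun t : Fin T => G.reward t (s t.castSucc) (a t) (b t)) := by
  classical
  rw [trajLaw_eq]
  simp only [lintegral_finsetSum_measure, lintegral_smul_measure, smul_eq_mul]
  refine Finset.sum_congr rfl fun s _ => Finset.sum_congr rfl fun a _ =>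
    Finset.sum_congr rfl fun b _ => ?_
  rw [lintegral_map hf (measurable_mk s a b)]

variable [MeasurableSingletonClass S] [MeasurableSingletonClass A₁] [MeasurableSingletonClass A₂]

theorem Tilt.measurable_density {G : MarkovGame S A₁ A₂ T} (D : G.Tilt) : Measurable D.density := by
  unfold density
  refine Measurable.mul ?_ (Finset.measurable_prod _ fun t _ => Trajectory.measurable_step
    (F := fun s a b r s' => D.trans t s a b s' * D.reward t s a b r)
    (fun s a b s' => (D.reward_measurable t s a b).const_mul _) t)
  exact Trajectory.measurable_of_measurable_rew fun s _ _ =>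
    (measurable_const : Measurable fun _ : Fin T → ℝ => D.init (s 0))

/-- For fixed states and actions the density splits: its discrete factor changes the path weight,
and its reward factors change the product measure of the rewards. The profile is not tilted. -/
theorem trajLaw_tilted (G : MarkovGame S A₁ A₂ T) (D : G.Tilt) (π : PolicyProfile S A₁ A₂ T) :
    (G.tilted D).trajLaw π = (G.trajLaw π).withDensity fun τ => ENNReal.ofReal (D.density τ) := by
  ext E hE
  have hdm : Measurable fun τ => ENNReal.ofReal (D.density τ) := D.measurable_density.ennreal_ofReal
  have hEm : Measurable (E.indicator fun _ : Trajectory S A₁ A₂ T => (1 : ENNReal)) :=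
    measurable_const.indicator hE
  have hfm : Measurable fun τ : Trajectory S A₁ A₂ T =>
      ENNReal.ofReal (D.density τ) * E.indicator (fun _ => 1) τ := hdm.mul hEm
  have e : ∫⁻ τ in E, ENNReal.ofReal (D.density τ) ∂(G.trajLaw π) =
      ∫⁻ τ, ENNReal.ofReal (D.density τ) * E.indicator (fun _ => 1) τ ∂(G.trajLaw π) := by
    rw [← lintegral_indicator hE]
    refine lintegral_congr fun τ => ?_
    by_cases hτ : τ ∈ E <;> simp [hτ]
  rw [withDensity_apply _ hE, e, ← lintegral_indicator_one hE]
  change ∫⁻ τ, E.indicator (fun _ => 1) τ ∂_ = _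
  rw [lintegral_trajLaw _ _ hEm, lintegral_trajLaw _ _ hfm]
  refine Finset.sum_congr rfl fun s _ => Finset.sum_congr rfl fun a _ =>
    Finset.sum_congr rfl fun b _ => ?_
  have hpi := Measure.pi_withDensity_ofReal
    (μ := fun t : Fin T => G.reward t (s t.castSucc) (a t) (b t))
    (a := fun t => D.reward t (s t.castSucc) (a t) (b t)) (fun t => D.reward_nonneg t _ _ _)
    (fun t => D.integrable_reward t _ _ _)
  have hrm : Measurable fun r : Fin T → ℝ =>
      ENNReal.ofReal (∏ t, D.reward t (s t.castSucc) (a t) (b t) (r t)) :=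
    (Finset.measurable_prod _ fun t _ =>
      (D.reward_measurable t _ _ _).comp (measurable_pi_apply t)).ennreal_ofReal
  have hw : (G.tilted D).pathWeight π s a b = G.pathWeight π s a b * (D.init (s 0) *
      ∏ t, D.trans t (s t.castSucc) (a t) (b t) (s t.succ)) := by
    simp only [pathWeight, tilted, Finset.prod_mul_distrib]
    ring
  have hc0 : 0 ≤ D.init (s 0) * ∏ t, D.trans t (s t.castSucc) (a t) (b t) (s t.succ) :=
    mul_nonneg (D.init_nonneg _) (Finset.prod_nonneg fun t _ => D.trans_nonneg _ _ _ _ _)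
  have hdens : ∀ r : Fin T → ℝ, ENNReal.ofReal (D.density (s, a, b, r)) =
      ENNReal.ofReal (D.init (s 0) * ∏ t, D.trans t (s t.castSucc) (a t) (b t) (s t.succ)) *
      ENNReal.ofReal (∏ t, D.reward t (s t.castSucc) (a t) (b t) (r t)) := fun r => by
    rw [← ENNReal.ofReal_mul hc0]
    simp only [Tilt.density, Trajectory.step, Trajectory.initState, Trajectory.state,
      Trajectory.act₁, Trajectory.act₂, Trajectory.rew, Trajectory.nextState,
      Finset.prod_mul_distrib, mul_assoc]
  have hpi' : (Measure.pi fun t : Fin T => (G.tilted D).reward t (s t.castSucc) (a t) (b t)) =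
      (Measure.pi fun t : Fin T => G.reward t (s t.castSucc) (a t) (b t)).withDensity fun r =>
        ENNReal.ofReal (∏ t, D.reward t (s t.castSucc) (a t) (b t) (r t)) := hpi
  rw [hpi', hw, ENNReal.ofReal_mul (G.pathWeight_nonneg π s a b), mul_assoc]
  congr 1
  have hEr : Measurable fun r : Fin T → ℝ =>
      E.indicator (fun _ => (1 : ENNReal)) (s, a, b, r) := hEm.comp (measurable_mk s a b)
  rw [lintegral_withDensity_eq_lintegral_mul _ hrm hEr, ← lintegral_const_mul _ (hrm.mul hEr)]
  refine lintegral_congr fun r => ?_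
  simp only [hdens, Pi.mul_apply, mul_assoc]

end MarkovGame

/-! ### Linear submodels and attainment of the bound -/

theorem single_le_sum_abs {ι : Type*} [Fintype ι] (f : ι → ℝ) (i : ι) : |f i| ≤ ∑ j, |f j| :=
  Finset.single_le_sum (f := fun j => |f j|) (fun _ _ => abs_nonneg _) (Finset.mem_univ i)

namespace MarkovGame

variable {S A₁ A₂ : Type*} [Fintype S] [Fintype A₁] [Fintype A₂] {T : ℕ}

/-- Bounded scores of the initial distribution, the transitions and the rewards. -/
structure Direction (G : MarkovGame S A₁ A₂ T) where
  bound : ℝ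
  bound_pos : 0 < bound
  init : S → ℝ
  abs_init_le : ∀ s, |init s| ≤ bound
  init_mean : ∑ s, G.init s * init s = 0
  trans : Fin T → S → A₁ → A₂ → S → ℝ
  abs_trans_le : ∀ t s a b s', |trans t s a b s'| ≤ bound
  trans_mean : ∀ t s a b, ∑ s', G.trans t s a b s' * trans t s a b s' = 0
  reward : Fin T → S → A₁ → A₂ → ℝ → ℝ
  abs_reward_le : ∀ t s a b r, |reward t s a b r| ≤ bound
  reward_measurable : ∀ t s a b, Measurable (reward t s a b)
  reward_mean : ∀ t s a b, ∫ r, reward t s a b r ∂(G.reward t s a b) = 0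

namespace Direction

variable {G : MarkovGame S A₁ A₂ T} (X : G.Direction)

theorem one_add_mul_nonneg {θ : ℝ} (hθ : |θ| * X.bound ≤ 1) {x : ℝ} (hx : |x| ≤ X.bound) :
    0 ≤ 1 + θ * x := by
  have h1 : |θ * x| ≤ 1 := by
    rw [abs_mul]
    exact (mul_le_mul_of_nonneg_left hx (abs_nonneg _)).trans hθ
  linarith [(abs_le.1 h1).1]

/-- The linear path of densities in a direction. -/
noncomputable def tilt (θ : ℝ) (hθ : |θ| * X.bound ≤ 1) : G.Tilt where
  init s := 1 + θ * X.init s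
  init_nonneg s := X.one_add_mul_nonneg hθ (X.abs_init_le s)
  init_sum := by
    simp only [mul_add, mul_one, Finset.sum_add_distrib, G.init_sum, mul_left_comm _ θ,
      ← Finset.mul_sum, X.init_mean, mul_zero, add_zero]
  trans t s a b s' := 1 + θ * X.trans t s a b s'
  trans_nonneg t s a b s' := X.one_add_mul_nonneg hθ (X.abs_trans_le t s a b s')
  trans_sum t s a b := by
    simp only [mul_add, mul_one, Finset.sum_add_distrib, G.trans_sum, mul_left_comm _ θ,
      ← Finset.mul_sum, X.trans_mean, mul_zero, add_zero]
  reward t s a b r := 1 + θ * X.reward t s a b r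
  reward_measurable t s a b := ((X.reward_measurable t s a b).const_mul θ).const_add 1
  reward_nonneg t s a b r := X.one_add_mul_nonneg hθ (X.abs_reward_le t s a b r)
  integral_reward t s a b := by
    have hi : Integrable (X.reward t s a b) (G.reward t s a b) :=
      Integrable.of_bound (X.reward_measurable t s a b).aestronglyMeasurable X.bound
        (ae_of_all _ (X.abs_reward_le t s a b))
    rw [integral_add (integrable_const _) (hi.const_mul θ), integral_const_mul, X.reward_mean,
      mul_zero, add_zero, integral_const, probReal_univ, one_smul]

/-- The score of the law of a trajectory. -/
noncomputable def score (τ : Trajectory S A₁ A₂ T) : ℝ :=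
  X.init τ.initState + ∑ t, τ.step t fun s a b r s' => X.trans t s a b s' + X.reward t s a b r

/-- The linear path of densities of a trajectory, for all real parameters. -/
noncomputable def path (θ : ℝ) (τ : Trajectory S A₁ A₂ T) : ℝ :=
  (1 + θ * X.init τ.initState) * ∏ t, τ.step t fun s a b r s' =>
    (1 + θ * X.trans t s a b s') * (1 + θ * X.reward t s a b r)

/-- The density is a finite product of factors `1 + θ x`, so to first order the scores of the
components add up. -/
theorem uniformTangent : UniformTangent X.path X.score := by
  refine UniformTangent.mul
    (UniformTangent.one_add_mul (x := fun τ : Trajectory S A₁ A₂ T => X.init τ.initState)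
      fun τ => X.abs_init_le _) (UniformTangent.prod
        (p := fun t θ (τ : Trajectory S A₁ A₂ T) => τ.step t fun s a b r s' =>
          (1 + θ * X.trans t s a b s') * (1 + θ * X.reward t s a b r))
        (x := fun t (τ : Trajectory S A₁ A₂ T) => τ.step t fun s a b r s' =>
          X.trans t s a b s' + X.reward t s a b r) Finset.univ fun t _ => ?_)
  exact UniformTangent.mul
    (UniformTangent.one_add_mul (x := fun τ : Trajectory S A₁ A₂ T =>
      X.trans t (τ.state t) (τ.act₁ t) (τ.act₂ t) (τ.nextState t))
      fun τ => X.abs_trans_le t _ _ _ _)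
    (UniformTangent.one_add_mul (x := fun τ : Trajectory S A₁ A₂ T =>
      X.reward t (τ.state t) (τ.act₁ t) (τ.act₂ t) (τ.rew t)) fun τ => X.abs_reward_le t _ _ _ _)

/-- The parameter, truncated to the range in which the linear path consists of densities. -/
noncomputable def clip (θ : ℝ) : ℝ := max (-X.bound⁻¹) (min X.bound⁻¹ θ)

theorem abs_clip_mul_le (θ : ℝ) : |X.clip θ| * X.bound ≤ 1 := by
  have h0 : 0 < X.bound⁻¹ := inv_pos.2 X.bound_pos
  have h1 : |X.clip θ| ≤ X.bound⁻¹ :=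
    abs_le.2 ⟨le_max_left _ _, max_le (by linarith) (min_le_left _ _)⟩
  calc |X.clip θ| * X.bound ≤ X.bound⁻¹ * X.bound :=
        mul_le_mul_of_nonneg_right h1 X.bound_pos.le
    _ = 1 := inv_mul_cancel₀ X.bound_pos.ne'

theorem eventually_clip_eq : ∀ᶠ θ in 𝓝 0, X.clip θ = θ := by
  have h0 : 0 < X.bound⁻¹ := inv_pos.2 X.bound_pos
  filter_upwards [Ioo_mem_nhds (neg_lt_zero.2 h0) h0] with θ hθ
  rw [clip, min_eq_right hθ.2.le, max_eq_right hθ.1.le]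

theorem clip_zero : X.clip 0 = 0 := X.eventually_clip_eq.self_of_nhds

/-- The games along the linear path of densities. -/
noncomputable def game (θ : ℝ) : MarkovGame S A₁ A₂ T :=
  G.tilted (X.tilt (X.clip θ) (X.abs_clip_mul_le θ))

theorem game_zero : X.game 0 = G := by
  cases G
  simp only [game, tilted, tilt, X.clip_zero, zero_mul, add_zero, mul_one, ENNReal.ofReal_one,
    withDensity_const, one_smul]

variable [MeasurableSpace S] [MeasurableSpace A₁] [MeasurableSpace A₂]
  [MeasurableSingletonClass S] [MeasurableSingletonClass A₁] [MeasurableSingletonClass A₂]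

theorem measurable_score : Measurable X.score := by
  unfold score
  refine Measurable.add ?_ (Finset.measurable_sum _ fun t _ => Trajectory.measurable_step
    (F := fun s a b r s' => X.trans t s a b s' + X.reward t s a b r)
    (fun s a b s' => (X.reward_measurable t s a b).const_add _) t)
  exact Trajectory.measurable_of_measurable_rew fun s _ _ =>
    (measurable_const : Measurable fun _ : Fin T → ℝ => X.init (s 0))

theorem memLp_score (πb : PolicyProfile S A₁ A₂ T) : MemLp X.score 2 (G.trajLaw πb) := by
  obtain ⟨C, -, hC⟩ := X.uniformTangent
  exact MemLp.of_bound X.measurable_score.aestronglyMeasurable C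
    (ae_of_all _ fun τ => (hC 0 (by simp) τ).1)

/-- The regular submodel along the linear path of densities in a direction. -/
noncomputable def submodel (γ : ℝ) {πb π : PolicyProfile S A₁ A₂ T}
    (hprob : ∀ t s a b, 0 < G.stateMarginal πb t.castSucc s → πb.prob t s a b = 0 →
      π.prob t s a b = 0) {R : ℝ} (hR : G.RewardBounded πb R) : RegularSubmodel G γ πb π :=
  have hlaw : ∀ θ, (X.game θ).trajLaw πb = (G.trajLaw πb).withDensity fun τ =>
      ENNReal.ofReal ((X.tilt (X.clip θ) (X.abs_clip_mul_le θ)).density τ) := fun θ =>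
    G.trajLaw_tilted _ πb
  have hq : Tendsto (fun θ : ℝ => (∫ τ, (√((X.tilt (X.clip θ) (X.abs_clip_mul_le θ)).density τ) -
      1 - θ / 2 * X.score τ) ^ 2 ∂(G.trajLaw πb)) / θ ^ 2) (𝓝[≠] 0) (𝓝 0) := by
    refine X.uniformTangent.tendsto_quadratic_mean (fun θ => Tilt.density_nonneg _) ?_
    filter_upwards [X.eventually_clip_eq] with θ hθ
    funext τ
    simp only [Tilt.density, tilt, hθ, path]
  { game := X.game
    behavior := fun _ => πb
    game_zero := X.game_zero
    behavior_zero := rfl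
    density := fun θ => (X.tilt (X.clip θ) (X.abs_clip_mul_le θ)).density
    density_nonneg := fun θ => Tilt.density_nonneg _
    density_measurable := fun θ => Tilt.measurable_density _
    law_eq := Eventually.of_forall hlaw
    score := X.score
    score_memLp := X.memLp_score πb
    quadratic_mean := hq
    valueDeriv := ∫ τ, drlSummand γ π (G.qValue γ π) (G.marginalRatio πb π) τ * X.score τ
      ∂(G.trajLaw πb)
    -- The required differentiability of the value comes for free from differentiability in
    -- quadratic mean.
    hasDerivAt_value := by
      have hd : HasScore G πb X.game (fun _ => πb) X.score := fun _ hf _ hB =>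
        hasDerivAt_integral_of_quadratic_mean (fun _ => inferInstance) (by rw [X.game_zero])
          (fun θ => Tilt.density_nonneg _) (fun θ => Tilt.measurable_density _)
          (Eventually.of_forall hlaw) (X.memLp_score πb) hq hf hB
      refine hd.hasDerivAt_value X.game_zero rfl ((X.memLp_score πb).integrable one_le_two)
        (Eventually.of_forall fun θ => ?_) hprob hR γ
      rw [hlaw θ]
      exact withDensity_absolutelyContinuous _ _ }

end Direction

/-- The direction of the efficient influence function. The rewards are truncated at `R`. -/
noncomputable def efficientDirection [MeasurableSpace S] [MeasurableSpace A₁] [MeasurableSpace A₂]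
    (G : MarkovGame S A₁ A₂ T) (γ : ℝ) {πb : PolicyProfile S A₁ A₂ T}
    (π : PolicyProfile S A₁ A₂ T) {R : ℝ} (hR : G.RewardBounded πb R) : G.Direction :=
  -- The centered influence function is split along the factors of the likelihood: `x` for the
  -- initial state, `y` for the transitions, and the reward minus its mean, weighted by `w`. Each
  -- part has mean zero under its own factor; `z` only bounds the reward part.
  let x : S → ℝ := fun s => G.stateValue γ π 0 s - ∑ s', G.init s' * G.stateValue γ π 0 s'
  let w : Fin T → S → A₁ → A₂ → ℝ := fun t s a b =>
    γ ^ (t : ℕ) * G.marginalRatio πb π t s a b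
  let y : Fin T → S → A₁ → A₂ → S → ℝ := fun t s a b s' => w t s a b *
    (γ * (G.stateValue γ π t.succ s' - ∑ s₁, G.trans t s a b s₁ * G.stateValue γ π t.succ s₁))
  let z : Fin T → S → A₁ → A₂ → ℝ := fun t s a b => w t s a b * (|R| + |G.meanReward t s a b|)
  -- A sum of all absolute values dominates every part; the 1 makes it positive.
  { bound := 1 + ∑ s, |x s| + ∑ i : Fin T × S × A₁ × A₂ × S, |y i.1 i.2.1 i.2.2.1 i.2.2.2.1 i.2.2.2.2|
      + ∑ i : Fin T × S × A₁ × A₂, |z i.1 i.2.1 i.2.2.1 i.2.2.2|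
    bound_pos := by positivity
    init := x
    abs_init_le := fun s => by
      have h := single_le_sum_abs x s
      have h1 : 0 ≤ ∑ i : Fin T × S × A₁ × A₂ × S,
        |y i.1 i.2.1 i.2.2.1 i.2.2.2.1 i.2.2.2.2| := by positivity
      have h2 : 0 ≤ ∑ i : Fin T × S × A₁ × A₂, |z i.1 i.2.1 i.2.2.1 i.2.2.2| := by positivity
      linarith
    init_mean := by
      simp only [x, mul_sub, Finset.sum_sub_distrib, ← Finset.sum_mul, G.init_sum, one_mul, sub_self]
    trans := y
    abs_trans_le := fun t s a b s' => by
      have h := single_le_sum_abs (fun i : Fin T × S × A₁ × A₂ × S =>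
        y i.1 i.2.1 i.2.2.1 i.2.2.2.1 i.2.2.2.2) (t, s, a, b, s')
      have h1 : 0 ≤ ∑ s, |x s| := by positivity
      have h2 : 0 ≤ ∑ i : Fin T × S × A₁ × A₂, |z i.1 i.2.1 i.2.2.1 i.2.2.2| := by positivity
      simp only at h
      linarith
    trans_mean := fun t s a b => by
      have e : ∀ s', G.trans t s a b s' * y t s a b s' = w t s a b * γ *
          (G.trans t s a b s' * G.stateValue γ π t.succ s' - G.trans t s a b s' *
            ∑ s₁, G.trans t s a b s₁ * G.stateValue γ π t.succ s₁) := fun s' => by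
        simp only [y]
        ring
      simp only [e, ← Finset.mul_sum, Finset.sum_sub_distrib, ← Finset.sum_mul, G.trans_sum,
        one_mul, sub_self, mul_zero]
    reward := fun t s a b r => w t s a b * (max (-|R|) (min |R| r) - G.meanReward t s a b)
    abs_reward_le := fun t s a b r => by
      have h := single_le_sum_abs (fun i : Fin T × S × A₁ × A₂ =>
        z i.1 i.2.1 i.2.2.1 i.2.2.2) (t, s, a, b)
      have h1 : 0 ≤ ∑ s, |x s| := by positivity
      have h2 : 0 ≤ ∑ i : Fin T × S × A₁ × A₂ × S,
        |y i.1 i.2.1 i.2.2.1 i.2.2.2.1 i.2.2.2.2| := by positivity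
      have h3 : |w t s a b * (max (-|R|) (min |R| r) - G.meanReward t s a b)| ≤ |z t s a b| := by
        simp only [z, abs_mul]
        refine mul_le_mul_of_nonneg_left ?_ (abs_nonneg _)
        rw [abs_of_nonneg (add_nonneg (abs_nonneg R) (abs_nonneg (G.meanReward t s a b)))]
        refine (abs_sub _ _).trans (add_le_add (abs_le.2 ⟨le_max_left _ _, ?_⟩) le_rfl)
        exact max_le (by linarith [abs_nonneg R]) (min_le_left _ _)
      simp only at h
      linarith
    reward_measurable := fun t s a b => by fun_prop
    -- Off the support nothing is known about the rewards, but there the ratio, and with it the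
    -- score, is 0. On the support the truncation is almost surely inactive.
    reward_mean := fun t s a b => by
      by_cases hm : G.marginal πb t s a b = 0
      · have hw : w t s a b = 0 := by simp only [w, marginalRatio, hm, div_zero, mul_zero]
        simp only [hw, zero_mul, integral_zero]
      · rw [integral_const_mul]
        have h1 : ∫ r, (max (-|R|) (min |R| r) - G.meanReward t s a b) ∂(G.reward t s a b) =
            ∫ r, (r - G.meanReward t s a b) ∂(G.reward t s a b) := by
          refine integral_congr_ae ?_
          filter_upwards [hR t s a b hm] with r hr
          have h2 := abs_le.1 (hr.trans (le_abs_self R))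
          rw [min_eq_right h2.2, max_eq_right h2.1]
        rw [h1, integral_sub (hR.integrable hm) (integrable_const _), integral_const, probReal_univ,
          one_smul, meanReward, sub_self, mul_zero] }

section Attainment

variable [MeasurableSpace S] [MeasurableSpace A₁] [MeasurableSpace A₂]
  [MeasurableSingletonClass S] [MeasurableSingletonClass A₁] [MeasurableSingletonClass A₂]
  {G : MarkovGame S A₁ A₂ T} {πb π : PolicyProfile S A₁ A₂ T}

/-- The centerings of the reward and of the next value add up to the true `Q`, so each step
contributes its weighted temporal difference; truncation is inactive almost surely. -/
theorem efficientDirection_score (γ : ℝ) {R : ℝ} (hR : G.RewardBounded πb R) :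
    ∀ᵐ τ ∂(G.trajLaw πb), (G.efficientDirection γ π hR).score τ =
      drlSummand γ π (G.qValue γ π) (G.marginalRatio πb π) τ -
        ∑ s, G.init s * G.stateValue γ π 0 s := by
  filter_upwards [hR.ae_abs_rew_le] with τ hτ
  rw [drlSummand_eq, ← stateValue_eq_averageValue, Direction.score, add_sub_right_comm]
  congr 1
  refine Finset.sum_congr rfl fun t _ => ?_
  have h2 := abs_le.1 ((hτ t).trans (le_abs_self R))
  simp only [Trajectory.step, tdStep, efficientDirection]
  rw [min_eq_right h2.2, max_eq_right h2.1, qValue]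
  ring

/-- The efficiency bound is the variance of the efficient influence function. -/
theorem efficiencyBound_eq (γ : ℝ)
    (hprob : ∀ t s a b, 0 < G.stateMarginal πb t.castSucc s → πb.prob t s a b = 0 →
      π.prob t s a b = 0) {R : ℝ} (hR : G.RewardBounded πb R) :
    G.efficiencyBound γ πb π = ENNReal.ofReal (G.upsilonEB γ πb π) := by
  refine le_antisymm (iSup_le fun M => M.cramerRao_le hprob hR) ?_
  set M := (G.efficientDirection γ π hR).submodel γ hprob hR with hM
  refine le_trans ?_ (le_iSup (fun M : RegularSubmodel G γ πb π => M.cramerRao) M)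
  set ψ := drlSummand γ π (G.qValue γ π) (G.marginalRatio πb π) with hψ
  have hψL : MemLp ψ 2 (G.trajLaw πb) := hR.memLp_drlSummand γ π _ _ 2
  have hc := G.covers_of_prob hprob
  set v := ∑ s, G.init s * G.stateValue γ π 0 s with hv
  have hmean : ∫ τ, ψ τ ∂(G.trajLaw πb) = v := by
    rw [hψ, hR.integral_drlSummand_true hc, (hR.of_covers hc).value_eq_sum_init]
  have hscore : ∀ᵐ τ ∂(G.trajLaw πb), M.score τ = ψ τ - v := efficientDirection_score γ hR
  have hvar : ∫ τ, (ψ τ - v) ^ 2 ∂(G.trajLaw πb) = G.upsilonEB γ πb π := by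
    rw [← hR.variance_drlSummand γ π, variance_eq_integral hψL.aemeasurable, hmean]
  have hI : ∫ τ, M.score τ ^ 2 ∂(G.trajLaw πb) = G.upsilonEB γ πb π := by
    rw [← hvar]
    refine integral_congr_ae ?_
    filter_upwards [hscore] with τ hτ
    rw [hτ]
  -- Since the score is the centered ψ, its inner product with ψ is again the variance; derivative
  -- and information agree, and the quotient is `Υ² / Υ`.
  have hD : M.valueDeriv = G.upsilonEB γ πb π := by
    have hi : Integrable (fun τ => v * (ψ τ - v)) (G.trajLaw πb) :=
      ((hψL.integrable one_le_two).sub (integrable_const v)).const_mul v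
    have hi2 : Integrable (fun τ => (ψ τ - v) ^ 2) (G.trajLaw πb) :=
      (hψL.sub (memLp_const v)).integrable_sq
    rw [M.valueDeriv_eq hprob hR]
    calc ∫ τ, ψ τ * M.score τ ∂(G.trajLaw πb)
        = ∫ τ, ((ψ τ - v) ^ 2 + v * (ψ τ - v)) ∂(G.trajLaw πb) := by
          refine integral_congr_ae ?_
          filter_upwards [hscore] with τ hτ
          rw [hτ]
          ring
      _ = G.upsilonEB γ πb π := by
          rw [integral_add hi2 hi, hvar, integral_const_mul,
            integral_sub (hψL.integrable one_le_two) (integrable_const v), hmean, integral_const,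
            probReal_univ, one_smul, sub_self, mul_zero, add_zero]
  rw [RegularSubmodel.cramerRao, hI, hD]
  -- In the degenerate case the claimed lower bound is 0, so nothing has to be divided.
  rcases le_or_gt (G.upsilonEB γ πb π) 0 with h | h
  · rw [ENNReal.ofReal_of_nonpos h]
    exact zero_le
  · rw [← ENNReal.ofReal_div_of_pos h, sq, mul_div_assoc, div_self h.ne', mul_one]

end Attainment

end MarkovGame

/-! ### The theorem -/

theorem theorem3
    {S A₁ A₂ : Type*} [Fintype S] [Fintype A₁] [Fintype A₂]
    [MeasurableSpace S] [MeasurableSingletonClass S]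
    [MeasurableSpace A₁] [MeasurableSingletonClass A₁]
    [MeasurableSpace A₂] [MeasurableSingletonClass A₂]
    {T : ℕ} (G : MarkovGame S A₁ A₂ T)
    (γ : ℝ) (hγ₀ : 0 ≤ γ) (hγ₁ : γ ≤ 1)
    -- behavior profile and target profile
    (πb π : PolicyProfile S A₁ A₂ T)
    -- overlap and bounded rewards
    (C Rmax : ℝ)
    (hoverlap : ∀ t s a b, 0 < G.stateMarginal πb t.castSucc s →
      π.prob t s a b ≤ C * πb.prob t s a b)
    (hreward : ∀ᵐ τ ∂(G.trajLaw πb), ∀ t, |τ.rew t| ≤ Rmax)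
    -- independent trajectories generated by the behavior profile
    {Ω : Type*} [MeasurableSpace Ω] (P : Measure Ω) [IsProbabilityMeasure P]
    (X : ℕ → Ω → Trajectory S A₁ A₂ T)
    (hX : ∀ i, Measurable (X i))
    (hlaw : ∀ i, P.map (X i) = G.trajLaw πb)
    (hindep : iIndepFun X P)
    -- evenly-sized folds, chosen independently of the data
    {K : ℕ} (hK : 0 < K)
    (fold : (n : ℕ) → Ω → Fin n → Fin K)
    (hfold : ∀ n, Measurable (fold n))
    (hfold_indep : ∀ n, IndepFun (fold n) (fun ω (i : Fin n) => X i ω) P)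
    (hfold_even : ∀ n ω k, n / K ≤ (Finset.univ.filter fun i => fold n ω i = k).card ∧
      (Finset.univ.filter fun i => fold n ω i = k).card ≤ n / K + 1)
    -- nuisance estimators constructed from the data outside of each fold, and their bounds
    (Qhat μhat : CrossFitEstimator S A₁ A₂ T K)
    (hQ_meas : ∀ n p k t s a b, Measurable fun D => Qhat n p k D t s a b)
    (hμ_meas : ∀ n p k t s a b, Measurable fun D => μhat n p k D t s a b)
    (hQ_bound : ∀ n p k D t s a b, |Qhat n p k D t s a b| ≤ ((T : ℝ) - (t : ℕ)) * Rmax)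
    (hμ_bound : ∀ n p k D t s a b,
      0 ≤ μhat n p k D t s a b ∧ μhat n p k D t s a b ≤ C ^ ((t : ℕ) + 1))
    -- rates of convergence in probability
    (α₁ α₂ : ℝ) (hα₁ : 0 < α₁) (hα₂ : 0 < α₂) (hα : 1 / 2 ≤ α₁ + α₂)
    (hQ_rate : ∀ t k, TendstoInMeasure P
      (fun (n : ℕ) ω => (n : ℝ) ^ α₁ * G.l2Norm πb t fun s a b =>
        Qhat n (fold n ω) k (fun j => X j.1 ω) t s a b - G.qValue γ π t s a b)
      atTop (fun _ => 0))
    (hμ_rate : ∀ t k, TendstoInMeasure P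
      (fun (n : ℕ) ω => (n : ℝ) ^ α₂ * G.l2Norm πb t fun s a b =>
        μhat n (fold n ω) k (fun j => X j.1 ω) t s a b - G.marginalRatio πb π t s a b)
      atTop (fun _ => 0)) :
    -- player 1
    TendstoInDistribution
      (fun (n : ℕ) ω => √(n : ℝ) *
        (drlEstimator γ π Qhat μhat n (fold n ω) (fun i => X i ω) - G.value γ π))
      atTop (id : ℝ → ℝ) (fun _ => P) (gaussianReal 0 (G.upsilonEB γ πb π).toNNReal) ∧
    -- player 2
    TendstoInDistribution
      (fun (n : ℕ) ω => √(n : ℝ) *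
        (-drlEstimator γ π Qhat μhat n (fold n ω) (fun i => X i ω) - -G.value γ π))
      atTop (id : ℝ → ℝ) (fun _ => P) (gaussianReal 0 (G.upsilonEB γ πb π).toNNReal) ∧
    -- the asymptotic variance is the efficiency bound
    G.efficiencyBound γ πb π = ENNReal.ofReal (G.upsilonEB γ πb π) := by
  -- Only the qualitative part of overlap is used from here on: at visited states the target profile
  -- plays nothing that the behavior profile never plays.
  have hprob : ∀ t s a b, 0 < G.stateMarginal πb t.castSucc s → πb.prob t s a b = 0 →
      π.prob t s a b = 0 := fun t s a b hs h0 => by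
    have h := hoverlap t s a b hs
    rw [h0, mul_zero] at h
    exact le_antisymm h (π.prob_nonneg t s a b)
  have hR := MarkovGame.rewardBounded_of_ae hreward
  have h1 := G.tendstoInDistribution_drlEstimator hγ₀ hγ₁ hprob hR hX hlaw hindep hfold hfold_indep
    hQ_meas hμ_meas hQ_bound hμ_bound hα₁ hα₂ hα hQ_rate hμ_rate
  refine ⟨h1, ?_, MarkovGame.efficiencyBound_eq γ hprob hR⟩
  convert h1.neg_gaussianReal using 3
  ring
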